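/- Let $n\ge 0$, let $S\subset\{1,\dots,n\}$, and let $\mathcal B(n,S)$ be the Ozsv\'ath--Szab\'o bordered dg algebra over $\mathbb F_2$ for $n$ parallel strands. Explicitly, it has idempotents $I_x$ for $x\subset\{0,\dots,n\}$. For $|x|=|y|$ the space $I_x\mathcal B_0(n)I_y$ has as basis the monomials with weight vector in $\tfrac12|v(x)-v(y)|+\mathbb Z_{\ge0}^n$, where $v_i(x)=\#\{a\in x: a\ge i\}$ and $|\cdot|$ is taken coordinatewise; it is zero if $|x|\ne|y|$; weights add under multiplication of composable monomials. Let $U_i$ be the sum over $x$ of the monomials in $I_x\mathcal B_0(n)I_x$ of weight equal to the $i$-th unit vector. Let $R_i$ (resp. $L_i$) be the sum of the monomials of weight half the $i$-th unit vector that move one dot from region $i-1$ to region $i$ (resp. from $i$ to $i-1$). Then $\mathcal B(n,S)$ is obtained from $\mathcal B_0(n)$ by dividing by the two-sided ideal generated by all $R_iR_{i+1}$, $L_{i+1}L_i$ and $I_xU_i$ with $x\cap\{i-1,i\}=\varnothing$, and then adjoining central elements $C_i$ ($i\in S$) with $C_i^2=0$ and $dC_i=U_i$, where $d$ vanishes on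 the other generators. Its homological grading, which $d$ raises by one, is the sum over $i \in S$ of twice the $i$-th weight, plus the number of factors $C_i$. Its multi-Alexander grading takes values in $M_Y:=H^0(Y;\tfrac14\mathbb Z)\cong(\tfrac14\mathbb Z)^n$, where $Y$ consists of $n$ points and $e_1,\dots,e_n$ is the standard basis (the classes of the negatively oriented points): $R_i$ and $L_i$ have degree $\tfrac12e_i$, and $U_i$ and $C_i$ have degree $e_i$. Let $\mathcal C_r(n,S)$ be the restriction $\big(\sum_x I_x\big)\mathcal B(n,S)\big(\sum_x I_x\big)$ of $\mathcal B(n,S)$ to the idempotents $I_x$ with $x\subset\{1,\dots,n\}$, and let $\mathcal C_l(n,S)$ be the restriction to those with $x\subset\{0,\dots,n-1\}$. Let $\mathcal C$ be $\mathcal C_r(n,S)$ or $\mathcal C_l(n,S)$. Let $M$ be a free abelian group with a homomorphism $f:M_Y\to M$. Let $\mathcal D^b_M(\mathcal C)$ be the triangulated category whose objects are the Type D structures over $\mathcal C$, with a homological grading by $\mathbb Z$ and an intrinsic grading by the $M_Y$-module $M$, that are homotopy equivalent to finitely generated bounded ones, and whose morphisms are the homotopy classes of degree-zero morphisms. Its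 suspension $[1]$ is the downward shift of the homological grading. Its Grothendieck group $K_0(\mathcal D^b_M(\mathcal C))$ is a $\mathbb Z[M]$-module through $m[X]=[X\{-m\}]$, where $\{-\}$ is the downward shift of the intrinsic grading. Let $Q_{I_x}=\mathcal C\cdot I_x$ be the Type D structure with one generator, of bidegree $(0,0)$ and idempotent $I_x$, and with $\delta^1=0$. 1. There are $2^n$ idempotents $I_x$ of $\mathcal C$ as above, and their classes $[Q_{I_x}]$ form a basis of $K_0(\mathcal D^b_M(\mathcal C))$ over $\mathbb Z[M]$. 2. In particular, $K_0(\mathcal D^b_{M_Y}(\mathcal C))$ (taking $M=M_Y$ and $f=\mathrm{id}$) is a free $\mathbb Z[M_Y]$-module of rank $2^n$. 3. There is an isomorphism of $\mathbb Z[M]$-modules $$\mathbb Z[M]\otimes_{\mathbb Z[M_Y]}K_0(\mathcal D^b_{M_Y}(\mathcal C))\;\cong\;K_0(\mathcal D^b_M(\mathcal C)),$$ where $\mathbb Z[M]$ is a $\mathbb Z[M_Y]$-algebra through $f$; it maps $1\otimes[Q_{I_x}]$ to $[Q_{I_x}]$ for all $x$. -/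

import Mathlib

namespace BorderedDecat

noncomputable section

open CategoryTheory

/-- A differential graded algebra over `𝔽₂`, with a homological grading by `ℤ`, an intrinsic
grading by `G`, and a complete family of orthogonal idempotents `e x` of degree `0`
(so it is a dg algebra over the idempotent ring `⨁ x, 𝔽₂ e x`).
The differential raises the homological degree by one; signs play no role over `𝔽₂`. -/
structure DGAlgebra (ι : Type) [Fintype ι] (G : Type) [AddCommGroup G] where
  carrier : Type
  [ring : Ring carrier]
  [algebra : Algebra (ZMod 2) carrier]
  e : ι → carrier
  e_complete : CompleteOrthogonalIdempotents e
  gr : ℤ × G → Submodule (ZMod 2) carrier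
  gr_indep : iSupIndep gr
  gr_span : iSup gr = ⊤
  e_mem : ∀ x, e x ∈ gr 0
  mul_mem : ∀ {p q : ℤ × G} {a b : carrier}, a ∈ gr p → b ∈ gr q → a * b ∈ gr (p + q)
  d : carrier →ₗ[ZMod 2] carrier
  d_mem : ∀ {p : ℤ × G} {a : carrier}, a ∈ gr p → d a ∈ gr (p + (1, 0))
  d_d : ∀ a, d (d a) = 0
  d_mul : ∀ a b, d (a * b) = d a * b + a * d b
  d_e : ∀ x, d (e x) = 0

attribute [instance] DGAlgebra.ring DGAlgebra.algebra

section TypeD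

variable {ι : Type} [Fintype ι] {G : Type} [AddCommGroup G] {M : Type*} [AddCommGroup M]

namespace DGAlgebra

variable (A : DGAlgebra ι G) (f : G →+ M)

/-- The elements of `e x * A * e y` of homological degree `h` and of intrinsic degree `m`, where
intrinsic degrees are pushed forward along `f : G →+ M`. -/
def piece (x y : ι) (h : ℤ) (m : M) : Submodule (ZMod 2) A.carrier where
  carrier := {a | a ∈ (⨆ g : {g : G // f g = m}, A.gr (h, g.1)) ∧ A.e x * a = a ∧ a * A.e y = a}
  add_mem' := by
    rintro a b ⟨h1, h2, h3⟩ ⟨k1, k2, k3⟩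
    exact ⟨add_mem h1 k1, by rw [mul_add, h2, k2], by rw [add_mul, h3, k3]⟩
  zero_mem' := ⟨zero_mem _, by simp, by simp⟩
  smul_mem' := by
    rintro c a ⟨h1, h2, h3⟩
    exact ⟨Submodule.smul_mem _ _ h1, by rw [mul_smul_comm, h2], by rw [smul_mul_assoc, h3]⟩

/-- The degree-one endomorphism `a ⊗ v ↦ d a ⊗ v + a * δ v` of the free left `A`-module on `α`
determined by a map `δ`. -/
def diff {α : Type} (δ : α → α →₀ A.carrier) : (α →₀ A.carrier) →+ (α →₀ A.carrier) :=
  Finsupp.mapRange.addMonoidHom A.d.toAddMonoidHom +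
    (Finsupp.linearCombination A.carrier δ).toAddMonoidHom

variable {A f}

lemma piece_congr {x y : ι} {h h' : ℤ} {m m' : M} {a : A.carrier} (ha : a ∈ A.piece f x y h m)
    (hh : h = h') (hm : m = m') : a ∈ A.piece f x y h' m' := by
  subst hh hm; exact ha

lemma piece_mul {x y z : ι} {h k : ℤ} {m l : M} {a b : A.carrier}
    (ha : a ∈ A.piece f x y h m) (hb : b ∈ A.piece f y z k l) :
    a * b ∈ A.piece f x z (h + k) (m + l) := by
  refine ⟨?_, by rw [← mul_assoc, ha.2.1], by rw [mul_assoc, hb.2.2]⟩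
  refine Submodule.iSup_induction _ (motive := fun a ↦ a * b ∈ _) ha.1 ?_ (by simp) ?_
  · intro g a ha
    refine Submodule.iSup_induction _ (motive := fun b ↦ a * b ∈ _) hb.1 ?_ (by simp) ?_
    · intro g' b hb
      exact Submodule.mem_iSup_of_mem ⟨g.1 + g'.1, by rw [map_add, g.2, g'.2]⟩ (A.mul_mem ha hb)
    · intro b c hb hc
      rw [mul_add]; exact add_mem hb hc
  · intro a c ha hc
    rw [add_mul]; exact add_mem ha hc

lemma piece_e (x : ι) : A.e x ∈ A.piece f x x 0 0 :=
  ⟨Submodule.mem_iSup_of_mem ⟨0, map_zero f⟩ (A.e_mem x), A.e_complete.idem x,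
    A.e_complete.idem x⟩

lemma d_one : A.d 1 = 0 := by
  rw [← A.e_complete.complete, map_sum]
  exact Finset.sum_eq_zero fun x _ ↦ A.d_e x

lemma add_self {α : Type} (v : α →₀ A.carrier) : v + v = 0 := by
  rw [← two_smul (ZMod 2) v, show (2 : ZMod 2) = 0 from rfl, zero_smul]

lemma diff_smul {α : Type} (δ : α → α →₀ A.carrier) (a : A.carrier) (v : α →₀ A.carrier) :
    A.diff δ (a • v) = Finsupp.mapRange.addMonoidHom (AddMonoidHom.mulLeft (A.d a)) v
      + a • A.diff δ v := by
  ext i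
  simp [diff, A.d_mul, add_assoc]

lemma diff_single {α : Type} (δ : α → α →₀ A.carrier) (g : α) (a : A.carrier) :
    A.diff δ (Finsupp.single g a) = Finsupp.single g (A.d a) + a • δ g := by
  simp [diff]

end DGAlgebra

/-- A (left) Type D structure over the dg algebra `A`, with a homological grading by `ℤ` and an
intrinsic grading by `M`, viewed as a module over the grading group of `A` through `f`.
The underlying bigraded vector space over the idempotent ring is presented by a homogeneous basis
`gen`: each generator has an idempotent, a homological degree and an intrinsic degree. The
operation `δ¹ : N → A ⊗ N` is given by `δ¹ g = ∑ g', δ g g' ⊗ g'`; it has degree `(1, 0)`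
and satisfies `(d ⊗ 1) ∘ δ¹ + (μ ⊗ 1) ∘ (1 ⊗ δ¹) ∘ δ¹ = 0`. The set of generators may be infinite,
and no boundedness is assumed. -/
structure TypeD (A : DGAlgebra ι G) (f : G →+ M) where
  gen : Type
  idem : gen → ι
  mas : gen → ℤ
  alex : gen → M
  δ : gen → gen →₀ A.carrier
  δ_mem : ∀ g g', δ g g' ∈
    A.piece f (idem g) (idem g') (mas g + 1 - mas g') (alex g - alex g')
  δ_δ : ∀ g, A.diff δ (δ g) = 0

namespace TypeD

variable {A : DGAlgebra ι G} {f : G →+ M}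

/-- The iterate `(δ¹)ᵏ : N → A^{⊗ k} ⊗ N`, where `A^{⊗ k}` (tensor powers over the idempotent ring)
is regarded as a subspace of the tensor algebra of `A` over `𝔽₂`. -/
def iter (X : TypeD A f) : ℕ → X.gen → (X.gen →₀ TensorAlgebra (ZMod 2) A.carrier)
  | 0, g => Finsupp.single g 1
  | k + 1, g => (X.δ g).sum fun g' a => TensorAlgebra.ι (ZMod 2) a • X.iter k g'

/-- Finitely generated and (operationally) bounded: `(δ¹)ᵏ = 0` for all large `k`. -/
def IsFGBounded (X : TypeD A f) : Prop :=
  Finite X.gen ∧ ∃ k₀, ∀ k ≥ k₀, ∀ g, X.iter k g = 0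

/-- A map `N → A ⊗ N'` compatible with the idempotents, of homological degree `k` and intrinsic
degree `0`. -/
def IsDeg (X Y : TypeD A f) (k : ℤ) (φ : X.gen → Y.gen →₀ A.carrier) : Prop :=
  ∀ g g', φ g g' ∈ A.piece f (X.idem g) (Y.idem g') (X.mas g + k - Y.mas g') (X.alex g - Y.alex g')

/-- The composite `(μ ⊗ 1) ∘ (1 ⊗ ψ) ∘ φ` of `φ : N → A ⊗ N'` and `ψ : N' → A ⊗ N''`. -/
def compFun {α β γ : Type} (φ : α → β →₀ A.carrier) (ψ : β → γ →₀ A.carrier) :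
    α → γ →₀ A.carrier :=
  fun g => Finsupp.linearCombination A.carrier ψ (φ g)

/-- The differential on the morphism complex,
`∂ φ = (d ⊗ 1) ∘ φ + (μ ⊗ 1) ∘ (1 ⊗ δ') ∘ φ + (μ ⊗ 1) ∘ (1 ⊗ φ) ∘ δ`. -/
def bdry (X Y : TypeD A f) (φ : X.gen → Y.gen →₀ A.carrier) : X.gen → Y.gen →₀ A.carrier :=
  fun g => A.diff Y.δ (φ g) + compFun X.δ φ g

/-- A morphism of Type D structures: a cycle of bidegree `(0, 0)` in the morphism complex. -/
@[ext]
structure Hom (X Y : TypeD A f) where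
  toFun : X.gen → Y.gen →₀ A.carrier
  deg : IsDeg X Y 0 toFun
  closed : bdry X Y toFun = 0

/-- The identity `v ↦ 1 ⊗ v` of `N`, as a matrix with entries in `A`. -/
def idFun (A : DGAlgebra ι G) {α : Type} (idem : α → ι) : α → α →₀ A.carrier :=
  fun g => Finsupp.single g (A.e (idem g))

lemma linComb_comp {α β γ : Type} (φ : α → β →₀ A.carrier) (ψ : β → γ →₀ A.carrier)
    (v : α →₀ A.carrier) :
    Finsupp.linearCombination A.carrier (compFun φ ψ) v =
      Finsupp.linearCombination A.carrier ψ (Finsupp.linearCombination A.carrier φ v) := by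
  have : Finsupp.linearCombination A.carrier (compFun φ ψ) =
      Finsupp.linearCombination A.carrier ψ ∘ₗ Finsupp.linearCombination A.carrier φ := by
    ext g : 2
    simp [compFun]
  rw [this]; rfl

lemma isDeg_comp {X Y Z : TypeD A f} {k l : ℤ} {φ : X.gen → Y.gen →₀ A.carrier}
    {ψ : Y.gen → Z.gen →₀ A.carrier} (hφ : IsDeg X Y k φ) (hψ : IsDeg Y Z l ψ) :
    IsDeg X Z (k + l) (compFun φ ψ) := by
  intro g g'
  rw [compFun, Finsupp.linearCombination_apply, Finsupp.sum, Finsupp.finsetSum_apply]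
  refine sum_mem fun i _ ↦ ?_
  exact DGAlgebra.piece_congr (DGAlgebra.piece_mul (hφ g i) (hψ i g')) (by ring) (by abel)

/-- `diff` is compatible with linear extension of morphisms. -/
lemma diff_linComb (X Y : TypeD A f) (φ : X.gen → Y.gen →₀ A.carrier) (v : X.gen →₀ A.carrier) :
    A.diff Y.δ (Finsupp.linearCombination A.carrier φ v) =
      Finsupp.linearCombination A.carrier φ (A.diff X.δ v) +
        Finsupp.linearCombination A.carrier (bdry X Y φ) v := by
  induction v using Finsupp.induction_linear with
  | zero => simp
  | add v w hv hw => simp only [map_add, hv, hw]; abel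
  | single g a =>
    have h2 := A.add_self (a • compFun X.δ φ g)
    simp only [Finsupp.linearCombination_single, DGAlgebra.diff_single, map_add, map_smul, bdry,
      smul_add, DGAlgebra.diff_smul]
    have h1 : Finsupp.mapRange.addMonoidHom (AddMonoidHom.mulLeft (A.d a)) (φ g) = A.d a • φ g := by
      ext; simp
    rw [h1]
    have h3 : a • Finsupp.linearCombination A.carrier φ (X.δ g) = a • compFun X.δ φ g := rfl
    rw [h3]
    calc _ = A.d a • φ g + a • A.diff Y.δ (φ g) + 0 := by rw [add_zero]
      _ = _ := by rw [← h2]; abel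

lemma bdry_comp (X Y Z : TypeD A f) (φ : X.gen → Y.gen →₀ A.carrier)
    (ψ : Y.gen → Z.gen →₀ A.carrier) :
    bdry X Z (compFun φ ψ) = compFun (bdry X Y φ) ψ + compFun φ (bdry Y Z ψ) := by
  funext g
  have h1 : A.diff Z.δ (compFun φ ψ g) = _ := diff_linComb Y Z ψ (φ g)
  have h2 : compFun X.δ (compFun φ ψ) g = _ := linComb_comp φ ψ (X.δ g)
  have h3 : compFun (bdry X Y φ) ψ g = Finsupp.linearCombination A.carrier ψ (A.diff Y.δ (φ g)) +
      Finsupp.linearCombination A.carrier ψ (compFun X.δ φ g) := map_add _ _ _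
  rw [Pi.add_apply, h3]
  change A.diff Z.δ (compFun φ ψ g) + compFun X.δ (compFun φ ψ) g = _
  rw [h1, h2]
  simp only [compFun]
  abel

lemma isDeg_id (X : TypeD A f) : IsDeg X X 0 (idFun A X.idem) := by
  intro g g'
  classical
  rw [idFun, Finsupp.single_apply]
  split_ifs with h
  · subst h
    exact DGAlgebra.piece_congr (DGAlgebra.piece_e _) (by ring) (by abel)
  · exact zero_mem _

lemma linComb_id {α : Type} (idem : α → ι) (v : α →₀ A.carrier)
    (hv : ∀ g, v g * A.e (idem g) = v g) :
    Finsupp.linearCombination A.carrier (idFun A idem) v = v := by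
  conv_rhs => rw [← Finsupp.sum_single v]
  rw [Finsupp.linearCombination_apply]
  refine Finsupp.sum_congr fun g _ ↦ ?_
  simp [idFun, hv]

lemma smul_eq_of_left {α : Type} (x : ι) (v : α →₀ A.carrier)
    (hv : ∀ g, A.e x * v g = v g) : A.e x • v = v := by
  ext g
  simpa using hv g

lemma comp_id {X Y : TypeD A f} {k : ℤ} {φ : X.gen → Y.gen →₀ A.carrier} (hφ : IsDeg X Y k φ) :
    compFun φ (idFun A Y.idem) = φ := by
  funext g
  exact linComb_id _ _ fun g' ↦ (hφ g g').2.2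

lemma id_comp {X Y : TypeD A f} {k : ℤ} {φ : X.gen → Y.gen →₀ A.carrier} (hφ : IsDeg X Y k φ) :
    compFun (idFun A X.idem) φ = φ := by
  funext g
  rw [compFun, idFun, Finsupp.linearCombination_single]
  exact smul_eq_of_left _ _ fun g' ↦ (hφ g g').2.1

lemma isDeg_δ (X : TypeD A f) : IsDeg X X 1 X.δ := X.δ_mem

lemma bdry_id (X : TypeD A f) : bdry X X (idFun A X.idem) = 0 := by
  funext g
  have h1 := congrFun (comp_id X.isDeg_δ) g
  have h2 := congrFun (id_comp X.isDeg_δ) g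
  simp only [bdry, h1]
  rw [idFun, DGAlgebra.diff_single, A.d_e]
  rw [compFun, idFun, Finsupp.linearCombination_single] at h2
  rw [h2]
  simpa using A.add_self (X.δ g)

instance : Category (TypeD A f) where
  Hom := Hom
  id X := ⟨idFun A X.idem, isDeg_id X, bdry_id X⟩
  comp {X Y Z} φ ψ := ⟨compFun φ.toFun ψ.toFun, by simpa using isDeg_comp φ.deg ψ.deg, by
    rw [bdry_comp, φ.closed, ψ.closed]
    funext g
    simp [compFun, Finsupp.linearCombination_apply]⟩
  id_comp φ := Hom.ext (id_comp φ.deg)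
  comp_id φ := Hom.ext (comp_id φ.deg)
  assoc φ ψ χ := Hom.ext (funext fun _ ↦ (linComb_comp _ _ _).symm)

/-- Homotopy of morphisms: `φ` and `ψ` differ by `∂ h`, with `h` of bidegree `(-1, 0)`. -/
def homotopic (A : DGAlgebra ι G) (f : G →+ M) : HomRel (TypeD A f) :=
  fun X Y φ ψ => ∃ h : X.gen → Y.gen →₀ A.carrier,
    IsDeg X Y (-1) h ∧ φ.toFun = ψ.toFun + bdry X Y h

lemma comp_toFun {X Y Z : TypeD A f} (φ : X ⟶ Y) (ψ : Y ⟶ Z) :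
    (φ ≫ ψ).toFun = compFun φ.toFun ψ.toFun := rfl

lemma compFun_add_left {α β γ : Type} (φ φ' : α → β →₀ A.carrier) (ψ : β → γ →₀ A.carrier) :
    compFun (φ + φ') ψ = compFun φ ψ + compFun φ' ψ :=
  funext fun _ ↦ map_add _ _ _

lemma compFun_add_right {α β γ : Type} (φ : α → β →₀ A.carrier) (ψ ψ' : β → γ →₀ A.carrier) :
    compFun φ (ψ + ψ') = compFun φ ψ + compFun φ ψ' := by
  funext g
  simp [compFun, Finsupp.linearCombination_apply, smul_add, Finsupp.sum_add]

lemma compFun_zero_left {α β γ : Type} (ψ : β → γ →₀ A.carrier) :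
    compFun (0 : α → β →₀ A.carrier) ψ = 0 :=
  funext fun _ ↦ map_zero _

lemma compFun_zero_right {α β γ : Type} (φ : α → β →₀ A.carrier) :
    compFun φ (0 : β → γ →₀ A.carrier) = 0 := by
  funext g
  simp [compFun]

lemma bdry_add (X Y : TypeD A f) (h k : X.gen → Y.gen →₀ A.carrier) :
    bdry X Y (h + k) = bdry X Y h + bdry X Y k := by
  funext g
  have := congrFun (compFun_add_right X.δ h k) g
  simp only [bdry, Pi.add_apply, map_add, this]
  abel

lemma bdry_zero (X Y : TypeD A f) : bdry X Y 0 = 0 := by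
  funext g
  simp [bdry, compFun_zero_right]

lemma fun_add_self {α β : Type} (h : α → β →₀ A.carrier) : h + h = 0 :=
  funext fun g ↦ A.add_self (h g)

/-- Homotopy is a congruence, so morphisms of the quotient category below are exactly homotopy
classes. -/
instance : Congruence (homotopic A f) where
  equivalence {X Y} :=
    { refl := fun φ ↦ ⟨0, fun _ _ ↦ zero_mem _, by rw [bdry_zero, add_zero]⟩
      symm := by
        rintro φ ψ ⟨h, hh, e⟩
        exact ⟨h, hh, by rw [e, add_assoc, fun_add_self, add_zero]⟩
      trans := by
        rintro φ ψ χ ⟨h, hh, e⟩ ⟨k, hk, e'⟩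
        exact ⟨k + h, fun g g' ↦ add_mem (hk g g') (hh g g'),
          by rw [e, e', bdry_add, add_assoc]⟩ }
  comp_left := by
    rintro X Y Z φ ψ ψ' ⟨h, hh, e⟩
    refine ⟨compFun φ.toFun h, by simpa using isDeg_comp φ.deg hh, ?_⟩
    rw [comp_toFun, comp_toFun, e, compFun_add_right, bdry_comp, φ.closed, compFun_zero_left,
      zero_add]
  comp_right := by
    rintro X Y Z φ φ' ψ ⟨h, hh, e⟩
    refine ⟨compFun h ψ.toFun, by simpa using isDeg_comp hh ψ.deg, ?_⟩
    rw [comp_toFun, comp_toFun, e, compFun_add_left, bdry_comp, ψ.closed, compFun_zero_right,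
      add_zero]

/-- The shift `X[1]`: homological degrees are shifted downwards by one. -/
def susp (X : TypeD A f) : TypeD A f where
  gen := X.gen
  idem := X.idem
  mas g := X.mas g - 1
  alex := X.alex
  δ := X.δ
  δ_mem g g' := DGAlgebra.piece_congr (X.δ_mem g g') (by ring) rfl
  δ_δ := X.δ_δ

/-- The intrinsic shift `X{-m}`: since `{-}` shifts downwards, the intrinsic degrees are raised
by `m`. -/
def twist (m : M) (X : TypeD A f) : TypeD A f where
  gen := X.gen
  idem := X.idem
  mas := X.mas
  alex g := X.alex g + m
  δ := X.δ
  δ_mem g g' := DGAlgebra.piece_congr (X.δ_mem g g') rfl (by abel)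
  δ_δ := X.δ_δ

/-- The shift `[1]` as a functor. -/
def suspFunctor (A : DGAlgebra ι G) (f : G →+ M) : TypeD A f ⥤ TypeD A f where
  obj := susp
  map φ := ⟨φ.toFun, fun g g' ↦ DGAlgebra.piece_congr (φ.deg g g')
    (by simp only [susp]; ring) rfl, φ.closed⟩

/-- The intrinsic shift `{-m}` as a functor. -/
def twistFunctor (A : DGAlgebra ι G) (f : G →+ M) (m : M) : TypeD A f ⥤ TypeD A f where
  obj := twist m
  map φ := ⟨φ.toFun, fun g g' ↦ DGAlgebra.piece_congr (φ.deg g g') rfl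
    (by simp only [twist]; abel), φ.closed⟩

lemma linComb_sumElim_inl {α β γ : Type} (φ : α → γ →₀ A.carrier) (ψ : β → γ →₀ A.carrier)
    (v : α →₀ A.carrier) (w : β →₀ A.carrier) :
    Finsupp.linearCombination A.carrier (Sum.elim φ ψ) (Finsupp.sumElim v w) =
      Finsupp.linearCombination A.carrier φ v + Finsupp.linearCombination A.carrier ψ w := by
  rw [Finsupp.sumElim_eq_add, map_add, Finsupp.linearCombination_mapDomain,
    Finsupp.linearCombination_mapDomain]
  rfl

/-- The operation `δ¹` of a mapping cone. -/
def coneδ {X Y : TypeD A f} (φ : X ⟶ Y) : X.gen ⊕ Y.gen → (X.gen ⊕ Y.gen →₀ A.carrier) :=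
  Sum.elim (fun g => Finsupp.sumElim (X.δ g) (φ.toFun g)) (fun g => Finsupp.sumElim 0 (Y.δ g))

lemma diff_coneδ {X Y : TypeD A f} (φ : X ⟶ Y) (v : X.gen →₀ A.carrier) (w : Y.gen →₀ A.carrier) :
    A.diff (coneδ φ) (Finsupp.sumElim v w) = Finsupp.sumElim (A.diff X.δ v)
      (Finsupp.linearCombination A.carrier φ.toFun v + A.diff Y.δ w) := by
  have h1 : ∀ v : X.gen →₀ A.carrier, Finsupp.linearCombination A.carrier
      (fun g ↦ Finsupp.sumElim (X.δ g) (φ.toFun g)) v = Finsupp.sumElim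
        (Finsupp.linearCombination A.carrier X.δ v)
        (Finsupp.linearCombination A.carrier φ.toFun v) := by
    intro v
    induction v using Finsupp.induction_linear with
    | zero => simp
    | add v w hv hw => simp only [map_add, hv, hw, Finsupp.sumElim_add]
    | single g a => ext (i | i) <;> simp
  have h2 : ∀ w : Y.gen →₀ A.carrier, Finsupp.linearCombination A.carrier
      (fun g ↦ Finsupp.sumElim (0 : X.gen →₀ A.carrier) (Y.δ g)) w = Finsupp.sumElim 0
        (Finsupp.linearCombination A.carrier Y.δ w) := by
    intro w
    induction w using Finsupp.induction_linear with
    | zero => simp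
    | add v w hv hw => rw [map_add, hv, hw, map_add, ← Finsupp.sumElim_add, add_zero]
    | single g a => ext (i | i) <;> simp
  have h3 : A.diff (coneδ φ) (Finsupp.sumElim v w) =
      Finsupp.mapRange.addMonoidHom A.d.toAddMonoidHom (Finsupp.sumElim v w) +
      Finsupp.linearCombination A.carrier (coneδ φ) (Finsupp.sumElim v w) := rfl
  rw [h3, coneδ, linComb_sumElim_inl, h1, h2]
  ext (i | i) <;> simp [DGAlgebra.diff, add_comm, add_left_comm]

/-- The mapping cone `X[1] ⊕ Y` of a morphism `φ : X ⟶ Y`, with operation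
`(x, y) ↦ (δ x, φ x + δ y)`. -/
def cone {X Y : TypeD A f} (φ : X ⟶ Y) : TypeD A f where
  gen := X.gen ⊕ Y.gen
  idem := Sum.elim X.idem Y.idem
  mas := Sum.elim (fun g => X.mas g - 1) Y.mas
  alex := Sum.elim X.alex Y.alex
  δ := coneδ φ
  δ_mem := by
    rintro (g | g) (g' | g')
    · exact DGAlgebra.piece_congr (X.δ_mem g g')
        (by simp only [Sum.elim_inl]; ring) rfl
    · exact DGAlgebra.piece_congr (φ.deg g g') (by simp) rfl
    · exact zero_mem _
    · exact DGAlgebra.piece_congr (Y.δ_mem g g') (by simp) rfl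
  δ_δ := by
    rintro (g | g)
    · have h1 := congrFun φ.closed g
      change A.diff Y.δ (φ.toFun g) + Finsupp.linearCombination A.carrier φ.toFun (X.δ g) = 0 at h1
      change A.diff (coneδ φ) (Finsupp.sumElim (X.δ g) (φ.toFun g)) = 0
      rw [diff_coneδ, X.δ_δ, add_comm, h1]
      simp
    · change A.diff (coneδ φ) (Finsupp.sumElim 0 (Y.δ g)) = 0
      rw [diff_coneδ, Y.δ_δ]
      simp

lemma e_smul_δ (X : TypeD A f) (g : X.gen) : A.e (X.idem g) • X.δ g = X.δ g :=
  smul_eq_of_left _ _ fun g' ↦ (X.δ_mem g g').2.1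

/-- The underlying map of the inclusion of `Y` into the mapping cone. -/
def coneInrFun (X Y : TypeD A f) : Y.gen → (X.gen ⊕ Y.gen →₀ A.carrier) :=
  fun g => Finsupp.single (Sum.inr g) (A.e (Y.idem g))

lemma linComb_coneInrFun (X Y : TypeD A f) (v : Y.gen →₀ A.carrier) :
    Finsupp.linearCombination A.carrier (coneInrFun X Y) v =
      Finsupp.sumElim 0 (Finsupp.linearCombination A.carrier (idFun A Y.idem) v) := by
  induction v using Finsupp.induction_linear with
  | zero => simp
  | add v w hv hw => rw [map_add, hv, hw, map_add, ← Finsupp.sumElim_add, add_zero]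
  | single g a =>
    rw [Finsupp.linearCombination_single, Finsupp.linearCombination_single, coneInrFun, idFun,
      Finsupp.smul_single, Finsupp.smul_single, Finsupp.sumElim_zero_single]

lemma bdry_coneInrFun {X Y : TypeD A f} (φ : X ⟶ Y) (g : Y.gen) :
    A.diff (coneδ φ) (coneInrFun X Y g) + compFun Y.δ (coneInrFun X Y) g = 0 := by
  have h : compFun Y.δ (coneInrFun X Y) g = Finsupp.sumElim 0 (compFun Y.δ (idFun A Y.idem) g) :=
    linComb_coneInrFun X Y (Y.δ g)
  have h2 : A.e (Y.idem g) • Finsupp.sumElim (0 : X.gen →₀ A.carrier) (Y.δ g) =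
      Finsupp.sumElim 0 (Y.δ g) := by
    conv_rhs => rw [← Y.e_smul_δ g]
    ext (i | i) <;> simp
  rw [h, congrFun (comp_id Y.isDeg_δ) g, coneInrFun, DGAlgebra.diff_single, A.d_e,
    Finsupp.single_zero, zero_add]
  change A.e (Y.idem g) • Finsupp.sumElim (0 : X.gen →₀ A.carrier) (Y.δ g) + _ = 0
  rw [h2]
  exact A.add_self _

/-- The inclusion of `Y` into the mapping cone of `φ : X ⟶ Y`. -/
def coneInr {X Y : TypeD A f} (φ : X ⟶ Y) : Y ⟶ cone φ where
  toFun := coneInrFun X Y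
  deg := fun g g' ↦ isDeg_id (cone φ) (Sum.inr g) g'
  closed := funext fun g ↦ bdry_coneInrFun φ g

/-- The underlying map of the projection of the mapping cone onto `X[1]`. -/
def coneFstFun (X Y : TypeD A f) : X.gen ⊕ Y.gen → (X.gen →₀ A.carrier) :=
  Sum.elim (fun g => Finsupp.single g (A.e (X.idem g))) (fun _ => 0)

lemma linComb_coneFstFun (X Y : TypeD A f) (v : X.gen →₀ A.carrier) (w : Y.gen →₀ A.carrier) :
    Finsupp.linearCombination A.carrier (coneFstFun X Y) (Finsupp.sumElim v w) =
      Finsupp.linearCombination A.carrier (idFun A X.idem) v := by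
  rw [coneFstFun, linComb_sumElim_inl]
  rw [show Finsupp.linearCombination A.carrier (fun _ : Y.gen ↦ (0 : X.gen →₀ A.carrier)) w = 0 by
    simp [Finsupp.linearCombination_apply], add_zero]
  rfl

lemma bdry_coneFstFun {X Y : TypeD A f} (φ : X ⟶ Y) (g : X.gen ⊕ Y.gen) :
    A.diff X.δ (coneFstFun X Y g) + compFun (coneδ φ) (coneFstFun X Y) g = 0 := by
  rcases g with g | g
  · have h : compFun (coneδ φ) (coneFstFun X Y) (Sum.inl g) = compFun X.δ (idFun A X.idem) g :=
      linComb_coneFstFun X Y (X.δ g) (φ.toFun g)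
    rw [h]
    exact congrFun (bdry_id X) g
  · have h : compFun (coneδ φ) (coneFstFun X Y) (Sum.inr g) =
        Finsupp.linearCombination A.carrier (idFun A X.idem) 0 :=
      linComb_coneFstFun X Y 0 (Y.δ g)
    rw [h, map_zero, add_zero]
    exact map_zero _

/-- The projection of the mapping cone of `φ : X ⟶ Y` onto `X[1]`. -/
def coneFst {X Y : TypeD A f} (φ : X ⟶ Y) : cone φ ⟶ susp X where
  toFun := coneFstFun X Y
  deg := by
    rintro (g | g) g'
    · exact isDeg_id (susp X) g g'
    · exact zero_mem _
  closed := funext fun g ↦ bdry_coneFstFun φ g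

lemma cone_twist_alex (m : M) {X Y : TypeD A f} (φ : X ⟶ Y) (g : X.gen ⊕ Y.gen) :
    (cone ((twistFunctor A f m).map φ)).alex g = (cone φ).alex g + m := by
  cases g <;> rfl

lemma idFun_comp_idFun (X : TypeD A f) :
    compFun (idFun A X.idem) (idFun A X.idem) = idFun A X.idem :=
  comp_id (isDeg_id X)

lemma cone_twist_isDeg (m : M) {X Y : TypeD A f} (φ : X ⟶ Y) :
    IsDeg (twist m (cone φ)) (cone ((twistFunctor A f m).map φ)) 0 (idFun A (cone φ).idem) := by
  intro g g'
  have h := cone_twist_alex m φ g'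
  refine DGAlgebra.piece_congr (isDeg_id (cone φ) g g') rfl ?_
  refine Eq.trans ?_ (congrArg (fun z ↦ ((cone φ).alex g + m) - z) h.symm)
  exact (add_sub_add_right_eq_sub _ _ _).symm

lemma cone_twist_isDeg' (m : M) {X Y : TypeD A f} (φ : X ⟶ Y) :
    IsDeg (cone ((twistFunctor A f m).map φ)) (twist m (cone φ)) 0 (idFun A (cone φ).idem) := by
  intro g g'
  have h := cone_twist_alex m φ g
  refine DGAlgebra.piece_congr (isDeg_id (cone φ) g g') rfl ?_
  refine Eq.trans ?_ (congrArg (fun z ↦ z - ((cone φ).alex g' + m)) h.symm)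
  exact (add_sub_add_right_eq_sub _ _ _).symm

/-- Intrinsic shifts commute with mapping cones. -/
def twistConeHom (m : M) {X Y : TypeD A f} (φ : X ⟶ Y) :
    twist m (cone φ) ⟶ cone ((twistFunctor A f m).map φ) :=
  ⟨idFun A (cone φ).idem, cone_twist_isDeg m φ, bdry_id (cone φ)⟩

/-- The inverse of `twistConeHom`. -/
def twistConeInv (m : M) {X Y : TypeD A f} (φ : X ⟶ Y) :
    cone ((twistFunctor A f m).map φ) ⟶ twist m (cone φ) :=
  ⟨idFun A (cone φ).idem, cone_twist_isDeg' m φ, bdry_id (cone φ)⟩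

/-- Intrinsic shifts commute with mapping cones. -/
def twistCone (m : M) {X Y : TypeD A f} (φ : X ⟶ Y) :
    twist m (cone φ) ≅ cone ((twistFunctor A f m).map φ) where
  hom := twistConeHom m φ
  inv := twistConeInv m φ
  hom_inv_id := Hom.ext (idFun_comp_idFun (cone φ))
  inv_hom_id := Hom.ext (idFun_comp_idFun (cone φ))

lemma coneInr_twist (m : M) {X Y : TypeD A f} (φ : X ⟶ Y) :
    (twistFunctor A f m).map (coneInr φ) ≫ (twistCone m φ).hom =
      coneInr ((twistFunctor A f m).map φ) := by
  have h : compFun (coneInr φ).toFun (idFun A (cone φ).idem) = (coneInr φ).toFun :=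
    comp_id (coneInr φ).deg
  exact Hom.ext h

lemma coneFst_twist (m : M) {X Y : TypeD A f} (φ : X ⟶ Y) :
    (twistCone m φ).hom ≫ coneFst ((twistFunctor A f m).map φ) =
      (twistFunctor A f m).map (coneFst φ) := by
  have h : compFun (idFun A (cone φ).idem) (coneFst φ).toFun = (coneFst φ).toFun :=
    id_comp (coneFst φ).deg
  exact Hom.ext h

lemma iter_twist (m : M) (X : TypeD A f) (k : ℕ) : (X.twist m).iter k = X.iter k := by
  induction k with
  | zero => rfl
  | succ k ih => funext g; simp only [iter, ih]; rfl

lemma twist_zero (X : TypeD A f) : X.twist 0 = X := by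
  cases X; simp [twist]

lemma twist_twist (m m' : M) (X : TypeD A f) : (X.twist m).twist m' = X.twist (m + m') := by
  simp [twist, add_assoc]

end TypeD

/-- The homotopy category of Type D structures over `A` with intrinsic gradings by `M`. -/
abbrev HoTypeD (A : DGAlgebra ι G) (f : G →+ M) := CategoryTheory.Quotient (TypeD.homotopic A f)

namespace HoTypeD

/-- The functor from Type D structures to their homotopy category. -/
abbrev of (A : DGAlgebra ι G) (f : G →+ M) : TypeD A f ⥤ HoTypeD A f :=
  CategoryTheory.Quotient.functor _

variable (A : DGAlgebra ι G) (f : G →+ M)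

/-- The shift functor `[1]` of the homotopy category. -/
def susp : HoTypeD A f ⥤ HoTypeD A f :=
  CategoryTheory.Quotient.lift _ (TypeD.suspFunctor A f ⋙ of A f) <| by
    rintro X Y φ ψ ⟨h, hh, e⟩
    exact CategoryTheory.Quotient.sound _ ⟨h, fun g g' ↦ DGAlgebra.piece_congr (hh g g')
      (by simp only [TypeD.suspFunctor, TypeD.susp]; ring) rfl, e⟩

/-- The intrinsic shift functor `{-m}` of the homotopy category. -/
def twist (m : M) : HoTypeD A f ⥤ HoTypeD A f :=
  CategoryTheory.Quotient.lift _ (TypeD.twistFunctor A f m ⋙ of A f) <| by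
    rintro X Y φ ψ ⟨h, hh, e⟩
    exact CategoryTheory.Quotient.sound _ ⟨h, fun g g' ↦ DGAlgebra.piece_congr (hh g g')
      rfl (by simp only [TypeD.twistFunctor, TypeD.twist]; abel), e⟩

variable {A f}

/-- A triangle `X ⟶ Y ⟶ Z ⟶ X[1]` is distinguished if it is isomorphic to the triangle
`X' ⟶ Y' ⟶ cone φ ⟶ X'[1]` of a morphism `φ` of Type D structures. -/
def IsDistinguished {X Y Z : HoTypeD A f} (u : X ⟶ Y) (v : Y ⟶ Z) (w : Z ⟶ (susp A f).obj X) :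
    Prop :=
  ∃ (X' Y' : TypeD A f) (φ : X' ⟶ Y') (a : X ≅ (of A f).obj X') (b : Y ≅ (of A f).obj Y')
    (c : Z ≅ (of A f).obj (TypeD.cone φ)),
    u ≫ b.hom = a.hom ≫ (of A f).map φ ∧
    v ≫ c.hom = b.hom ≫ (of A f).map (TypeD.coneInr φ) ∧
    w ≫ (susp A f).map a.hom = c.hom ≫ (of A f).map (TypeD.coneFst φ)

end HoTypeD

/-- The objects of `D^b_M(A)`: Type D structures over `A`, with intrinsic gradings by `M`, which are
homotopy equivalent to finitely generated bounded ones. -/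
def isDb (A : DGAlgebra ι G) (f : G →+ M) : ObjectProperty (HoTypeD A f) :=
  fun X => ∃ Y : TypeD A f, Y.IsFGBounded ∧ Nonempty (X ≅ (HoTypeD.of A f).obj Y)

/-- The triangulated category `D^b_M(A)`, a full subcategory of the homotopy category. -/
abbrev Db (A : DGAlgebra ι G) (f : G →+ M) := (isDb A f).FullSubcategory

/-- The isomorphism class of an object of `D^b_M(A)`, as a generator of a free abelian group. -/
def Db.cls {A : DGAlgebra ι G} {f : G →+ M} (X : Db A f) :
    FreeAbelianGroup (_root_.Quotient (isIsomorphicSetoid (Db A f))) :=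
  FreeAbelianGroup.of (Quotient.mk (isIsomorphicSetoid (Db A f)) X)

/-- The relations `[X] + [Z] - [Y]`, for the distinguished triangles `X ⟶ Y ⟶ Z ⟶ X[1]` of
`D^b_M(A)`. -/
def K0Relations (A : DGAlgebra ι G) (f : G →+ M) :
    AddSubgroup (FreeAbelianGroup (_root_.Quotient (isIsomorphicSetoid (Db A f)))) :=
  AddSubgroup.closure {r | ∃ (X Y Z : Db A f) (u : X.obj ⟶ Y.obj) (v : Y.obj ⟶ Z.obj)
    (w : Z.obj ⟶ (HoTypeD.susp A f).obj X.obj),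
    HoTypeD.IsDistinguished u v w ∧ r = X.cls + Z.cls - Y.cls}

/-- The Grothendieck group of `D^b_M(A)`. -/
def K0 (A : DGAlgebra ι G) (f : G →+ M) :=
  FreeAbelianGroup (_root_.Quotient (isIsomorphicSetoid (Db A f))) ⧸ K0Relations A f

instance (A : DGAlgebra ι G) (f : G →+ M) : AddCommGroup (K0 A f) :=
  inferInstanceAs (AddCommGroup (_ ⧸ K0Relations A f))

namespace K0

variable {A : DGAlgebra ι G} {f : G →+ M}

/-- The class in the Grothendieck group of an object of `D^b_M(A)`. -/
def mk (X : Db A f) : K0 A f := QuotientAddGroup.mk X.cls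

lemma twist_susp_map (m : M) {X Y : HoTypeD A f} (g : X ⟶ Y) :
    (HoTypeD.twist A f m).map ((HoTypeD.susp A f).map g) =
      (HoTypeD.susp A f).map ((HoTypeD.twist A f m).map g) := by
  obtain ⟨g, rfl⟩ := (HoTypeD.of A f).map_surjective g
  rfl

lemma glue_inr {C : Type*} [Category C] {Y Z Y' K K' : C} {v : Y ⟶ Z} {c : Z ⟶ K} {b : Y ⟶ Y'}
    {i : Y' ⟶ K} {t : K ⟶ K'} {i' : Y' ⟶ K'} (h : v ≫ c = b ≫ i) (ht : i ≫ t = i') :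
    v ≫ c ≫ t = b ≫ i' := by
  rw [← ht, ← Category.assoc, h, Category.assoc]

lemma glue_fst {C : Type*} [Category C] {Z S S' K K' : C} {w : Z ⟶ S} {s : S ⟶ S'} {c : Z ⟶ K}
    {p : K ⟶ S'} {t : K ⟶ K'} {p' : K' ⟶ S'} (h : w ≫ s = c ≫ p) (ht : t ≫ p' = p) :
    w ≫ s = (c ≫ t) ≫ p' := by
  rw [h, Category.assoc, ht]

/-- The intrinsic shift of a triangle. -/
def twistThird (m : M) {X Z : HoTypeD A f} (w : Z ⟶ (HoTypeD.susp A f).obj X) :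
    (HoTypeD.twist A f m).obj Z ⟶ (HoTypeD.susp A f).obj ((HoTypeD.twist A f m).obj X) :=
  (HoTypeD.twist A f m).map w

lemma isDistinguished_twist (m : M) {X Y Z : HoTypeD A f} {u : X ⟶ Y} {v : Y ⟶ Z}
    {w : Z ⟶ (HoTypeD.susp A f).obj X} (h : HoTypeD.IsDistinguished u v w) :
    HoTypeD.IsDistinguished ((HoTypeD.twist A f m).map u) ((HoTypeD.twist A f m).map v)
      (twistThird m w) := by
  obtain ⟨X', Y', φ, a, b, c, h1, h2, h3⟩ := h
  have e1 := (HoTypeD.twist A f m).map_comp u b.hom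
  have e1' := (HoTypeD.twist A f m).map_comp a.hom ((HoTypeD.of A f).map φ)
  have e2 := (HoTypeD.twist A f m).map_comp v c.hom
  have e2' := (HoTypeD.twist A f m).map_comp b.hom ((HoTypeD.of A f).map (TypeD.coneInr φ))
  have e3 := (HoTypeD.twist A f m).map_comp w ((HoTypeD.susp A f).map a.hom)
  have e3' := (HoTypeD.twist A f m).map_comp c.hom ((HoTypeD.of A f).map (TypeD.coneFst φ))
  rw [twist_susp_map] at e3
  have t2 := congrArg (HoTypeD.of A f).map (TypeD.coneInr_twist m φ)
  have t3 := congrArg (HoTypeD.of A f).map (TypeD.coneFst_twist m φ)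
  have k3 := e3.symm.trans ((congrArg (HoTypeD.twist A f m).map h3).trans e3')
  refine ⟨X'.twist m, Y'.twist m, (TypeD.twistFunctor A f m).map φ,
    (HoTypeD.twist A f m).mapIso a, (HoTypeD.twist A f m).mapIso b,
    (HoTypeD.twist A f m).mapIso c ≪≫ (HoTypeD.of A f).mapIso (TypeD.twistCone m φ), ?_, ?_, ?_⟩
  · exact e1.symm.trans ((congrArg (HoTypeD.twist A f m).map h1).trans e1')
  · exact glue_inr (e2.symm.trans ((congrArg (HoTypeD.twist A f m).map h2).trans e2')) t2
  · exact glue_fst k3 t3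

lemma isDb_twist (m : M) {X : HoTypeD A f} (h : isDb A f X) :
    isDb A f ((HoTypeD.twist A f m).obj X) := by
  obtain ⟨Y, ⟨hY, k₀, hk⟩, ⟨e⟩⟩ := h
  refine ⟨Y.twist m, ⟨hY, k₀, ?_⟩, ⟨(HoTypeD.twist A f m).mapIso e⟩⟩
  intro k hk' g
  rw [TypeD.iter_twist]
  exact hk k hk' g

/-- The intrinsic shift `{-m}` on objects of `D^b_M(A)`. -/
def twistObj (m : M) (X : Db A f) : Db A f := ⟨(HoTypeD.twist A f m).obj X.obj,
  isDb_twist m X.property⟩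

/-- The endomorphism `[X] ↦ [X{-m}]` of the Grothendieck group. -/
def act (m : M) : K0 A f →+ K0 A f :=
  QuotientAddGroup.map (K0Relations A f) (K0Relations A f)
    (FreeAbelianGroup.map (Quotient.map (sa := isIsomorphicSetoid (Db A f))
      (sb := isIsomorphicSetoid (Db A f)) (twistObj m)
      fun _ _ ⟨i⟩ ↦ ⟨(isDb A f).isoMk ((HoTypeD.twist A f m).mapIso ((isDb A f).ι.mapIso i))⟩)) <| by
    rw [K0Relations, AddSubgroup.closure_le]
    rintro _ ⟨X, Y, Z, u, v, w, h, rfl⟩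
    refine AddSubgroup.subset_closure ⟨twistObj m X, twistObj m Y, twistObj m Z, _, _, _,
      isDistinguished_twist m h, ?_⟩
    simp only [map_sub, map_add, Db.cls, FreeAbelianGroup.map_of_apply]
    rfl

lemma act_mk (m : M) (X : Db A f) : act m (mk X) = mk (twistObj m X) := rfl

lemma twistObj_zero (X : Db A f) : twistObj 0 X = X :=
  ObjectProperty.FullSubcategory.ext (CategoryTheory.Quotient.ext (TypeD.twist_zero X.obj.as))

lemma twistObj_add (m m' : M) (X : Db A f) : twistObj (m + m') X = twistObj m' (twistObj m X) :=
  ObjectProperty.FullSubcategory.ext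
    (CategoryTheory.Quotient.ext (TypeD.twist_twist m m' X.obj.as).symm)

lemma hom_ext {B : Type*} [AddCommGroup B] {φ ψ : K0 A f →+ B} (h : ∀ X, φ (mk X) = ψ (mk X)) :
    φ = ψ := by
  refine QuotientAddGroup.addMonoidHom_ext _ ?_
  ext x
  induction x using Quotient.inductionOn with
  | h X => exact h X

/-- The action of `M` on the Grothendieck group, as a monoid homomorphism. -/
def actHom (A : DGAlgebra ι G) (f : G →+ M) : Multiplicative M →* Module.End ℤ (K0 A f) where
  toFun m := (act m.toAdd).toIntLinearMap
  map_one' := by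
    have h : act (A := A) (f := f) (0 : M) = AddMonoidHom.id _ :=
      hom_ext fun X ↦ by rw [act_mk, twistObj_zero]; rfl
    ext x
    exact DFunLike.congr_fun h x
  map_mul' m m' := by
    have h : act (A := A) (f := f) (m.toAdd + m'.toAdd) = (act m.toAdd).comp (act m'.toAdd) :=
      hom_ext fun X ↦ by
        rw [act_mk, add_comm, twistObj_add]; rfl
    ext x
    exact DFunLike.congr_fun h x

/-- The `ℤ[M]`-module structure on `K₀(D^b_M(A))` with `m • [X] = [X{-m}]`. -/
instance : Module (AddMonoidAlgebra ℤ M) (K0 A f) :=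
  Module.compHom (K0 A f) (AddMonoidAlgebra.lift ℤ _ M (actHom A f)).toRingHom

lemma single_smul_mk (m : M) (X : Db A f) :
    (AddMonoidAlgebra.single m 1 : AddMonoidAlgebra ℤ M) • mk X = mk (twistObj m X) := by
  change AddMonoidAlgebra.lift ℤ _ M (actHom A f) (AddMonoidAlgebra.single m 1) (mk X) = _
  rw [AddMonoidAlgebra.lift_single, one_smul]
  exact act_mk m X

end K0

end TypeD

section Elementary

variable {ι : Type} [Fintype ι] {G : Type} [AddCommGroup G] {M : Type*} [AddCommGroup M]

/-- The Type D structure `Q_x = A · e x`: one generator, with idempotent `e x` and bidegree `(0, 0)`,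
and `δ¹ = 0`. -/
def TypeD.Q (A : DGAlgebra ι G) (f : G →+ M) (x : ι) : TypeD A f where
  gen := Unit
  idem _ := x
  mas _ := 0
  alex _ := 0
  δ _ := 0
  δ_mem _ _ := zero_mem _
  δ_δ _ := map_zero _

lemma TypeD.Q_isFGBounded (A : DGAlgebra ι G) (f : G →+ M) (x : ι) :
    (TypeD.Q A f x).IsFGBounded := by
  refine ⟨inferInstanceAs (Finite Unit), 1, fun k hk g ↦ ?_⟩
  obtain ⟨k, rfl⟩ := Nat.exists_eq_add_of_le' hk
  rfl

/-- `Q_x` as an object of `D^b_M(A)`. -/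
def Db.Q (A : DGAlgebra ι G) (f : G →+ M) (x : ι) : Db A f :=
  ⟨(HoTypeD.of A f).obj (TypeD.Q A f x), TypeD.Q A f x, TypeD.Q_isFGBounded A f x, ⟨Iso.refl _⟩⟩

namespace DGAlgebra

variable (A : DGAlgebra ι G) (p : ι → Prop) [DecidablePred p]

/-- The sum of the idempotents `e x` with `p x`. -/
def eSum : A.carrier := ∑ x : {x // p x}, A.e x

lemma e_mul_eSum (x : {x // p x}) : A.e x * A.eSum p = A.e x := by
  rw [eSum, Finset.mul_sum, Finset.sum_eq_single x, A.e_complete.idem x]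
  · intro y _ hy
    exact A.e_complete.ortho fun h ↦ hy (Subtype.ext h.symm)
  · simp

lemma eSum_mul_e (x : {x // p x}) : A.eSum p * A.e x = A.e x := by
  rw [eSum, Finset.sum_mul, Finset.sum_eq_single x, A.e_complete.idem x]
  · intro y _ hy
    exact A.e_complete.ortho fun h ↦ hy (Subtype.ext h)
  · simp

lemma eSum_idem : IsIdempotentElem (A.eSum p) := by
  change A.eSum p * A.eSum p = A.eSum p
  conv_lhs => rw [eSum, Finset.sum_mul]
  exact Finset.sum_congr rfl fun x _ ↦ A.e_mul_eSum p x

/-- The corner `(∑ e x) * A * (∑ e x)`. -/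
abbrev Corner := (A.eSum_idem p).Corner

variable {A p} in
lemma corner_prop (a : Corner A p) : A.eSum p * a.1 = a.1 ∧ a.1 * A.eSum p = a.1 :=
  (Subsemigroup.mem_corner_iff (A.eSum_idem p)).mp a.2

/-- The element `a` of `A` as an element of the corner, if `a` is fixed by the idempotent. -/
def toCorner (a : A.carrier) (h : A.eSum p * a = a ∧ a * A.eSum p = a) : Corner A p :=
  ⟨a, (Subsemigroup.mem_corner_iff (A.eSum_idem p)).mpr h⟩

lemma add_self' (a : A.carrier) : a + a = 0 := by
  rw [← two_smul (ZMod 2) a, show (2 : ZMod 2) = 0 from rfl, zero_smul]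

instance : Module (ZMod 2) (Corner A p) :=
  AddCommGroup.zmodModule fun a ↦ Subtype.ext <| by
    rw [two_nsmul]
    exact A.add_self' a.1

instance : Algebra (ZMod 2) (Corner A p) := ZMod.algebraOfModule 2 _

/-- The inclusion of the corner. -/
def cornerVal : Corner A p →ₗ[ZMod 2] A.carrier :=
  AddMonoidHom.toZModLinearMap 2
    { toFun := Subtype.val, map_zero' := rfl, map_add' := fun _ _ ↦ rfl }

lemma eSum_mem : A.eSum p ∈ A.gr 0 := sum_mem fun x _ ↦ A.e_mem x

/-- The map `a ↦ e * a * e` onto the corner. -/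
def cornerProj : A.carrier →ₗ[ZMod 2] Corner A p :=
  AddMonoidHom.toZModLinearMap 2
    { toFun := fun a ↦ ⟨A.eSum p * a * A.eSum p, a, rfl⟩
      map_zero' := Subtype.ext (by change _ * _ * _ = (0 : A.carrier); simp)
      map_add' := fun a b ↦ Subtype.ext (by
        change A.eSum p * (a + b) * A.eSum p = A.eSum p * a * A.eSum p + A.eSum p * b * A.eSum p
        rw [mul_add, add_mul]) }

lemma d_eSum : A.d (A.eSum p) = 0 := by
  rw [eSum, map_sum]
  exact Finset.sum_eq_zero fun x _ ↦ A.d_e x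

/-- The restriction of the differential to the corner. -/
def cornerD : Corner A p →ₗ[ZMod 2] Corner A p :=
  AddMonoidHom.toZModLinearMap 2
    { toFun := fun a ↦ A.toCorner p (A.d a.1) <| by
        have h1 := A.d_mul (A.eSum p) a.1
        have h2 := A.d_mul a.1 (A.eSum p)
        rw [(corner_prop a).1, d_eSum, zero_mul, zero_add] at h1
        rw [(corner_prop a).2, d_eSum, mul_zero, add_zero] at h2
        exact ⟨h1.symm, h2.symm⟩
      map_zero' := Subtype.ext (map_zero A.d)
      map_add' := fun a b ↦ Subtype.ext (map_add A.d a.1 b.1) }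

/-- The restriction of `A` to the idempotents `e x` with `p x`: the dg algebra
`(∑ e x) * A * (∑ e x)`. -/
def corner : DGAlgebra {x // p x} G where
  carrier := Corner A p
  e x := A.toCorner p (A.e x) ⟨A.eSum_mul_e p x, A.e_mul_eSum p x⟩
  e_complete :=
    { idem := fun x ↦ Subtype.ext (A.e_complete.idem x)
      ortho := fun x y h ↦ Subtype.ext (A.e_complete.ortho fun h' ↦ h (Subtype.ext h'))
      complete := Subtype.ext (map_sum (A.cornerVal p) _ _) }
  gr q := (A.gr q).comap (A.cornerVal p)
  gr_indep := by
    rw [iSupIndep_def]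
    intro q
    rw [Submodule.disjoint_def]
    intro a h1 h2
    have h := iSupIndep_def.mp A.gr_indep q
    rw [Submodule.disjoint_def] at h
    refine Subtype.ext (h _ h1 ?_)
    have h3 : (⨆ (j) (_ : j ≠ q), (A.gr j).comap (A.cornerVal p)) ≤
        (⨆ (j) (_ : j ≠ q), A.gr j).comap (A.cornerVal p) :=
      iSup₂_le fun j hj ↦ Submodule.comap_mono (le_iSup₂_of_le j hj le_rfl)
    exact h3 h2
  gr_span := by
    rw [eq_top_iff]
    have h1 : (⊤ : Submodule (ZMod 2) (Corner A p)) ≤ (iSup A.gr).map (A.cornerProj p) := by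
      intro a _
      rw [A.gr_span]
      refine ⟨a.1, trivial, Subtype.ext ?_⟩
      change A.eSum p * a.1 * A.eSum p = a.1
      rw [(corner_prop a).1, (corner_prop a).2]
    refine h1.trans ?_
    rw [Submodule.map_iSup]
    refine iSup_mono fun q ↦ ?_
    rintro _ ⟨a, ha, rfl⟩
    have := A.mul_mem (A.mul_mem (A.eSum_mem p) ha) (A.eSum_mem p)
    rw [zero_add, add_zero] at this
    exact this
  e_mem x := A.e_mem x
  mul_mem ha hb := A.mul_mem ha hb
  d := A.cornerD p
  d_mem ha := A.d_mem ha
  d_d a := Subtype.ext (A.d_d a.1)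
  d_mul a b := Subtype.ext (A.d_mul a.1 b.1)
  d_e x := Subtype.ext (A.d_e x)

end DGAlgebra
end Elementary

section OSz

variable {n : ℕ}

/-- An idempotent state: a set of regions among the `n + 1` regions `0, …, n` cut out by `n` parallel
strands. The `i`-th strand (`i : Fin n`, zero-based) separates the regions `i.castSucc`
and `i.succ`. -/
abbrev IState (n : ℕ) := Finset (Fin (n + 1))

/-- The number `v_i(x)` of elements of `x` to the right of strand `i`. -/
def vcount (x : IState n) (i : Fin n) : ℤ := (x.filter fun a => i.succ ≤ a).card

/-- The monomials `φ^{x,y}(U₁^{s₁} ⋯ Uₙ^{sₙ})` from `x` to `y`, encoded by twice their weight vector,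
`t = 2 w^{x,y} + 2 s`, where `2 w^{x,y}_i = |v_i(x) - v_i(y)|` is twice the minimal relative weight.
These form a basis of `I_x · B₀(n) · I_y`; this space is zero if `x`, `y` have different sizes.
The product of two composable monomials is the monomial whose weight is the sum of their weights. -/
def IsMono (x y : IState n) (t : Fin n → ℕ) : Prop :=
  x.card = y.card ∧ ∃ s : Fin n → ℕ, ∀ i, t i = (vcount x i - vcount y i).natAbs + 2 * s i

/-- `x` and `y` are the idempotents of a nonzero component of `R_i`: a dot moves from the
region to the left of strand `i` to the region to its right. This component of `R_i`, as well as
the component of `L_i` from `y` to `x`, is the monomial with `t = Pi.single i 1`. -/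
def RStep (i : Fin n) (x y : IState n) : Prop :=
  i.castSucc ∈ x ∧ i.succ ∉ x ∧ y = insert i.succ (x.erase i.castSucc)

/-- The monomials generating the two-sided ideal `J`: the components of `R_i R_{i+1}` and of
`L_{i+1} L_i`, and `I_x U_i` for `x` containing neither of the two regions adjacent to strand `i`. -/
inductive JGen : IState n → IState n → (Fin n → ℕ) → Prop
  | RR {x y z : IState n} {i j : Fin n} (hij : j.val = i.val + 1) (hi : RStep i x y)
      (hj : RStep j y z) : JGen x z (Pi.single i 1 + Pi.single j 1)
  | LL {x y z : IState n} {i j : Fin n} (hij : j.val = i.val + 1) (hi : RStep i x y)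
      (hj : RStep j y z) : JGen z x (Pi.single j 1 + Pi.single i 1)
  | U {x : IState n} {i : Fin n} (h : i.castSucc ∉ x) (h' : i.succ ∉ x) :
      JGen x x (Pi.single i 2)

/-- The monomials in the two-sided ideal `J` of `B₀(n)`. -/
def InJ (x y : IState n) (t : Fin n → ℕ) : Prop :=
  ∃ (p q : IState n) (a b c : Fin n → ℕ), IsMono x p a ∧ JGen p q b ∧ IsMono q y c ∧ t = a + b + c

/-- A basis of `B(n, S)`: monomials `φ^{x,y}(U^s) · ∏_{i ∈ cs} C_i`, with `φ^{x,y}(U^s)` a monomial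
of `B₀(n)` not in `J`, and `cs` a subset of `S`. -/
@[ext]
structure Mono (n : ℕ) (S : Finset (Fin n)) where
  x : IState n
  y : IState n
  t : Fin n → ℕ
  cs : Finset (Fin n)
  isMono : IsMono x y t
  notInJ : ¬ InJ x y t
  subset : cs ⊆ S

lemma IsMono.refl (x : IState n) : IsMono x x 0 := ⟨rfl, 0, fun i ↦ by simp⟩

lemma IsMono.add {x y z : IState n} {t t' : Fin n → ℕ} (h : IsMono x y t) (h' : IsMono y z t') :
    IsMono x z (t + t') := by
  obtain ⟨h1, s, hs⟩ := h
  obtain ⟨h1', s', hs'⟩ := h'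
  refine ⟨h1.trans h1', fun i ↦ (t i + t' i - (vcount x i - vcount z i).natAbs) / 2, fun i ↦ ?_⟩
  have h2 := hs i
  have h3 := hs' i
  simp only [Pi.add_apply]
  omega

lemma IsMono.add_two {x y : IState n} {t : Fin n → ℕ} (h : IsMono x y t) (i : Fin n) :
    IsMono x y (t + Pi.single i 2) := by
  obtain ⟨h1, s, hs⟩ := h
  refine ⟨h1, s + Pi.single i 1, fun j ↦ ?_⟩
  rcases eq_or_ne j i with rfl | hj
  · simp [hs j]; ring
  · simp [hs j, hj]

lemma InJ.add_right {x y z : IState n} {t t' : Fin n → ℕ} (h : InJ x y t) (h' : IsMono y z t') :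
    InJ x z (t + t') := by
  obtain ⟨p, q, a, b, c, h1, h2, h3, rfl⟩ := h
  exact ⟨p, q, a, b, c + t', h1, h2, h3.add h', by rw [add_assoc]⟩

lemma InJ.add_left {x y z : IState n} {t t' : Fin n → ℕ} (h : InJ y z t') (h' : IsMono x y t) :
    InJ x z (t + t') := by
  obtain ⟨p, q, a, b, c, h1, h2, h3, rfl⟩ := h
  exact ⟨p, q, t + a, b, c, h'.add h1, h2, h3, by simp only [add_assoc]⟩

lemma isMono_two (x : IState n) (i : Fin n) : IsMono x x (Pi.single i 2) := by
  simpa using (IsMono.refl x).add_two i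

variable {S : Finset (Fin n)}

/-- The underlying vector space of `B(n, S)`. -/
def BAlg (n : ℕ) (S : Finset (Fin n)) := Mono n S →₀ ZMod 2

instance : AddCommGroup (BAlg n S) := inferInstanceAs (AddCommGroup (Mono n S →₀ ZMod 2))
instance : Module (ZMod 2) (BAlg n S) := inferInstanceAs (Module (ZMod 2) (Mono n S →₀ ZMod 2))

open Classical in
/-- The element of `B(n, S)` given by the data `x`, `y`, `t`, `cs` of a monomial of `B₀(n)` times a
product of `C_i`'s; it is zero if the monomial lies in `J`. -/
def mon (S : Finset (Fin n)) (x y : IState n) (t : Fin n → ℕ) (cs : Finset (Fin n)) : BAlg n S :=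
  if h : IsMono x y t ∧ ¬ InJ x y t ∧ cs ⊆ S then
    Finsupp.single (⟨x, y, t, cs, h.1, h.2.1, h.2.2⟩ : Mono n S) (1 : ZMod 2) else 0

/-- A linear map out of `B(n, S)` defined on the basis. -/
def BAlg.lift {V : Type} [AddCommGroup V] [Module (ZMod 2) V] (F : Mono n S → V) :
    BAlg n S →ₗ[ZMod 2] V := Finsupp.linearCombination (ZMod 2) F

/-- The product of two basis elements. -/
def monMul (a b : Mono n S) : BAlg n S :=
  if a.y = b.x ∧ Disjoint a.cs b.cs then mon S a.x b.y (a.t + b.t) (a.cs ∪ b.cs) else 0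

/-- The multiplication of `B(n, S)`: the `C_i` are central, and `C_i² = 0`. -/
def BAlg.mulHom : BAlg n S →ₗ[ZMod 2] BAlg n S →ₗ[ZMod 2] BAlg n S :=
  BAlg.lift fun a => BAlg.lift fun b => monMul a b

/-- The differential of `B(n, S)`: `d` vanishes on `B₀(n) / J`, and `d C_i = U_i`. -/
def BAlg.d : BAlg n S →ₗ[ZMod 2] BAlg n S :=
  BAlg.lift fun a => ∑ i ∈ a.cs, mon S a.x a.y (a.t + Pi.single i 2) (a.cs.erase i)

/-- The basis element `a`, in the form of an element of `B(n, S)`. -/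
def Mono.toAlg (a : Mono n S) : BAlg n S := mon S a.x a.y a.t a.cs

lemma toAlg_eq (a : Mono n S) : a.toAlg = (Finsupp.single a (1 : ZMod 2) : Mono n S →₀ ZMod 2) :=
  dif_pos ⟨a.isMono, a.notInJ, a.subset⟩

lemma lift_toAlg {V : Type} [AddCommGroup V] [Module (ZMod 2) V] (F : Mono n S → V)
    (a : Mono n S) : BAlg.lift F a.toAlg = F a := by
  rw [toAlg_eq]
  exact (Finsupp.linearCombination_single _ _ _).trans (one_smul _ _)

lemma mon_zero {x y : IState n} {t : Fin n → ℕ} {cs : Finset (Fin n)}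
    (h : ¬ (IsMono x y t ∧ ¬ InJ x y t ∧ cs ⊆ S)) : mon S x y t cs = 0 := dif_neg h

lemma mon_cases {x y : IState n} {t : Fin n → ℕ} {cs : Finset (Fin n)} (h : IsMono x y t)
    (hcs : cs ⊆ S) : (∃ a : Mono n S, a.x = x ∧ a.y = y ∧ a.t = t ∧ a.cs = cs) ∨ InJ x y t := by
  by_cases hJ : InJ x y t
  · exact Or.inr hJ
  · exact Or.inl ⟨⟨x, y, t, cs, h, hJ, hcs⟩, rfl, rfl, rfl, rfl⟩

/-- Products of monomials of `B₀(n)`, in the quotient. -/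
lemma mon_mul {x y y' z : IState n} {t t' : Fin n → ℕ} {cs cs' : Finset (Fin n)}
    (h : IsMono x y t) (h' : IsMono y' z t') (hcs : cs ⊆ S) (hcs' : cs' ⊆ S) :
    BAlg.mulHom (mon S x y t cs) (mon S y' z t' cs') =
      if y = y' ∧ Disjoint cs cs' then mon S x z (t + t') (cs ∪ cs') else 0 := by
  rcases mon_cases h hcs with ⟨a, rfl, rfl, rfl, rfl⟩ | hJ
  · rcases mon_cases h' hcs' with ⟨b, rfl, rfl, rfl, rfl⟩ | hJ'
    · change BAlg.mulHom a.toAlg b.toAlg = _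
      rw [BAlg.mulHom, lift_toAlg, lift_toAlg]
      rfl
    · rw [mon_zero (fun k ↦ k.2.1 hJ'), map_zero]
      split_ifs with hy
      · obtain ⟨rfl, -⟩ := hy
        exact (mon_zero fun k ↦ k.2.1 (hJ'.add_left h)).symm
      · rfl
  · rw [mon_zero (fun k ↦ k.2.1 hJ), map_zero, LinearMap.zero_apply]
    split_ifs with hy
    · obtain ⟨rfl, -⟩ := hy
      exact (mon_zero fun k ↦ k.2.1 (hJ.add_right h')).symm
    · rfl

lemma mon_d {x y : IState n} {t : Fin n → ℕ} {cs : Finset (Fin n)} (h : IsMono x y t)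
    (hcs : cs ⊆ S) :
    BAlg.d (mon S x y t cs) = ∑ i ∈ cs, mon S x y (t + Pi.single i 2) (cs.erase i) := by
  rcases mon_cases h hcs with ⟨a, rfl, rfl, rfl, rfl⟩ | hJ
  · change BAlg.d a.toAlg = _
    rw [BAlg.d, lift_toAlg]
  · rw [mon_zero (fun k ↦ k.2.1 hJ), map_zero]
    exact (Finset.sum_eq_zero fun i _ ↦
      mon_zero fun k ↦ k.2.1 (hJ.add_right (isMono_two y i))).symm

lemma BAlg.induction {P : BAlg n S → Prop} (h0 : P 0) (hadd : ∀ a b, P a → P b → P (a + b))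
    (hmon : ∀ a : Mono n S, P a.toAlg) (b : BAlg n S) : P b := by
  refine Finsupp.induction_linear (motive := P) b h0 hadd fun a r ↦ ?_
  rcases (by decide : ∀ r : ZMod 2, r = 0 ∨ r = 1) r with rfl | rfl
  · rw [Finsupp.single_zero]; exact h0
  · rw [← toAlg_eq]; exact hmon a

/-- The idempotent `I_x`. -/
def idemI (S : Finset (Fin n)) (x : IState n) : BAlg n S := mon S x x 0 ∅

instance : Mul (BAlg n S) := ⟨fun a b => BAlg.mulHom a b⟩

lemma BAlg.mul_def (a b : BAlg n S) : a * b = BAlg.mulHom a b := rfl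

lemma toAlg_mul (a b : Mono n S) : a.toAlg * b.toAlg =
    if a.y = b.x ∧ Disjoint a.cs b.cs then mon S a.x b.y (a.t + b.t) (a.cs ∪ b.cs) else 0 :=
  mon_mul a.isMono b.isMono a.subset b.subset

lemma BAlg.mul_assoc' (a b c : BAlg n S) : a * b * c = a * (b * c) := by
  induction a using BAlg.induction with
  | h0 => simp [BAlg.mul_def]
  | hadd a a' h h' => simp only [BAlg.mul_def, map_add, LinearMap.add_apply] at *; rw [h, h']
  | hmon a =>
  induction b using BAlg.induction with
  | h0 => simp [BAlg.mul_def]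
  | hadd a a' h h' => simp only [BAlg.mul_def, map_add, LinearMap.add_apply] at *; rw [h, h']
  | hmon b =>
  induction c using BAlg.induction with
  | h0 => simp [BAlg.mul_def]
  | hadd a a' h h' => simp only [BAlg.mul_def, map_add] at *; rw [h, h']
  | hmon c =>
  have l : ∀ (p : Prop) [Decidable p] (u v : BAlg n S), (if p then u else 0) * v =
      if p then u * v else 0 := by
    intro p _ u v
    split_ifs <;> simp [BAlg.mul_def]
  have r : ∀ (p : Prop) [Decidable p] (u v : BAlg n S), v * (if p then u else 0) =
      if p then v * u else 0 := by
    intro p _ u v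
    split_ifs <;> simp [BAlg.mul_def]
  rw [toAlg_mul, toAlg_mul, l, r]
  by_cases h1 : a.y = b.x
  · by_cases h2 : b.y = c.x
    · have e1 : mon S a.x b.y (a.t + b.t) (a.cs ∪ b.cs) * c.toAlg = _ :=
        mon_mul (a.isMono.add (h1 ▸ b.isMono)) c.isMono (Finset.union_subset a.subset b.subset)
          c.subset
      have e2 : a.toAlg * mon S b.x c.y (b.t + c.t) (b.cs ∪ c.cs) = _ :=
        mon_mul a.isMono (b.isMono.add (h2 ▸ c.isMono)) a.subset
          (Finset.union_subset b.subset c.subset)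
      rw [e1, e2, ← ite_and, ← ite_and, add_assoc, Finset.union_assoc]
      refine if_congr ?_ rfl rfl
      rw [Finset.disjoint_union_left, Finset.disjoint_union_right]
      tauto
    · have h3 : ¬ (b.y = c.x ∧ Disjoint b.cs c.cs) := fun k ↦ h2 k.1
      rw [if_neg h3]
      split_ifs
      · exact (mon_mul (a.isMono.add (h1 ▸ b.isMono)) c.isMono
          (Finset.union_subset a.subset b.subset) c.subset).trans (if_neg (fun k ↦ h2 k.1))
      · rfl
  · have h3 : ¬ (a.y = b.x ∧ Disjoint a.cs b.cs) := fun k ↦ h1 k.1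
    rw [if_neg h3]
    by_cases h2 : b.y = c.x
    · split_ifs
      · exact ((mon_mul a.isMono (b.isMono.add (h2 ▸ c.isMono)) a.subset
          (Finset.union_subset b.subset c.subset)).trans (if_neg (fun k ↦ h1 k.1))).symm
      · rfl
    · have h4 : ¬ (b.y = c.x ∧ Disjoint b.cs c.cs) := fun k ↦ h2 k.1
      rw [if_neg h4]

lemma idemI_mul (x : IState n) (a : Mono n S) :
    idemI S x * a.toAlg = if x = a.x then a.toAlg else 0 := by
  have h : idemI S x * a.toAlg = _ :=
    mon_mul (IsMono.refl x) a.isMono (Finset.empty_subset S) a.subset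
  rw [h]
  by_cases hx : x = a.x
  · subst hx; simp [Mono.toAlg]
  · simp [hx]

lemma mul_idemI (x : IState n) (a : Mono n S) :
    a.toAlg * idemI S x = if a.y = x then a.toAlg else 0 := by
  have h : a.toAlg * idemI S x = _ :=
    mon_mul a.isMono (IsMono.refl x) a.subset (Finset.empty_subset S)
  rw [h]
  by_cases hx : a.y = x
  · subst hx; simp [Mono.toAlg]
  · simp [hx]

instance : One (BAlg n S) := ⟨∑ x, idemI S x⟩

lemma BAlg.one_def : (1 : BAlg n S) = ∑ x, idemI S x := rfl

lemma BAlg.one_mul' (a : BAlg n S) : 1 * a = a := by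
  induction a using BAlg.induction with
  | h0 => simp [BAlg.mul_def]
  | hadd a a' h h' => simp only [BAlg.mul_def, map_add] at *; rw [h, h']
  | hmon a =>
    rw [BAlg.one_def, BAlg.mul_def, map_sum, LinearMap.sum_apply]
    simp only [← BAlg.mul_def, idemI_mul]
    simp

lemma BAlg.mul_one' (a : BAlg n S) : a * 1 = a := by
  induction a using BAlg.induction with
  | h0 => simp [BAlg.mul_def]
  | hadd a a' h h' => simp only [BAlg.mul_def, map_add, LinearMap.add_apply] at *; rw [h, h']
  | hmon a =>
    rw [BAlg.one_def, BAlg.mul_def, map_sum]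
    simp only [← BAlg.mul_def, mul_idemI]
    simp

instance : Ring (BAlg n S) :=
  { (inferInstance : AddCommGroup (BAlg n S)), (inferInstance : Mul (BAlg n S)),
    (inferInstance : One (BAlg n S)) with
    left_distrib := fun a b c ↦ by simp only [BAlg.mul_def, map_add]
    right_distrib := fun a b c ↦ by simp only [BAlg.mul_def, map_add, LinearMap.add_apply]
    zero_mul := fun a ↦ by simp only [BAlg.mul_def, map_zero, LinearMap.zero_apply]
    mul_zero := fun a ↦ by simp only [BAlg.mul_def, map_zero]
    mul_assoc := BAlg.mul_assoc'
    one_mul := BAlg.one_mul'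
    mul_one := BAlg.mul_one' }

instance : Algebra (ZMod 2) (BAlg n S) := ZMod.algebraOfModule 2 _

/-- `M_Y = H⁰(Y; ¼ℤ)` for the zero-manifold `Y` of `n` points: the group `(¼ℤ)ⁿ`. The `i`-th
standard basis vector is the class `e_i` of the `i`-th point, oriented negatively. -/
abbrev MY (n : ℕ) := Fin n → ↥(AddSubgroup.zmultiples (1 / 4 : ℚ))

/-- The element `1 / 2` of `¼ℤ`. -/
def half : ↥(AddSubgroup.zmultiples (1 / 4 : ℚ)) :=
  ⟨1 / 2, AddSubgroup.mem_zmultiples_iff.mpr ⟨2, by norm_num⟩⟩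

/-- The homological degree of a monomial (in the convention where `d` raises it by one): each `U_i`
with `i ∈ S` contributes `2`, each `R_i` or `L_i` with `i ∈ S` and each `C_i` contributes `1`. -/
def maslov (S : Finset (Fin n)) (t : Fin n → ℕ) (cs : Finset (Fin n)) : ℤ :=
  ∑ i ∈ S, (t i : ℤ) + cs.card

/-- The multi-Alexander degree of a monomial: `R_i` and `L_i` have degree `½ e_i`, and
`U_i` and `C_i` have degree `e_i`. -/
def alexander (t : Fin n → ℕ) (cs : Finset (Fin n)) : MY n :=
  fun i => (t i + if i ∈ cs then 2 else 0) • half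

/-- The bidegree of a monomial. -/
def mdeg (S : Finset (Fin n)) (t : Fin n → ℕ) (cs : Finset (Fin n)) : ℤ × MY n :=
  (maslov S t cs, alexander t cs)

lemma mdeg_add (t t' : Fin n → ℕ) {cs cs' : Finset (Fin n)} (h : Disjoint cs cs') :
    mdeg S (t + t') (cs ∪ cs') = mdeg S t cs + mdeg S t' cs' := by
  refine Prod.ext ?_ (funext fun i ↦ ?_)
  · simp only [mdeg, maslov, Prod.fst_add, Finset.card_union_of_disjoint h, Pi.add_apply]
    push_cast
    rw [Finset.sum_add_distrib]
    ring
  · simp only [mdeg, alexander, Prod.snd_add, Pi.add_apply, ← add_smul]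
    congr 1
    have h1 : i ∈ cs → i ∉ cs' := fun k ↦ Finset.disjoint_left.mp h k
    simp only [Finset.mem_union]
    split_ifs <;> first | omega | tauto

lemma mdeg_d (t : Fin n → ℕ) {cs : Finset (Fin n)} (hcs : cs ⊆ S) {i : Fin n} (hi : i ∈ cs) :
    mdeg S (t + Pi.single i 2) (cs.erase i) = mdeg S t cs + (1, 0) := by
  refine Prod.ext ?_ (funext fun j ↦ ?_)
  · simp only [mdeg, maslov, Prod.fst_add, Pi.add_apply]
    have h1 := Finset.card_erase_add_one hi
    have h2 : ∑ j ∈ S, ((Pi.single i 2 : Fin n → ℕ) j : ℤ) = 2 := by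
      rw [Finset.sum_eq_single i]
      · simp
      · intro j _ hj; simp [hj]
      · intro h; exact absurd (hcs hi) h
    push_cast
    rw [Finset.sum_add_distrib, h2]
    omega
  · simp only [mdeg, alexander, Prod.snd_add, Pi.add_apply, Pi.zero_apply, add_zero]
    congr 1
    rcases eq_or_ne j i with rfl | hj
    · simp [hi]
    · simp [hj]

/-- The homogeneous pieces of `B(n, S)`. -/
def BAlg.gr (n : ℕ) (S : Finset (Fin n)) (q : ℤ × MY n) : Submodule (ZMod 2) (BAlg n S) :=
  Submodule.span (ZMod 2) {b | ∃ a : Mono n S, b = a.toAlg ∧ mdeg S a.t a.cs = q}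

lemma mon_mem_gr {x y : IState n} {t : Fin n → ℕ} {cs : Finset (Fin n)} {q : ℤ × MY n}
    (hq : mdeg S t cs = q) : mon S x y t cs ∈ BAlg.gr n S q := by
  by_cases h : IsMono x y t ∧ ¬ InJ x y t ∧ cs ⊆ S
  · exact Submodule.subset_span ⟨⟨x, y, t, cs, h.1, h.2.1, h.2.2⟩, rfl, hq⟩
  · rw [mon_zero h]; exact zero_mem _

/-- The coefficient of a basis element. -/
def BAlg.coeff (a : Mono n S) : BAlg n S →ₗ[ZMod 2] ZMod 2 := Finsupp.lapply a

lemma BAlg.coeff_toAlg (a b : Mono n S) (h : b ≠ a) : BAlg.coeff a b.toAlg = 0 := by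
  rw [toAlg_eq]
  exact Finsupp.single_eq_of_ne h.symm

lemma BAlg.coeff_of_mem_gr {q : ℤ × MY n} {a : Mono n S} (h : mdeg S a.t a.cs ≠ q)
    {b : BAlg n S} (hb : b ∈ BAlg.gr n S q) : BAlg.coeff a b = 0 := by
  have : BAlg.gr n S q ≤ LinearMap.ker (BAlg.coeff a) := by
    rw [BAlg.gr, Submodule.span_le]
    rintro _ ⟨c, rfl, hc⟩
    exact BAlg.coeff_toAlg a c (by rintro rfl; exact h hc)
  exact this hb

lemma BAlg.gr_indep : iSupIndep (BAlg.gr n S) := by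
  rw [iSupIndep_def]
  intro q
  rw [Submodule.disjoint_def]
  intro b h1 h2
  refine Finsupp.ext fun a ↦ ?_
  by_cases h : mdeg S a.t a.cs = q
  · have : (⨆ (j) (_ : j ≠ q), BAlg.gr n S j) ≤ LinearMap.ker (BAlg.coeff a) :=
      iSup₂_le fun j hj c hc ↦ BAlg.coeff_of_mem_gr (by rw [h]; exact hj.symm) hc
    exact this h2
  · exact BAlg.coeff_of_mem_gr h h1

lemma BAlg.gr_span : iSup (BAlg.gr n S) = ⊤ := by
  rw [eq_top_iff]
  intro b _
  induction b using BAlg.induction with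
  | h0 => exact zero_mem _
  | hadd a b ha hb => exact add_mem (ha trivial) (hb trivial)
  | hmon a => exact Submodule.mem_iSup_of_mem _ (mon_mem_gr rfl)

lemma BAlg.mul_mem {p q : ℤ × MY n} {a b : BAlg n S} (ha : a ∈ BAlg.gr n S p)
    (hb : b ∈ BAlg.gr n S q) : a * b ∈ BAlg.gr n S (p + q) := by
  have h1 : BAlg.gr n S p ≤ (BAlg.gr n S (p + q)).comap (BAlg.mulHom.flip b) := by
    rw [BAlg.gr, Submodule.span_le]
    rintro _ ⟨a, rfl, rfl⟩
    have h2 : BAlg.gr n S q ≤ (BAlg.gr n S (mdeg S a.t a.cs + q)).comap (BAlg.mulHom a.toAlg) := by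
      rw [BAlg.gr, Submodule.span_le]
      rintro _ ⟨b, rfl, rfl⟩
      change a.toAlg * b.toAlg ∈ BAlg.gr n S _
      rw [toAlg_mul]
      split_ifs with h
      · exact mon_mem_gr (mdeg_add _ _ h.2)
      · exact zero_mem _
    exact h2 hb
  exact h1 ha

lemma BAlg.d_mem {p : ℤ × MY n} {a : BAlg n S} (ha : a ∈ BAlg.gr n S p) :
    BAlg.d a ∈ BAlg.gr n S (p + (1, 0)) := by
  have h1 : BAlg.gr n S p ≤ (BAlg.gr n S (p + (1, 0))).comap BAlg.d := by
    rw [BAlg.gr, Submodule.span_le]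
    rintro _ ⟨a, rfl, rfl⟩
    change BAlg.d (mon S a.x a.y a.t a.cs) ∈ BAlg.gr n S _
    rw [mon_d a.isMono a.subset]
    exact sum_mem fun i hi ↦ mon_mem_gr (mdeg_d _ a.subset hi)
  exact h1 ha

lemma BAlg.add_self (a : BAlg n S) : a + a = 0 := by
  rw [← two_smul (ZMod 2) a, show (2 : ZMod 2) = 0 from rfl, zero_smul]

lemma BAlg.d_d (a : BAlg n S) : BAlg.d (BAlg.d a) = 0 := by
  induction a using BAlg.induction with
  | h0 => simp
  | hadd a b ha hb => rw [map_add, map_add, ha, hb, add_zero]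
  | hmon a =>
    rw [Mono.toAlg, mon_d a.isMono a.subset, map_sum]
    have h1 : ∀ i ∈ a.cs, BAlg.d (mon S a.x a.y (a.t + Pi.single i 2) (a.cs.erase i)) =
        ∑ j ∈ a.cs.erase i, mon S a.x a.y (a.t + Pi.single i 2 + Pi.single j 2)
          ((a.cs.erase i).erase j) := fun i _ ↦
      mon_d (a.isMono.add_two i) ((Finset.erase_subset _ _).trans a.subset)
    rw [Finset.sum_congr rfl h1, Finset.sum_sigma']
    refine Finset.sum_involution (fun p _ ↦ ⟨p.2, p.1⟩) ?_ ?_ ?_ ?_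
    · rintro ⟨i, j⟩ _
      dsimp only
      rw [Finset.erase_right_comm, add_right_comm]
      exact BAlg.add_self _
    · rintro ⟨i, j⟩ h _ e
      simp only [Finset.mem_sigma, Finset.mem_erase] at h
      exact h.2.1 (congrArg Sigma.fst e)
    · rintro ⟨i, j⟩ h
      simp only [Finset.mem_sigma, Finset.mem_erase] at h ⊢
      exact ⟨h.2.2, h.2.1.symm, h.1⟩
    · rintro ⟨i, j⟩ _
      rfl

lemma BAlg.sum_mul' {α : Type} (s : Finset α) (F : α → BAlg n S) (b : BAlg n S) :
    (∑ i ∈ s, F i) * b = ∑ i ∈ s, F i * b := Finset.sum_mul s F b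

lemma BAlg.d_mul (a b : BAlg n S) : BAlg.d (a * b) = BAlg.d a * b + a * BAlg.d b := by
  induction a using BAlg.induction with
  | h0 => simp
  | hadd a a' h h' => simp only [add_mul, map_add] at *; rw [h, h']; abel
  | hmon a =>
  induction b using BAlg.induction with
  | h0 => simp
  | hadd b b' h h' => simp only [mul_add, map_add] at *; rw [h, h']; abel
  | hmon b =>
  have ea : BAlg.d a.toAlg = _ := mon_d a.isMono a.subset
  have eb : BAlg.d b.toAlg = _ := mon_d b.isMono b.subset
  rw [toAlg_mul, ea, eb, Finset.sum_mul, Finset.mul_sum]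
  have h1 : ∀ i ∈ a.cs, mon S a.x a.y (a.t + Pi.single i 2) (a.cs.erase i) * b.toAlg =
      if a.y = b.x ∧ Disjoint (a.cs.erase i) b.cs then
        mon S a.x b.y (a.t + b.t + Pi.single i 2) (a.cs.erase i ∪ b.cs) else 0 := fun i _ ↦ by
    have := mon_mul (S := S) (a.isMono.add_two i) b.isMono
      ((Finset.erase_subset i _).trans a.subset) b.subset
    rw [add_right_comm]
    exact this
  have h2 : ∀ i ∈ b.cs, a.toAlg * mon S b.x b.y (b.t + Pi.single i 2) (b.cs.erase i) =
      if a.y = b.x ∧ Disjoint a.cs (b.cs.erase i) then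
        mon S a.x b.y (a.t + b.t + Pi.single i 2) (a.cs ∪ b.cs.erase i) else 0 := fun i _ ↦ by
    have := mon_mul (S := S) a.isMono (b.isMono.add_two i) a.subset
      ((Finset.erase_subset i _).trans b.subset)
    rw [add_assoc]
    exact this
  rw [Finset.sum_congr rfl h1, Finset.sum_congr rfl h2]
  by_cases hy : a.y = b.x
  · simp only [hy, true_and]
    have hmono := a.isMono.add (hy ▸ b.isMono)
    by_cases hd : Disjoint a.cs b.cs
    · rw [if_pos hd, mon_d hmono (Finset.union_subset a.subset b.subset),
        Finset.sum_union hd]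
      congr 1
      · refine Finset.sum_congr rfl fun i hi ↦ ?_
        rw [if_pos (hd.mono_left (Finset.erase_subset _ _)), Finset.erase_union_distrib,
          Finset.erase_eq_of_notMem (Finset.disjoint_left.mp hd hi)]
      · refine Finset.sum_congr rfl fun i hi ↦ ?_
        rw [if_pos (hd.mono_right (Finset.erase_subset _ _)), Finset.erase_union_distrib,
          Finset.erase_eq_of_notMem (Finset.disjoint_right.mp hd hi)]
    · rw [if_neg hd, map_zero]
      obtain ⟨k, hka, hkb⟩ := Finset.not_disjoint_iff.mp hd
      rw [Finset.sum_eq_single_of_mem k hka, Finset.sum_eq_single_of_mem k hkb]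
      · have e1 : Disjoint (a.cs.erase k) b.cs ↔ Disjoint a.cs (b.cs.erase k) :=
          Finset.disjoint_erase_comm
        have e2 : a.cs.erase k ∪ b.cs = a.cs ∪ b.cs.erase k := by
          ext j
          simp only [Finset.mem_union, Finset.mem_erase]
          rcases eq_or_ne j k with rfl | hj
          · simp [hka, hkb]
          · simp [hj]
        simp only [e1, e2]
        exact (BAlg.add_self _).symm
      · intro i _ hi
        refine if_neg fun h ↦ ?_
        exact Finset.disjoint_left.mp h hka (Finset.mem_erase.mpr ⟨hi.symm, hkb⟩)
      · intro i _ hi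
        refine if_neg fun h ↦ ?_
        exact Finset.disjoint_left.mp h (Finset.mem_erase.mpr ⟨hi.symm, hka⟩) hkb
  · simp [hy]

/-- The dg algebra `B(n, S)`, bigraded by the homological degree and the multi-Alexander degree. -/
def OSzB (n : ℕ) (S : Finset (Fin n)) : DGAlgebra (IState n) (MY n) where
  carrier := BAlg n S
  e := idemI S
  e_complete :=
    { idem := fun x ↦ by
        refine (mon_mul (IsMono.refl x) (IsMono.refl x) (Finset.empty_subset S)
          (Finset.empty_subset S)).trans ?_
        simp [idemI]
      ortho := fun x y h ↦ by
        refine (mon_mul (IsMono.refl x) (IsMono.refl y) (Finset.empty_subset S)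
          (Finset.empty_subset S)).trans ?_
        simp [h]
      complete := rfl }
  gr := BAlg.gr n S
  gr_indep := BAlg.gr_indep
  gr_span := BAlg.gr_span
  e_mem x := mon_mem_gr (by
    refine Prod.ext ?_ (funext fun i ↦ ?_)
    · simp [mdeg, maslov]
    · simp [mdeg, alexander])
  mul_mem := BAlg.mul_mem
  d := BAlg.d
  d_mem := BAlg.d_mem
  d_d := BAlg.d_d
  d_mul := BAlg.d_mul
  d_e x := by
    refine (mon_d (IsMono.refl x) (Finset.empty_subset S)).trans ?_
    simp

/-- The two truncations of `B(n, S)`. -/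
inductive Side
  | r
  | l

/-- The region that idempotent states are not allowed to contain: the leftmost region `0` for
`C_r(n, S)`, and the rightmost region `n` for `C_l(n, S)`. -/
def Side.excl (n : ℕ) : Side → Fin (n + 1)
  | .r => 0
  | .l => Fin.last n

/-- The idempotent states of `C_r(n, S)` and of `C_l(n, S)`. -/
abbrev CState (side : Side) (n : ℕ) := {x : IState n // side.excl n ∉ x}

/-- The dg algebras `C_r(n, S)` and `C_l(n, S)`: the sum of `I_x · B(n, S) · I_y` over all
idempotent states `x`, `y` not containing the excluded region. -/
def OSzC (side : Side) (n : ℕ) (S : Finset (Fin n)) : DGAlgebra (CState side n) (MY n) :=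
  (OSzB n S).corner fun x => side.excl n ∉ x

end OSz
end
end BorderedDecat

open BorderedDecat

open scoped TensorProduct

/-! The argument works for every dg algebra `A` over `𝔽₂` as above that has, at each idempotent `e
x`, an augmentation: a ring map `ε : A → 𝔽₂` with `ε ∘ d = 0` and `ε (e x) = 1` that vanishes in all
nonzero bidegrees.

Generation (`K0.span_Q`) uses boundedness and no augmentation. Let `X` be finitely generated,
bounded and nonzero, and take the least `k` for which `(δ¹)ᵏ` is not injective on the `𝔽₂`-span of
the generators; `k > 0`. If `(δ¹)ᵏ v = 0`, then applying a linear form to the leftmost tensor factor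
gives a vector killed by `(δ¹)ᵏ⁻¹`, hence zero; so `δ¹ v = 0` (`TypeD.exists_kernel`). A homogeneous
component `c` of `v` is still killed (`TypeD.exists_isKernelVector`). It spans a one-generator
substructure, and `X` is the mapping cone of a map to it from the desuspended quotient `X / c`
(`TypeD.IsKernelVector.splitIso`). The quotient is bounded and has one generator fewer, so induction
applies. The one-generator pieces are shifts of the `Q_x`; intrinsic shifts are scalars in `ℤ[M]`,
and the homological shift is a sign.

Independence (`K0.linearIndependent_Q`): applying `ε` to the entries of `δ¹` turns a Type D
structure into a complex of `𝔽₂`-vector spaces. The Euler characteristic of its part with idempotent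
`x` and intrinsic degree `m` is a homotopy invariant and is additive on distinguished triangles, so
it descends to a homomorphism `K₀ → ℤ` (`K0.euler`). On `∑ r_y [Q_y]` it equals the coefficient of
`m` in `r_x`.

For `B(n, S)` the augmentation at `I_x` reads off the coefficient of `I_x`. It is multiplicative
because weights are nonnegative and add, and because the only monomials of weight zero without
factors `C_i` are the idempotents (`BAlg.coeff_mul`). It restricts to the truncations. The
statements on rank and base change then follow formally from the basis. -/

namespace BorderedDecat

noncomputable section

open CategoryTheory

/-! ### Homology of `ℤ/2`-graded complexes over `𝔽₂`, and the exact hexagon of a mapping cone. -/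

section LinearAlgebra

variable {U V W : Type*} [AddCommGroup U] [Module (ZMod 2) U]
  [AddCommGroup V] [Module (ZMod 2) V] [AddCommGroup W] [Module (ZMod 2) W]

/-- The homology `(P ∩ ker D) / D Q`, at the component `P`, of a `ℤ/2`-graded differential `D` with
components `P` and `Q`. -/
abbrev Homology₂ (D : V →ₗ[ZMod 2] V) (P Q : Submodule (ZMod 2) V) : Type _ :=
  ↥(P ⊓ LinearMap.ker D) ⧸ (Q.map D).comap (P ⊓ LinearMap.ker D).subtype

namespace Homology₂

/-- The linear map `f` sends `P` to `P'` and `Q` to `Q'`, and commutes with the differentials. -/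
structure IsMap (D : V →ₗ[ZMod 2] V) (P Q : Submodule (ZMod 2) V) (D' : W →ₗ[ZMod 2] W)
    (P' Q' : Submodule (ZMod 2) W) (f : V →ₗ[ZMod 2] W) : Prop where
  left : ∀ v ∈ P, f v ∈ P'
  right : ∀ v ∈ Q, f v ∈ Q'
  comm : ∀ v, f (D v) = D' (f v)

variable {D : V →ₗ[ZMod 2] V} {P Q : Submodule (ZMod 2) V} {D' : W →ₗ[ZMod 2] W}
  {P' Q' : Submodule (ZMod 2) W} {D'' : U →ₗ[ZMod 2] U} {P'' Q'' : Submodule (ZMod 2) U}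

lemma IsMap.swap {f : V →ₗ[ZMod 2] W} (h : IsMap D P Q D' P' Q' f) : IsMap D Q P D' Q' P' f :=
  ⟨h.right, h.left, h.comm⟩

/-- The class of a cycle. -/
def cls (v : V) (hP : v ∈ P) (hD : D v = 0) : Homology₂ D P Q :=
  Submodule.Quotient.mk ⟨v, hP, hD⟩

lemma ind {motive : Homology₂ D P Q → Prop} (h : ∀ v hP hD, motive (cls v hP hD)) (a) :
    motive a := by
  induction a using Submodule.Quotient.induction_on with
  | H a => exact h a.1 a.2.1 a.2.2

lemma cls_eq_cls {v w : V} {hP : v ∈ P} {hD : D v = 0} {hP' : w ∈ P} {hD' : D w = 0} :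
    (cls v hP hD : Homology₂ D P Q) = cls w hP' hD' ↔ ∃ q ∈ Q, D q = v - w := by
  rw [cls, cls, Submodule.Quotient.eq]
  rfl

lemma cls_eq_zero {v : V} {hP : v ∈ P} {hD : D v = 0} :
    (cls v hP hD : Homology₂ D P Q) = 0 ↔ ∃ q ∈ Q, D q = v := by
  rw [cls, Submodule.Quotient.mk_eq_zero]
  rfl

/-- The map induced on homology. -/
def map (f : V →ₗ[ZMod 2] W) (hf : IsMap D P Q D' P' Q' f) :
    Homology₂ D P Q →ₗ[ZMod 2] Homology₂ D' P' Q' :=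
  Submodule.mapQ _ _ (f.restrict (p := P ⊓ LinearMap.ker D) (q := P' ⊓ LinearMap.ker D')
    fun v hv ↦ ⟨hf.left v hv.1, by
      exact (hf.comm v).symm.trans ((congrArg f hv.2).trans (map_zero f))⟩) <| by
    rintro ⟨v, hv⟩ ⟨q, hq, e⟩
    exact ⟨f q, hf.right q hq, by rw [← hf.comm, e]; rfl⟩

lemma map_cls (f : V →ₗ[ZMod 2] W) (hf : IsMap D P Q D' P' Q' f) (v : V) (hP : v ∈ P)
    (hD : D v = 0) : map f hf (cls v hP hD) =
      cls (f v) (hf.left v hP) (by rw [← hf.comm, hD, map_zero]) := rfl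

/-- Maps that are inverse up to homotopy induce an isomorphism on homology. -/
def equiv (f : V →ₗ[ZMod 2] W) (hf : IsMap D P Q D' P' Q' f) (g : W →ₗ[ZMod 2] V)
    (hg : IsMap D' P' Q' D P Q g) (h : V →ₗ[ZMod 2] V) (hh : ∀ v ∈ P, h v ∈ Q)
    (e : ∀ v ∈ P, g (f v) - v = D (h v) + h (D v)) (h' : W →ₗ[ZMod 2] W) (hh' : ∀ v ∈ P', h' v ∈ Q')
    (e' : ∀ v ∈ P', f (g v) - v = D' (h' v) + h' (D' v)) :
    Homology₂ D P Q ≃ₗ[ZMod 2] Homology₂ D' P' Q' :=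
  LinearEquiv.ofLinearMap (map f hf) (map g hg)
    (by
      refine LinearMap.ext fun a ↦ ?_
      induction a using ind with
      | h v hP hD =>
        rw [LinearMap.comp_apply, map_cls, map_cls, LinearMap.id_apply, cls_eq_cls]
        exact ⟨h' v, hh' v hP, by rw [e' v hP, hD, map_zero, add_zero]⟩)
    (by
      refine LinearMap.ext fun a ↦ ?_
      induction a using ind with
      | h v hP hD =>
        rw [LinearMap.comp_apply, map_cls, map_cls, LinearMap.id_apply, cls_eq_cls]
        exact ⟨h v, hh v hP, by rw [e v hP, hD, map_zero, add_zero]⟩)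

/-- `K` is the mapping cone of `φ : V → W`, with projections `q`, `r` and inclusions `s`, `i`. -/
structure IsCone (D : V →ₗ[ZMod 2] V) (P Q : Submodule (ZMod 2) V) (D' : W →ₗ[ZMod 2] W)
    (P' Q' : Submodule (ZMod 2) W)
    (D'' : U →ₗ[ZMod 2] U) (P'' Q'' : Submodule (ZMod 2) U) (φ : V →ₗ[ZMod 2] W)
    (i : W →ₗ[ZMod 2] U) (q : U →ₗ[ZMod 2] V)
    (r : U →ₗ[ZMod 2] W) (s : V →ₗ[ZMod 2] U) : Prop where
  isMap_φ : IsMap D P Q D' P' Q' φ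
  isMap_i : IsMap D' P' Q' D'' P'' Q'' i
  isMap_q : IsMap D'' P'' Q'' D Q P q
  r_left : ∀ u ∈ P'', r u ∈ P'
  r_right : ∀ u ∈ Q'', r u ∈ Q'
  s_left : ∀ u ∈ P, s u ∈ Q''
  s_right : ∀ u ∈ Q, s u ∈ P''
  q_i : ∀ w, q (i w) = 0
  q_s : ∀ v, q (s v) = v
  r_i : ∀ w, r (i w) = w
  r_s : ∀ v, r (s v) = 0
  sum : ∀ u, i (r u) + s (q u) = u
  r_D : ∀ u, r (D'' u) = φ (q u) + D' (r u)

variable {φ : V →ₗ[ZMod 2] W} {i : W →ₗ[ZMod 2] U} {q : U →ₗ[ZMod 2] V}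
  {r : U →ₗ[ZMod 2] W} {s : V →ₗ[ZMod 2] U}

namespace IsCone

lemma ext_iff (h : IsCone D P Q D' P' Q' D'' P'' Q'' φ i q r s) {u u' : U} :
    u = u' ↔ q u = q u' ∧ r u = r u' := by
  refine ⟨by rintro rfl; exact ⟨rfl, rfl⟩, fun ⟨h1, h2⟩ ↦ ?_⟩
  rw [← h.sum u, h1, h2, h.sum]

/-- In the coordinates `(q, r)`, the equation `D'' u = i b` says that `q u` is a cycle and `b = φ (q
u) + D' (r u)`. Together with `exact_q`, `exact_φ` and their versions for the other parity this
gives an exact hexagon. The equation `D² = 0` plays no role, since homology is formed by dividing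
cycles by those boundaries that are cycles. -/
lemma exact_i (h : IsCone D P Q D' P' Q' D'' P'' Q'' φ i q r s) :
    Function.Exact (map φ h.isMap_φ) (map i h.isMap_i) := by
  intro a
  induction a using ind with
  | h b hP hD =>
  rw [map_cls, cls_eq_zero]
  constructor
  · rintro ⟨u, hu, e⟩
    rw [h.ext_iff, h.isMap_q.comm, h.q_i, h.r_i, h.r_D] at e
    refine ⟨cls (q u) (h.isMap_q.right u hu) e.1, ?_⟩
    rw [map_cls, cls_eq_cls]
    refine ⟨-r u, neg_mem (h.r_right u hu), ?_⟩
    rw [← e.2, map_neg]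
    abel
  · rintro ⟨a, e⟩
    induction a using ind with
    | h a hP' hD' =>
    rw [map_cls, cls_eq_cls] at e
    obtain ⟨b', hb', e⟩ := e
    refine ⟨s a - i b', sub_mem (h.s_left a hP') (h.isMap_i.right b' hb'), ?_⟩
    rw [h.ext_iff, h.isMap_q.comm, h.r_D, h.q_i]
    simp only [map_sub, h.q_s, h.q_i, h.r_s, h.r_i, e, hD']
    simp

lemma exact_q (h : IsCone D P Q D' P' Q' D'' P'' Q'' φ i q r s) :
    Function.Exact (map i h.isMap_i) (map q h.isMap_q) := by
  intro a
  induction a using ind with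
  | h u hP hD =>
  rw [map_cls, cls_eq_zero]
  constructor
  · rintro ⟨a, ha, e⟩
    -- With `q u = D a`, the cycle `u` differs from `i (r u - φ a)` by `D'' (s a)`, up to signs that
    -- are invisible over `𝔽₂`.
    have h1 : D' (r u - φ a) = 0 := by
      have := h.r_D u
      rw [hD, map_zero, ← e, h.isMap_φ.comm] at this
      rw [map_sub, ZModModule.sub_eq_add, add_comm, ← this]
    refine ⟨cls (r u - φ a) (sub_mem (h.r_left u hP) (h.isMap_φ.left a ha)) h1, ?_⟩
    rw [map_cls, cls_eq_cls]
    refine ⟨-s a, neg_mem (h.s_left a ha), ?_⟩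
    rw [h.ext_iff, h.isMap_q.comm, h.r_D]
    simp only [map_sub, map_neg, h.q_s, h.q_i, h.r_s, h.r_i, e]
    simp
  · rintro ⟨a, e⟩
    induction a using ind with
    | h b hP' hD' =>
    rw [map_cls, cls_eq_cls] at e
    obtain ⟨u', hu', e⟩ := e
    refine ⟨-q u', neg_mem (h.isMap_q.right u' hu'), ?_⟩
    rw [map_neg, ← h.isMap_q.comm, e, map_sub, h.q_i]
    simp

lemma exact_φ (h : IsCone D P Q D' P' Q' D'' P'' Q'' φ i q r s) :
    Function.Exact (map q h.isMap_q) (map φ h.isMap_φ.swap) := by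
  intro a
  induction a using ind with
  | h a hP hD =>
  rw [map_cls, cls_eq_zero]
  constructor
  · rintro ⟨b, hb, e⟩
    -- The `r`-component of `D'' (s a + i b)` is `φ a + D' b = 2 φ a`, which vanishes in
    -- characteristic two.
    have h1 : D'' (s a + i b) = 0 := by
      rw [h.ext_iff, h.isMap_q.comm, h.r_D]
      simp only [map_add, h.q_s, h.q_i, h.r_s, h.r_i, hD, e, map_zero, add_zero, zero_add]
      exact ⟨trivial, ZModModule.add_self _⟩
    refine ⟨cls (s a + i b) (add_mem (h.s_right a hP) (h.isMap_i.left b hb)) h1, ?_⟩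
    rw [map_cls, cls_eq_cls]
    refine ⟨0, zero_mem _, ?_⟩
    rw [map_add, h.q_s, h.q_i]
    simp
  · rintro ⟨u, e⟩
    induction u using ind with
    | h u hP' hD' =>
    rw [map_cls, cls_eq_cls] at e
    obtain ⟨a', ha', e⟩ := e
    have h1 := h.r_D u
    rw [hD', map_zero] at h1
    refine ⟨φ a' + r u, add_mem (h.isMap_φ.left a' ha') (h.r_left u hP'), ?_⟩
    rw [map_add, ← h.isMap_φ.comm, e, map_sub, ZModModule.sub_eq_add, add_right_comm, ← h1,
      zero_add]

lemma swap (h : IsCone D P Q D' P' Q' D'' P'' Q'' φ i q r s) :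
    IsCone D Q P D' Q' P' D'' Q'' P'' φ i q r s :=
  ⟨h.isMap_φ.swap, h.isMap_i.swap, h.isMap_q.swap, h.r_right, h.r_left, h.s_right, h.s_left,
    h.q_i, h.q_s, h.r_i, h.r_s, h.sum, h.r_D⟩

end IsCone

/-- The Euler characteristic of the homology. -/
def euler (D : V →ₗ[ZMod 2] V) (P Q : Submodule (ZMod 2) V) : ℤ :=
  Module.finrank (ZMod 2) (Homology₂ D P Q) - Module.finrank (ZMod 2) (Homology₂ D Q P)

lemma finrank_zero [Module.Finite (ZMod 2) V] (P Q : Submodule (ZMod 2) V) :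
    Module.finrank (ZMod 2) (Homology₂ 0 P Q) = Module.finrank (ZMod 2) P := by
  have h1 := Submodule.finrank_quotient_add_finrank
    ((Q.map (0 : V →ₗ[ZMod 2] V)).comap (P ⊓ LinearMap.ker (0 : V →ₗ[ZMod 2] V)).subtype)
  have h2 : (Q.map (0 : V →ₗ[ZMod 2] V)).comap
      (P ⊓ LinearMap.ker (0 : V →ₗ[ZMod 2] V)).subtype = ⊥ := by
    rw [Submodule.map_zero, Submodule.comap_bot, Submodule.ker_subtype]
  have h3 : P ⊓ LinearMap.ker (0 : V →ₗ[ZMod 2] V) = P := by rw [LinearMap.ker_zero, inf_top_eq]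
  have h4 := congrArg (fun T : Submodule (ZMod 2) _ ↦ Module.finrank (ZMod 2) T) h2
  rw [finrank_bot] at h4
  rw [h4, add_zero] at h1
  exact h1.trans (by rw [h3])

end Homology₂

lemma finrank_eq_of_exact {A B C : Type*} [AddCommGroup A] [Module (ZMod 2) A] [AddCommGroup B]
    [Module (ZMod 2) B] [AddCommGroup C] [Module (ZMod 2) C] [Module.Finite (ZMod 2) B]
    {f : A →ₗ[ZMod 2] B} {g : B →ₗ[ZMod 2] C} (h : Function.Exact f g) :
    Module.finrank (ZMod 2) B = Module.finrank (ZMod 2) (LinearMap.range f) +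
      Module.finrank (ZMod 2) (LinearMap.range g) := by
  rw [← LinearMap.finrank_range_add_finrank_ker g, LinearMap.exact_iff.mp h, add_comm]

/-- Each of the six dimensions in the exact hexagon is the sum of the ranks of its two adjacent
maps, and these ranks cancel in the alternating sum. -/
lemma Homology₂.IsCone.euler_eq {D : V →ₗ[ZMod 2] V} {P Q : Submodule (ZMod 2) V}
    {D' : W →ₗ[ZMod 2] W} {P' Q' : Submodule (ZMod 2) W} {D'' : U →ₗ[ZMod 2] U}
    {P'' Q'' : Submodule (ZMod 2) U} {φ : V →ₗ[ZMod 2] W} {i : W →ₗ[ZMod 2] U}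
    {q : U →ₗ[ZMod 2] V} {r : U →ₗ[ZMod 2] W} {s : V →ₗ[ZMod 2] U}
    (h : IsCone D P Q D' P' Q' D'' P'' Q'' φ i q r s)
    [Module.Finite (ZMod 2) (Homology₂ D P Q)] [Module.Finite (ZMod 2) (Homology₂ D Q P)]
    [Module.Finite (ZMod 2) (Homology₂ D' P' Q')] [Module.Finite (ZMod 2) (Homology₂ D' Q' P')]
    [Module.Finite (ZMod 2) (Homology₂ D'' P'' Q'')]
    [Module.Finite (ZMod 2) (Homology₂ D'' Q'' P'')] :
    euler D P Q + euler D'' P'' Q'' = euler D' P' Q' := by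
  have h1 := finrank_eq_of_exact h.exact_i
  have h2 := finrank_eq_of_exact h.exact_q
  have h3 := finrank_eq_of_exact h.exact_φ
  have h4 := finrank_eq_of_exact h.swap.exact_i
  have h5 := finrank_eq_of_exact h.swap.exact_q
  have h6 := finrank_eq_of_exact h.swap.exact_φ
  simp only [euler]
  omega

end LinearAlgebra

/-! ### Reduction along an augmentation, and linear independence of the classes `[Q_x]`. -/

section Reduction

variable {ι : Type} [Fintype ι] {G : Type} [AddCommGroup G] {M : Type*} [AddCommGroup M]
  {A : DGAlgebra ι G} {f : G →+ M} {x : ι}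

/-- `ε` is a homogeneous augmentation of `A` at the idempotent `e x`. -/
structure DGAlgebra.IsAugmentation (A : DGAlgebra ι G) (x : ι) (ε : A.carrier →+* ZMod 2) :
    Prop where
  d : ∀ a, ε (A.d a) = 0
  e : ε (A.e x) = 1
  gr : ∀ p ≠ 0, ∀ a ∈ A.gr p, ε a = 0

variable {ε : A.carrier →+* ZMod 2}

/-- The augmentation kills `e y` for `y ≠ x` by orthogonality. For the degrees: if `(h, m) ≠ 0`,
then no `g` with `f g = m` makes `(h, g)` zero, so every summand of the piece is killed. This needs
no injectivity of `f`. -/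
lemma DGAlgebra.IsAugmentation.of_piece (hε : A.IsAugmentation x ε) {y z : ι} {h : ℤ} {m : M}
    {a : A.carrier} (ha : a ∈ A.piece f y z h m) (h0 : ε a ≠ 0) :
    y = x ∧ z = x ∧ h = 0 ∧ m = 0 := by
  have e0 : ∀ y ≠ x, ε (A.e y) = 0 := fun y hy ↦ by
    have := congrArg ε (A.e_complete.ortho hy)
    rwa [map_mul, hε.e, mul_one, map_zero] at this
  refine ⟨?_, ?_, ?_⟩
  · by_contra hy
    exact h0 (by rw [← ha.2.1, map_mul, e0 y hy, zero_mul])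
  · by_contra hy
    exact h0 (by rw [← ha.2.2, map_mul, e0 z hy, mul_zero])
  · by_contra hc
    refine h0 (Submodule.iSup_induction _ (motive := fun a ↦ ε a = 0) ha.1 ?_ (map_zero ε) ?_)
    · rintro ⟨g, hg⟩ a ha
      refine hε.gr (h, g) (fun e ↦ hc ?_) a ha
      obtain ⟨rfl, rfl⟩ := Prod.mk.inj e
      exact ⟨rfl, by rw [← hg, map_zero]⟩
    · intro a b ha hb
      rw [map_add, ha, hb, add_zero]

/-- The matrix `φ`, with the augmentation applied to its entries, as a linear map. -/
def red (ε : A.carrier →+* ZMod 2) {α β : Type} (φ : α → β →₀ A.carrier) :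
    (α →₀ ZMod 2) →ₗ[ZMod 2] (β →₀ ZMod 2) :=
  Finsupp.linearCombination (ZMod 2) fun g ↦
    Finsupp.mapRange.addMonoidHom (ε : A.carrier →+ ZMod 2) (φ g)

lemma red_single {α β : Type} (φ : α → β →₀ A.carrier) (g : α) :
    red ε φ (Finsupp.single g 1) =
      Finsupp.mapRange.addMonoidHom (ε : A.carrier →+ ZMod 2) (φ g) := by
  simp [red]

lemma red_mapRange {α β : Type} (φ : α → β →₀ A.carrier) (v : α →₀ A.carrier) :
    red ε φ (Finsupp.mapRange.addMonoidHom (ε : A.carrier →+ ZMod 2) v) =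
      Finsupp.mapRange.addMonoidHom (ε : A.carrier →+ ZMod 2)
        (Finsupp.linearCombination A.carrier φ v) := by
  induction v using Finsupp.induction_linear with
  | zero => simp
  | add v w hv hw => simp only [map_add, hv, hw]
  | single g a =>
    ext g'
    simp [red]

lemma red_comp {α β γ : Type} (φ : α → β →₀ A.carrier) (ψ : β → γ →₀ A.carrier)
    (v : α →₀ ZMod 2) : red ε (TypeD.compFun φ ψ) v = red ε ψ (red ε φ v) := by
  have : red ε (TypeD.compFun φ ψ) = red ε ψ ∘ₗ red ε φ := by
    refine Finsupp.lhom_ext' fun g ↦ LinearMap.ext_ring ?_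
    simp only [LinearMap.comp_apply, Finsupp.lsingle_apply, red_single, red_mapRange]
    rfl
  rw [this]; rfl

lemma red_add {α β : Type} (φ ψ : α → β →₀ A.carrier) :
    red ε (φ + ψ) = red ε φ + red ε ψ := by
  refine Finsupp.lhom_ext' fun g ↦ LinearMap.ext_ring ?_
  simp only [LinearMap.comp_apply, LinearMap.add_apply, Finsupp.lsingle_apply, red_single,
    Pi.add_apply, map_add]

lemma red_zero {α β : Type} : red ε (0 : α → β →₀ A.carrier) = 0 := by
  refine Finsupp.lhom_ext' fun g ↦ LinearMap.ext_ring ?_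
  simp [red_single]

/-- Since `ε ∘ d = 0`, only the `A`-linear term of `A.diff δ` survives reduction. -/
lemma mapRange_diff (hε : A.IsAugmentation x ε) {α : Type} (δ : α → α →₀ A.carrier)
    (v : α →₀ A.carrier) :
    Finsupp.mapRange.addMonoidHom (ε : A.carrier →+ ZMod 2) (A.diff δ v) =
      red ε δ (Finsupp.mapRange.addMonoidHom (ε : A.carrier →+ ZMod 2) v) := by
  rw [red_mapRange, DGAlgebra.diff, AddMonoidHom.add_apply, map_add]
  refine add_eq_right.mpr ?_
  ext g
  simp [hε.d]

namespace TypeD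

/-- This makes reduction a dg functor: closed morphisms become chain maps and homotopies become
chain homotopies. -/
lemma red_bdry (hε : A.IsAugmentation x ε) (X Y : TypeD A f) (h : X.gen → Y.gen →₀ A.carrier)
    (v : X.gen →₀ ZMod 2) :
    red ε (bdry X Y h) v = red ε Y.δ (red ε h v) + red ε h (red ε X.δ v) := by
  have : red ε (bdry X Y h) = red ε Y.δ ∘ₗ red ε h + red ε h ∘ₗ red ε X.δ := by
    refine Finsupp.lhom_ext' fun g ↦ LinearMap.ext_ring ?_
    simp only [LinearMap.comp_apply, LinearMap.add_apply, Finsupp.lsingle_apply, red_single,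
      red_mapRange, bdry, map_add, mapRange_diff hε]
    rfl
  rw [this]; rfl

/-- The span of the generators with idempotent `x`, intrinsic degree `m`, and homological degree of
parity `p`. -/
def part (X : TypeD A f) (x : ι) (m : M) (p : ZMod 2) : Submodule (ZMod 2) (X.gen →₀ ZMod 2) :=
  Finsupp.supported (ZMod 2) (ZMod 2) {g | X.idem g = x ∧ X.alex g = m ∧ (X.mas g : ZMod 2) = p}

lemma mem_part {X : TypeD A f} {m : M} {p : ZMod 2} {v : X.gen →₀ ZMod 2} :
    v ∈ X.part x m p ↔
      ∀ g, v g ≠ 0 → X.idem g = x ∧ X.alex g = m ∧ (X.mas g : ZMod 2) = p := by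
  rw [part, Finsupp.mem_supported]
  exact forall_congr' fun g ↦ by rw [Finset.mem_coe, Finsupp.mem_support_iff]; rfl

lemma red_mem_part (hε : A.IsAugmentation x ε) {X Y : TypeD A f} {k : ℤ}
    {φ : X.gen → Y.gen →₀ A.carrier} (hφ : IsDeg X Y k φ) {m : M} {p p' : ZMod 2}
    (hp : p' = p + k) (v : X.gen →₀ ZMod 2) (hv : v ∈ X.part x m p) :
    red ε φ v ∈ Y.part x m p' := by
  rw [red, Finsupp.linearCombination_apply]
  refine Submodule.sum_mem _ fun g hg ↦ Submodule.smul_mem _ _ ?_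
  obtain ⟨h1, h2, h3⟩ := (Finsupp.mem_supported _ _).mp hv hg
  refine (Finsupp.mem_supported _ _).mpr fun g' hg' ↦ ?_
  obtain ⟨-, k1, k2, k3⟩ := hε.of_piece (hφ g g') (by simpa using hg')
  refine ⟨k1, by rw [← h2]; exact (sub_eq_zero.mp k3).symm, ?_⟩
  rw [← sub_eq_zero.mp k2, Int.cast_add, h3, hp]

/-- The restriction to `X.part x` matters: as `ε (e y) = 0` for `y ≠ x`, the reduced identity is the
projection onto the generators with idempotent `x`. -/
lemma red_id (hε : A.IsAugmentation x ε) (X : TypeD A f) {m : M} {p : ZMod 2} (v : X.gen →₀ ZMod 2)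
    (hv : v ∈ X.part x m p) : red ε (idFun A X.idem) v = v := by
  conv_rhs => rw [← Finsupp.sum_single v]
  rw [red, Finsupp.linearCombination_apply]
  refine Finsupp.sum_congr fun g hg ↦ ?_
  obtain ⟨h1, -⟩ := (Finsupp.mem_supported _ _).mp hv hg
  simp [idFun, h1, hε.e]

lemma isMap_red (hε : A.IsAugmentation x ε) {X Y : TypeD A f} (φ : X ⟶ Y) (m : M) (p q : ZMod 2) :
    Homology₂.IsMap (red ε X.δ) (X.part x m p) (X.part x m q) (red ε Y.δ) (Y.part x m p)
      (Y.part x m q) (red ε φ.toFun) where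
  left := red_mem_part hε φ.deg (by simp)
  right := red_mem_part hε φ.deg (by simp)
  comm v := by
    have h := red_bdry hε X Y φ.toFun v
    rw [φ.closed, red_zero, LinearMap.zero_apply] at h
    rw [← sub_eq_zero, ZModModule.sub_eq_add, add_comm, ← h]

lemma red_homotopic (hε : A.IsAugmentation x ε) {X : TypeD A f} {φ : X ⟶ X}
    (h : homotopic A f φ (𝟙 X)) (m : M) (p : ZMod 2) :
    ∃ h : (X.gen →₀ ZMod 2) →ₗ[ZMod 2] (X.gen →₀ ZMod 2),
      (∀ v ∈ X.part x m p, h v ∈ X.part x m (p + 1)) ∧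
      ∀ v ∈ X.part x m p, red ε φ.toFun v - v = red ε X.δ (h v) + h (red ε X.δ v) := by
  obtain ⟨h, hh, e⟩ := h
  refine ⟨red ε h, red_mem_part hε hh (by congr 1), fun v hv ↦ ?_⟩
  have e1 : red ε (𝟙 X : X ⟶ X).toFun v = v := red_id hε X v hv
  rw [e, red_add, LinearMap.add_apply, e1, red_bdry hε, add_sub_cancel_left]

/-- The homology of the reduction of a Type D structure at `x`, in intrinsic degree `m` and
homological degree of parity `p`. -/
abbrev homology (ε : A.carrier →+* ZMod 2) (X : TypeD A f) (x : ι) (m : M) (p : ZMod 2) : Type :=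
  Homology₂ (red ε X.δ) (X.part x m p) (X.part x m (p + 1))

/-- Because homotopy is a congruence, equal classes in the quotient category are joined by an actual
homotopy. An isomorphism there is thus a homotopy equivalence, and its homotopies reduce to chain
homotopies. -/
lemma homologyEquiv (hε : A.IsAugmentation x ε) {X Y : HoTypeD A f} (i : X ≅ Y) (m : M)
    (p : ZMod 2) : Nonempty (X.as.homology ε x m p ≃ₗ[ZMod 2] Y.as.homology ε x m p) := by
  obtain ⟨φ, hφ⟩ := (HoTypeD.of A f).map_surjective (X := X.as) (Y := Y.as) i.hom
  obtain ⟨ψ, hψ⟩ := (HoTypeD.of A f).map_surjective (X := Y.as) (Y := X.as) i.inv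
  have h1 : homotopic A f (φ ≫ ψ) (𝟙 X.as) := by
    rw [← CategoryTheory.Quotient.functor_map_eq_iff (homotopic A f)]
    have := i.hom_inv_id
    rw [← hφ, ← hψ] at this
    exact ((HoTypeD.of A f).map_comp φ ψ).trans (this.trans ((HoTypeD.of A f).map_id X.as).symm)
  have h2 : homotopic A f (ψ ≫ φ) (𝟙 Y.as) := by
    rw [← CategoryTheory.Quotient.functor_map_eq_iff (homotopic A f)]
    have := i.inv_hom_id
    rw [← hφ, ← hψ] at this
    exact ((HoTypeD.of A f).map_comp ψ φ).trans (this.trans ((HoTypeD.of A f).map_id Y.as).symm)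
  obtain ⟨h, hh, e⟩ := red_homotopic hε h1 m p
  obtain ⟨h', hh', e'⟩ := red_homotopic hε h2 m p
  simp only [comp_toFun, red_comp] at e e'
  exact ⟨Homology₂.equiv _ (isMap_red hε φ m _ _) _ (isMap_red hε ψ m _ _) h hh e h' hh' e'⟩

/-- The Euler characteristic of the reduction of a Type D structure at `x` in intrinsic
degree `m`. -/
def euler (ε : A.carrier →+* ZMod 2) (X : TypeD A f) (x : ι) (m : M) : ℤ :=
  Homology₂.euler (red ε X.δ) (X.part x m 0) (X.part x m 1)

lemma euler_congr (hε : A.IsAugmentation x ε) {X Y : HoTypeD A f} (i : X ≅ Y) (m : M) :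
    X.as.euler ε x m = Y.as.euler ε x m := by
  obtain ⟨h0⟩ := homologyEquiv hε i m 0
  obtain ⟨h1⟩ := homologyEquiv hε i m 1
  exact congrArg₂ (fun a b : ℕ ↦ (a - b : ℤ)) h0.finrank_eq h1.finrank_eq

/-- `X` may have infinitely many generators, but its reduced homology is that of a finitely
generated representative. -/
lemma finite_homology (hε : A.IsAugmentation x ε) {X : HoTypeD A f} (h : isDb A f X) (m : M)
    (p : ZMod 2) : Module.Finite (ZMod 2) (X.as.homology ε x m p) := by
  obtain ⟨Y, ⟨hY, -⟩, ⟨i⟩⟩ := h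
  obtain ⟨e⟩ := homologyEquiv hε i m p
  have : Module.Finite (ZMod 2) (Y.gen →₀ ZMod 2) := inferInstance
  have : Module.Finite (ZMod 2) (Y.homology ε x m p) := inferInstance
  exact Module.Finite.equiv (M := Y.homology ε x m p) e.symm

lemma red_coneδ {X Y : TypeD A f} (φ : X ⟶ Y) (u : X.gen ⊕ Y.gen →₀ ZMod 2) :
    Finsupp.sumFinsuppLEquivProdFinsupp (ZMod 2) (red ε (coneδ φ) u) =
      (red ε X.δ (Finsupp.sumFinsuppLEquivProdFinsupp (ZMod 2) u).1,
        red ε φ.toFun (Finsupp.sumFinsuppLEquivProdFinsupp (ZMod 2) u).1 +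
          red ε Y.δ (Finsupp.sumFinsuppLEquivProdFinsupp (ZMod 2) u).2) := by
  induction u using Finsupp.induction_linear with
  | zero => simp
  | add u v hu hv =>
    simp only [map_add, hu, hv, Prod.fst_add, Prod.snd_add, Prod.mk_add_mk]
    congr 1
    abel
  | single g a =>
    rcases g with g | g <;> refine Prod.ext (Finsupp.ext fun i ↦ ?_) (Finsupp.ext fun i ↦ ?_) <;>
      simp [red, coneδ]

/-- The reduction of a mapping cone, as a direct sum. -/
def coneEquiv {X Y : TypeD A f} (φ : X ⟶ Y) :
    ((cone φ).gen →₀ ZMod 2) ≃ₗ[ZMod 2] (X.gen →₀ ZMod 2) × (Y.gen →₀ ZMod 2) :=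
  Finsupp.sumFinsuppLEquivProdFinsupp (ZMod 2) (α := X.gen) (β := Y.gen)

lemma coneEquiv_red {X Y : TypeD A f} (φ : X ⟶ Y) (u : (cone φ).gen →₀ ZMod 2) :
    coneEquiv φ (red ε (cone φ).δ u) = (red ε X.δ (coneEquiv φ u).1,
      red ε φ.toFun (coneEquiv φ u).1 + red ε Y.δ (coneEquiv φ u).2) :=
  red_coneδ φ u

/-- `X` enters the cone as `X[1]`, which flips the parity of its homological degrees. -/
lemma mem_part_cone {X Y : TypeD A f} (φ : X ⟶ Y) {m : M} {p : ZMod 2}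
    {u : (cone φ).gen →₀ ZMod 2} : u ∈ (cone φ).part x m p ↔
      (coneEquiv φ u).1 ∈ X.part x m (p + 1) ∧ (coneEquiv φ u).2 ∈ Y.part x m p := by
  have h : ∀ z : ℤ, ((z - 1 : ℤ) : ZMod 2) = p ↔ (z : ZMod 2) = p + 1 := fun z ↦ by
    rw [Int.cast_sub, Int.cast_one, sub_eq_iff_eq_add]
  rw [mem_part, mem_part, mem_part]
  refine Sum.forall.trans (and_congr (forall_congr' fun g ↦ ?_) Iff.rfl)
  exact imp_congr Iff.rfl (and_congr Iff.rfl (and_congr Iff.rfl (h _)))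

lemma isCone_red (hε : A.IsAugmentation x ε) {X Y : TypeD A f} (φ : X ⟶ Y) (m : M) :
    Homology₂.IsCone (red ε X.δ) (X.part x m 0) (X.part x m 1) (red ε Y.δ) (Y.part x m 0)
      (Y.part x m 1) (red ε (cone φ).δ) ((cone φ).part x m 0) ((cone φ).part x m 1)
      (red ε φ.toFun) ((coneEquiv φ).symm.toLinearMap ∘ₗ LinearMap.inr _ _ _)
      (LinearMap.fst _ _ _ ∘ₗ (coneEquiv φ).toLinearMap)
      (LinearMap.snd _ _ _ ∘ₗ (coneEquiv φ).toLinearMap)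
      ((coneEquiv φ).symm.toLinearMap ∘ₗ LinearMap.inl _ _ _) := by
  have hi : ∀ w, coneEquiv φ (((coneEquiv φ).symm.toLinearMap ∘ₗ LinearMap.inr _ _ _) w) =
    (0, w) := fun w ↦ (coneEquiv φ).apply_symm_apply (0, w)
  have hs : ∀ v, coneEquiv φ (((coneEquiv φ).symm.toLinearMap ∘ₗ LinearMap.inl _ _ _) v) =
    (v, 0) := fun v ↦ (coneEquiv φ).apply_symm_apply (v, 0)
  exact
  { isMap_φ := isMap_red hε φ m 0 1
    isMap_i :=
      { left := fun v hv ↦ (mem_part_cone φ).mpr (by rw [hi]; exact ⟨zero_mem _, hv⟩)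
        right := fun v hv ↦ (mem_part_cone φ).mpr (by rw [hi]; exact ⟨zero_mem _, hv⟩)
        comm := fun v ↦ (coneEquiv φ).injective (by
          rw [coneEquiv_red, hi, hi, map_zero, map_zero, zero_add]) }
    isMap_q :=
      { left := fun u hu ↦ ((mem_part_cone φ).mp hu).1
        right := fun u hu ↦ ((mem_part_cone φ).mp hu).1
        comm := fun u ↦ congrArg Prod.fst (coneEquiv_red φ u) }
    r_left := fun u hu ↦ ((mem_part_cone φ).mp hu).2
    r_right := fun u hu ↦ ((mem_part_cone φ).mp hu).2
    s_left := fun v hv ↦ (mem_part_cone φ).mpr (by rw [hs]; exact ⟨hv, zero_mem _⟩)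
    s_right := fun v hv ↦ (mem_part_cone φ).mpr (by rw [hs]; exact ⟨hv, zero_mem _⟩)
    q_i := fun w ↦ congrArg Prod.fst (hi w)
    q_s := fun v ↦ congrArg Prod.fst (hs v)
    r_i := fun w ↦ congrArg Prod.snd (hi w)
    r_s := fun v ↦ congrArg Prod.snd (hs v)
    sum := fun u ↦ (coneEquiv φ).injective (by
      rw [map_add, hi, hs]
      exact Prod.ext (zero_add _) (add_zero _))
    r_D := fun u ↦ congrArg Prod.snd (coneEquiv_red φ u) }

lemma euler_distinguished (hε : A.IsAugmentation x ε) {X Y Z : HoTypeD A f} {u : X ⟶ Y} {v : Y ⟶ Z}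
    {w : Z ⟶ (HoTypeD.susp A f).obj X} (h : HoTypeD.IsDistinguished u v w) (hX : isDb A f X)
    (hY : isDb A f Y) (hZ : isDb A f Z) (m : M) :
    X.as.euler ε x m + Z.as.euler ε x m = Y.as.euler ε x m := by
  obtain ⟨X', Y', φ, a, b, c, -⟩ := h
  rw [euler_congr hε a, euler_congr hε b, euler_congr hε c]
  -- The models `X'`, `Y'` of the triangle need not be finitely generated; the finite dimensions
  -- required by the hexagon are transported from `X`, `Y`, `Z`.
  have fin : ∀ {X : HoTypeD A f} {X' : TypeD A f} (_ : X ≅ (HoTypeD.of A f).obj X')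
      (_ : isDb A f X) p, Module.Finite (ZMod 2) (X'.homology ε x m p) := fun a hX p ↦ by
    have := finite_homology hε hX m p
    obtain ⟨e⟩ := homologyEquiv hε a m p
    exact Module.Finite.equiv e
  have : Module.Finite (ZMod 2) (Homology₂ (red ε X'.δ) (X'.part x m 0) (X'.part x m 1)) :=
    fin a hX 0
  have : Module.Finite (ZMod 2) (Homology₂ (red ε X'.δ) (X'.part x m 1) (X'.part x m 0)) :=
    fin a hX 1
  have : Module.Finite (ZMod 2) (Homology₂ (red ε Y'.δ) (Y'.part x m 0) (Y'.part x m 1)) :=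
    fin b hY 0
  have : Module.Finite (ZMod 2) (Homology₂ (red ε Y'.δ) (Y'.part x m 1) (Y'.part x m 0)) :=
    fin b hY 1
  have : Module.Finite (ZMod 2) (Homology₂ (red ε (cone φ).δ) ((cone φ).part x m 0)
      ((cone φ).part x m 1)) :=
    fin c hZ 0
  have : Module.Finite (ZMod 2) (Homology₂ (red ε (cone φ).δ) ((cone φ).part x m 1)
      ((cone φ).part x m 0)) :=
    fin c hZ 1
  exact (isCone_red hε φ m).euler_eq

open Classical in
lemma finrank_part_twist_Q (y : ι) (m m' : M) (p : ZMod 2) :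
    Module.finrank (ZMod 2) ((twist m' (Q A f y)).part x m p) =
      if y = x ∧ m' = m ∧ p = 0 then 1 else 0 := by
  split_ifs with h
  · obtain ⟨rfl, rfl, rfl⟩ := h
    have : (twist m' (Q A f y)).part y m' 0 = ⊤ :=
      eq_top_iff.mpr fun v _ ↦ mem_part.mpr fun g _ ↦ ⟨rfl, zero_add _, Int.cast_zero⟩
    rw [this, finrank_top]
    exact (Module.finrank_finsupp_self (ZMod 2) (ι := Unit)).trans Fintype.card_unit
  · have : (twist m' (Q A f y)).part x m p = ⊥ := by
      refine eq_bot_iff.mpr fun v hv ↦ (Submodule.mem_bot _).mpr (Finsupp.ext fun g ↦ ?_)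
      by_contra hg
      obtain ⟨h1, h2, h3⟩ := mem_part.mp hv g hg
      exact h ⟨h1, (zero_add m').symm.trans h2, h3.symm.trans Int.cast_zero⟩
    rw [this, finrank_bot]

open Classical in
lemma euler_twist_Q (y : ι) (m m' : M) :
    (twist m' (Q A f y)).euler ε x m = if y = x ∧ m' = m then 1 else 0 := by
  have : Module.Finite (ZMod 2) ((twist m' (Q A f y)).gen →₀ ZMod 2) :=
    inferInstanceAs (Module.Finite (ZMod 2) (Unit →₀ ZMod 2))
  have h : red ε (twist m' (Q A f y)).δ = 0 := red_zero
  rw [euler, Homology₂.euler, h, Homology₂.finrank_zero, Homology₂.finrank_zero,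
    finrank_part_twist_Q, finrank_part_twist_Q]
  by_cases h : y = x ∧ m' = m <;> simp [h]

end TypeD

/-- The additive map on the Grothendieck group induced by the Euler characteristic. -/
def K0.euler (hε : A.IsAugmentation x ε) (m : M) : K0 A f →+ ℤ :=
  QuotientAddGroup.lift (K0Relations A f)
    (FreeAbelianGroup.lift (Quotient.lift (fun X : Db A f ↦ X.obj.as.euler ε x m)
      fun _ _ ⟨i⟩ ↦ TypeD.euler_congr hε ((isDb A f).ι.mapIso i) m)) <| by
    rw [K0Relations, AddSubgroup.closure_le]
    rintro _ ⟨X, Y, Z, u, v, w, h, rfl⟩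
    have := TypeD.euler_distinguished hε h X.property Y.property Z.property m
    simp only [SetLike.mem_coe, AddMonoidHom.mem_ker, map_sub, map_add, Db.cls,
      FreeAbelianGroup.lift_apply_of]
    exact sub_eq_zero.mpr this

lemma K0.euler_mk (hε : A.IsAugmentation x ε) (m : M) (X : Db A f) :
    K0.euler hε m (K0.mk X) = X.obj.as.euler ε x m :=
  FreeAbelianGroup.lift_apply_of _ _

-- Both sides are additive in `r`, so `r` may be taken to be a multiple of one `m'`. This `m'` moves
-- the generator of `Q_y` to intrinsic degree `m'`, where the reduced complex is one-dimensional if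
-- `y = x` and has no part at `x` otherwise.
open Classical in
lemma K0.euler_smul_Q (hε : A.IsAugmentation x ε) (y : ι) (m : M) (r : AddMonoidAlgebra ℤ M) :
    K0.euler hε m (r • K0.mk (Db.Q A f y)) = if y = x then r.coeff m else 0 := by
  classical
  induction r using AddMonoidAlgebra.induction_linear with
  | zero => simp
  | add r s hr hs => rw [add_smul, map_add, hr, hs]; split_ifs <;> simp
  | single m' c =>
    have h1 : (AddMonoidAlgebra.single m' c : AddMonoidAlgebra ℤ M) =
      c • AddMonoidAlgebra.single m' 1 := by simp
    rw [h1, smul_assoc, map_zsmul, single_smul_mk, euler_mk]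
    have h2 : (twistObj m' (Db.Q A f y)).obj.as.euler ε x m = _ :=
      TypeD.euler_twist_Q (f := f) y m m'
    rw [h2]
    by_cases h : y = x <;> simp [h, Finsupp.single_apply]

/-- The functionals `K0.euler`, over all `x` and `m`, read off every integer coefficient of a linear
relation. -/
lemma K0.linearIndependent_Q (h : ∀ x, ∃ ε, A.IsAugmentation x ε) :
    LinearIndependent (AddMonoidAlgebra ℤ M) fun x ↦ K0.mk (Db.Q A f x) := by
  classical
  rw [Fintype.linearIndependent_iff]
  intro r hr x
  obtain ⟨ε, hε⟩ := h x
  ext m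
  have := congrArg (K0.euler hε m) hr
  rw [map_sum, map_zero] at this
  simpa only [K0.euler_smul_Q, Finset.sum_ite_eq', Finset.mem_univ, if_true,
    AddMonoidAlgebra.coeff_zero, Finsupp.zero_apply] using this

end Reduction

/-! ### Stripping the leftmost factor in a tensor algebra. -/

section LeftDerivative

variable {V : Type*} [AddCommGroup V] [Module (ZMod 2) V]

/-- The representation of the tensor algebra that records the left derivative. -/
def leftDerivRep (l : V →ₗ[ZMod 2] ZMod 2) :
    V →ₗ[ZMod 2] Module.End (ZMod 2) (TensorAlgebra (ZMod 2) V × TensorAlgebra (ZMod 2) V) :=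
  LinearMap.mk₂ (ZMod 2) (fun v t ↦ (TensorAlgebra.ι (ZMod 2) v * t.1, l v • t.1))
    (fun v w t ↦ by simp [add_mul, add_smul])
    (fun c v t ↦ by simp [mul_smul])
    (fun v s t ↦ by simp [mul_add])
    (fun c v t ↦ Prod.ext (mul_smul_comm _ _ _) (smul_comm _ _ _))

/-- The linear map on the tensor algebra that applies a linear form to the leftmost factor. -/
def leftDeriv (l : V →ₗ[ZMod 2] ZMod 2) :
    TensorAlgebra (ZMod 2) V →ₗ[ZMod 2] TensorAlgebra (ZMod 2) V :=
  LinearMap.snd _ _ _ ∘ₗ LinearMap.applyₗ (1, 0) ∘ₗ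
    (TensorAlgebra.lift (ZMod 2) (leftDerivRep l)).toLinearMap

lemma leftDerivRep_fst (l : V →ₗ[ZMod 2] ZMod 2) (t : TensorAlgebra (ZMod 2) V)
    (u : TensorAlgebra (ZMod 2) V × TensorAlgebra (ZMod 2) V) :
    (TensorAlgebra.lift (ZMod 2) (leftDerivRep l) t u).1 = t * u.1 := by
  induction t using TensorAlgebra.induction generalizing u with
  | algebraMap r => simp [Algebra.smul_def]
  | ι v => simp [leftDerivRep]
  | mul a b ha hb => simp [ha, hb, mul_assoc]
  | add a b ha hb => simp [ha, hb, add_mul]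

/-- In the representation `v · (t, u) = (v t, l(v) t)` the first component accumulates the product,
while the second is overwritten at each step. Only the letter acting last, that is the leftmost one,
is therefore seen by `l`. -/
lemma leftDeriv_ι_mul (l : V →ₗ[ZMod 2] ZMod 2) (v : V) (t : TensorAlgebra (ZMod 2) V) :
    leftDeriv l (TensorAlgebra.ι (ZMod 2) v * t) = l v • t := by
  have h : leftDeriv l (TensorAlgebra.ι (ZMod 2) v * t) =
      l v • (TensorAlgebra.lift (ZMod 2) (leftDerivRep l) t (1, 0)).1 := by
    simp [leftDeriv, leftDerivRep]
  rw [h, leftDerivRep_fst, mul_one]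

end LeftDerivative

/-! ### Eliminating one basis element along a vector with coefficients in `𝔽₂`. -/

section Elimination

variable {R : Type*} [Ring R] {N : Type*} [AddCommGroup N] [Module R N] {α : Type}

lemma linearCombination_subtypeDomain (F : α → N) (g₀ : α) (w : α →₀ R) :
    Finsupp.linearCombination R F w = Finsupp.linearCombination R
      (fun g : {g // g ≠ g₀} ↦ F g) (w.subtypeDomain fun g ↦ g ≠ g₀) + w g₀ • F g₀ := by
  classical
  induction w using Finsupp.induction_linear with
  | zero => simp
  | add v w hv hw =>
    rw [map_add, hv, hw, Finsupp.subtypeDomain_add, map_add, Finsupp.add_apply, add_smul]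
    abel
  | single g a =>
    by_cases h : g = g₀
    · subst h
      have : (Finsupp.single g a).subtypeDomain (fun i ↦ i ≠ g) = 0 := by
        ext i
        simp [i.2.symm]
      rw [this, map_zero, zero_add, Finsupp.linearCombination_single, Finsupp.single_eq_same]
    · have : (Finsupp.single g a).subtypeDomain (fun g ↦ g ≠ g₀) = Finsupp.single ⟨g, h⟩ a := by
        ext i
        simp [Finsupp.single_apply, Subtype.ext_iff]
      rw [this]
      simp [h]

variable [Algebra (ZMod 2) R]

lemma add_self_of_algebra (R : Type*) [Ring R] [Algebra (ZMod 2) R] {N : Type*} [AddCommGroup N]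
    [Module R N] (v : N) : v + v = 0 := by
  have h : (1 + 1 : R) = 0 := by
    rw [← map_one (algebraMap (ZMod 2) R), ← map_add, show (1 + 1 : ZMod 2) = 0 from rfl, map_zero]
  rw [← one_smul R v, ← add_smul, h, zero_smul]

/-- A vector over `𝔽₂`, with coefficients extended to `R`. -/
def extendScalars (R : Type*) [Ring R] [Algebra (ZMod 2) R] (c : α →₀ ZMod 2) : α →₀ R :=
  c.mapRange (algebraMap (ZMod 2) R) (map_zero _)

/-- The projection onto the span of the basis elements other than `g₀`, whose kernel is spanned by
`c` if the coefficient of `g₀` in `c` is one. -/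
def elim (R : Type*) [Ring R] [Algebra (ZMod 2) R] (c : α →₀ ZMod 2) (g₀ : α) :
    (α →₀ R) →ₗ[R] ({g // g ≠ g₀} →₀ R) :=
  Finsupp.lsubtypeDomain {g | g ≠ g₀} + (Finsupp.lapply g₀ : (α →₀ R) →ₗ[R] R).smulRight
    ((extendScalars R c).subtypeDomain fun g ↦ g ≠ g₀)

lemma elim_apply (c : α →₀ ZMod 2) (g₀ : α) (w : α →₀ R) (g : {g // g ≠ g₀}) :
    elim R c g₀ w g = w g + w g₀ * algebraMap (ZMod 2) R (c g) := rfl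

/-- As `c g₀ = 1`, the quotient by `c` is free on the basis elements other than `g₀`, and `elim` is
the quotient map: it replaces `g₀` by the remaining terms of `c`, with no sign in characteristic
two. A linear map that kills `c` factors through it. -/
lemma linearCombination_elim {c : α →₀ ZMod 2} {g₀ : α} (hc : c g₀ = 1) {F : α → N}
    (hF : Finsupp.linearCombination R F (extendScalars R c) = 0) (w : α →₀ R) :
    Finsupp.linearCombination R (fun g : {g // g ≠ g₀} ↦ F g) (elim R c g₀ w) =
      Finsupp.linearCombination R F w := by
  rw [linearCombination_subtypeDomain F g₀] at hF ⊢
  have h1 : (extendScalars R c) g₀ = 1 := by simp [extendScalars, hc]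
  rw [h1, one_smul] at hF
  rw [elim, LinearMap.add_apply, map_add, LinearMap.smulRight_apply, map_smul,
    eq_neg_of_add_eq_zero_left hF, smul_neg]
  congr 1
  exact neg_eq_of_add_eq_zero_left (add_self_of_algebra R _)

lemma elim_single {c : α →₀ ZMod 2} {g₀ g : α} (hg : g ≠ g₀) (a : R) :
    elim R c g₀ (Finsupp.single g a) = Finsupp.single ⟨g, hg⟩ a := by
  classical
  ext i
  simp [elim_apply, Finsupp.single_apply, Subtype.ext_iff, hg]

lemma linearCombination_single_elim_add {c : α →₀ ZMod 2} {g₀ : α} (hc : c g₀ = 1) (w : α →₀ R) :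
    Finsupp.linearCombination R (fun g : {g // g ≠ g₀} ↦ Finsupp.single g.1 1) (elim R c g₀ w) +
      w g₀ • extendScalars R c = w := by
  have h : ∀ w : α →₀ R, Finsupp.linearCombination R (fun g : {g // g ≠ g₀} ↦ Finsupp.single g.1 1)
      (w.subtypeDomain fun g ↦ g ≠ g₀) = w - w g₀ • Finsupp.single g₀ 1 := fun w ↦ by
    rw [eq_sub_iff_add_eq, ← linearCombination_subtypeDomain (fun g ↦ Finsupp.single g (1 : R))]
    simp [Finsupp.linearCombination_apply]
  have h1 : extendScalars R c g₀ = 1 := by simp [extendScalars, hc]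
  have h2 := add_self_of_algebra R (w g₀ • extendScalars R c)
  have h3 := add_self_of_algebra R (w g₀ • Finsupp.single g₀ (1 : R))
  have h4 : elim R c g₀ w = (w.subtypeDomain fun g ↦ g ≠ g₀) +
    w g₀ • (extendScalars R c).subtypeDomain fun g ↦ g ≠ g₀ := rfl
  rw [h4, map_add, map_smul, h, h, h1, one_smul, smul_sub]
  calc _ = w + (w g₀ • extendScalars R c + w g₀ • extendScalars R c) -
        (w g₀ • Finsupp.single g₀ (1 : R) + w g₀ • Finsupp.single g₀ (1 : R)) := by abel
    _ = w := by rw [h2, h3, add_zero, sub_zero]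

lemma elim_extendScalars {c : α →₀ ZMod 2} {g₀ : α} (hc : c g₀ = 1) :
    elim R c g₀ (extendScalars R c) = 0 := by
  ext g
  rw [elim_apply, show extendScalars R c g₀ = 1 by simp [extendScalars, hc], one_mul]
  exact add_self_of_algebra R _

lemma linearCombination_extendScalars [Module (ZMod 2) N] [IsScalarTower (ZMod 2) R N] (F : α → N)
    (c : α →₀ ZMod 2) : Finsupp.linearCombination R F (extendScalars R c) =
      Finsupp.linearCombination (ZMod 2) F c := by
  rw [extendScalars, Finsupp.linearCombination_apply, Finsupp.sum_mapRange_index (by simp)]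
  simp [Finsupp.linearCombination_apply]

/-- The coefficients of `c` lie in `𝔽₂`, so they are central and pass through every `𝔽₂`-linear map.
This is applied to the differential of `A` and to the embedding of `A` in its tensor algebra. -/
lemma elim_mapRange {R' : Type*} [Ring R'] [Algebra (ZMod 2) R'] (c : α →₀ ZMod 2) (g₀ : α)
    (l : R →ₗ[ZMod 2] R') (w : α →₀ R) :
    elim R' c g₀ (Finsupp.mapRange.linearMap l w) =
      Finsupp.mapRange.linearMap l (elim R c g₀ w) := by
  ext g
  simp only [elim_apply, Finsupp.mapRange.linearMap_apply, Finsupp.mapRange_apply, map_add,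
    ← Algebra.commutes, ← Algebra.smul_def, map_smul]

end Elimination

/-! ### Homogeneous vectors killed by `δ¹` in a bounded Type D structure. -/

section Kernel

variable {ι : Type} [Fintype ι] {G : Type} [AddCommGroup G] {M : Type*} [AddCommGroup M]
  {A : DGAlgebra ι G} {f : G →+ M}

lemma DGAlgebra.exists_projection (A : DGAlgebra ι G) (s : Set (ℤ × G)) :
    ∃ P : A.carrier →ₗ[ZMod 2] A.carrier,
      (∀ p ∈ s, ∀ a ∈ A.gr p, P a = a) ∧ ∀ p ∉ s, ∀ a ∈ A.gr p, P a = 0 := by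
  have h : IsCompl (⨆ p ∈ s, A.gr p) (⨆ p ∈ sᶜ, A.gr p) := by
    refine ⟨A.gr_indep.disjoint_biSup_biSup disjoint_compl_right, ?_⟩
    rw [codisjoint_iff, eq_top_iff, ← A.gr_span]
    refine iSup_le fun p ↦ ?_
    by_cases hp : p ∈ s
    · exact le_sup_of_le_left (le_iSup₂_of_le p hp le_rfl)
    · exact le_sup_of_le_right (le_iSup₂_of_le p hp le_rfl)
  refine ⟨Submodule.projection _ _ h, fun p hp a ha ↦ ?_, fun p hp a ha ↦ ?_⟩
  · exact Submodule.projection_apply_left h ⟨a, (le_iSup₂_of_le p hp le_rfl : A.gr p ≤ _) ha⟩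
  · exact (Submodule.projection_apply_eq_zero_iff h).mpr
      ((le_iSup₂_of_le p hp le_rfl : A.gr p ≤ _) ha)

namespace TypeD

lemma linearCombination_iter_succ (X : TypeD A f) (k : ℕ) (v : X.gen →₀ ZMod 2) :
    Finsupp.linearCombination (ZMod 2) (X.iter (k + 1)) v =
      (Finsupp.linearCombination (ZMod 2) X.δ v).sum
        fun g a ↦ TensorAlgebra.ι (ZMod 2) a • X.iter k g := by
  induction v using Finsupp.induction_linear with
  | zero => simp
  | add v w hv hw =>
    rw [map_add, map_add, hv, hw, Finsupp.sum_add_index'] <;> simp [add_smul]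
  | single g r =>
    rcases (by decide : ∀ r : ZMod 2, r = 0 ∨ r = 1) r with rfl | rfl
    · simp
    · rw [Finsupp.linearCombination_single, Finsupp.linearCombination_single, one_smul, one_smul,
        iter]

/-- In `(δ¹)ᵏ⁺¹ v` the coefficients of `δ¹ v` are the leftmost tensor factors, so a linear form on
that factor turns the vanishing of `(δ¹)ᵏ⁺¹ v` into that of `(δ¹)ᵏ` on `(l ⊗ 1) δ¹ v`. -/
lemma leftDeriv_iter (X : TypeD A f) (k : ℕ) (v : X.gen →₀ ZMod 2)
    (h : Finsupp.linearCombination (ZMod 2) (X.iter (k + 1)) v = 0)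
    (l : A.carrier →ₗ[ZMod 2] ZMod 2) :
    Finsupp.linearCombination (ZMod 2) (X.iter k) (Finsupp.mapRange.linearMap l
      (Finsupp.linearCombination (ZMod 2) X.δ v)) = 0 := by
  rw [linearCombination_iter_succ] at h
  have h1 := congrArg (Finsupp.mapRange.linearMap (leftDeriv l)) h
  rw [map_finsuppSum, map_zero] at h1
  rw [← h1, Finsupp.linearCombination_apply, Finsupp.mapRange.linearMap_apply,
    Finsupp.sum_mapRange_index (by simp)]
  refine Finsupp.sum_congr fun g _ ↦ ?_
  ext g'
  simp [leftDeriv_ι_mul]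

/-- A nonzero bounded Type D structure has a nonzero element on which `δ¹` vanishes. -/
lemma exists_kernel {X : TypeD A f} (hX : X.IsFGBounded) [Nonempty X.gen] :
    ∃ v : X.gen →₀ ZMod 2, v ≠ 0 ∧ Finsupp.linearCombination (ZMod 2) X.δ v = 0 := by
  classical
  obtain ⟨-, k₀, hk⟩ := hX
  -- Boundedness enters here: `(δ¹)^k₀` kills every generator. The minimal such `k` is positive
  -- because `(δ¹)⁰` is injective.
  have hex : ∃ k, ∃ v : X.gen →₀ ZMod 2, v ≠ 0 ∧
      Finsupp.linearCombination (ZMod 2) (X.iter k) v = 0 :=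
    ⟨k₀, Finsupp.single (Classical.arbitrary _) 1, by simp, by simp [hk]⟩
  obtain ⟨v, hv, h⟩ := Nat.find_spec hex
  refine ⟨v, hv, ?_⟩
  have h0 : Nat.find hex ≠ 0 := by
    intro h0
    rw [h0] at h
    refine hv (Finsupp.ext fun g ↦ ?_)
    have h1 := DFunLike.congr_fun h g
    simpa [iter, Finsupp.linearCombination_apply, Finsupp.sum_apply, Finsupp.single_apply] using h1
  obtain ⟨k, hk'⟩ := Nat.exists_eq_succ_of_ne_zero h0
  rw [hk'] at h
  have hmin : ∀ w : X.gen →₀ ZMod 2, Finsupp.linearCombination (ZMod 2) (X.iter k) w = 0 →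
      w = 0 := fun w hw ↦ by
    by_contra hw0
    exact Nat.find_min hex (by omega : k < _) ⟨w, hw0, hw⟩
  ext g
  -- By minimality `(δ¹)ᵏ` is injective, so every linear form vanishes on all coefficients of `δ¹
  -- v`; linear forms separate the points of `A`.
  rw [Finsupp.zero_apply, ← Module.forall_dual_apply_eq_zero_iff (ZMod 2)]
  intro l
  exact DFunLike.congr_fun (hmin _ (X.leftDeriv_iter k v h l)) g

/-- A homogeneous vector on which `δ¹` vanishes, together with a generator occurring in it. -/
structure IsKernelVector (X : TypeD A f) (c : X.gen →₀ ZMod 2) (g₀ : X.gen) : Prop where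
  coeff : c g₀ = 1
  homog : ∀ g, c g ≠ 0 → X.idem g = X.idem g₀ ∧ X.mas g = X.mas g₀ ∧ X.alex g = X.alex g₀
  δ : Finsupp.linearCombination A.carrier X.δ (extendScalars A.carrier c) = 0

/-- For a fixed target `g'`, generators that differ in idempotent or bidegree have their entries `δ
g g'` in independent summands of `A`. They cannot cancel each other, so each homogeneous component
of a kernel vector is again one. -/
lemma exists_isKernelVector {X : TypeD A f} (hX : X.IsFGBounded) [Nonempty X.gen] :
    ∃ c g₀, IsKernelVector X c g₀ := by
  classical
  obtain ⟨v, hv, h⟩ := exists_kernel hX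
  obtain ⟨g₀, hg₀⟩ := Finsupp.ne_iff.mp hv
  let p : X.gen → Prop := fun g ↦
    X.idem g = X.idem g₀ ∧ X.mas g = X.mas g₀ ∧ X.alex g = X.alex g₀
  refine ⟨v.filter p, g₀, ?_, ?_, ?_⟩
  · rw [Finsupp.filter_apply_pos p v ⟨rfl, rfl, rfl⟩]
    exact (by decide : ∀ r : ZMod 2, r ≠ 0 → r = 1) _ hg₀
  · intro g hg
    by_contra hp
    exact hg (Finsupp.filter_apply_neg p v hp)
  · ext g'
    obtain ⟨P, hP1, hP2⟩ := A.exists_projection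
      {q | q.1 = X.mas g₀ + 1 - X.mas g' ∧ f q.2 = X.alex g₀ - X.alex g'}
    -- `P` keeps the degrees possible for an entry from a generator of the bidegree of `g₀` to `g'`;
    -- multiplication by `A.e (X.idem g₀)` then removes the generators with the same bidegree and
    -- another idempotent.
    have hP : ∀ g, A.e (X.idem g₀) * P (X.δ g g') = if p g then X.δ g g' else 0 := by
      intro g
      have hδ := X.δ_mem g g'
      split_ifs with hp
      · obtain ⟨h1, h2, h3⟩ := hp
        have : P (X.δ g g') = X.δ g g' := by
          refine Submodule.iSup_induction _ (motive := fun a ↦ P a = a) hδ.1 ?_ (map_zero P) ?_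
          · rintro ⟨q, hq⟩ a ha
            exact hP1 _ ⟨by rw [h2], by rw [hq, h3]⟩ a ha
          · intro a b ha hb
            rw [map_add, ha, hb]
        rw [this, ← h1, hδ.2.1]
      · by_cases hd : X.mas g = X.mas g₀ ∧ X.alex g = X.alex g₀
        · obtain ⟨h2, h3⟩ := hd
          have : P (X.δ g g') = X.δ g g' := by
            refine Submodule.iSup_induction _ (motive := fun a ↦ P a = a) hδ.1 ?_ (map_zero P) ?_
            · rintro ⟨q, hq⟩ a ha
              exact hP1 _ ⟨by rw [h2], by rw [hq, h3]⟩ a ha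
            · intro a b ha hb
              rw [map_add, ha, hb]
          rw [this, ← hδ.2.1, ← mul_assoc, A.e_complete.ortho, zero_mul]
          exact fun h1 ↦ hp ⟨h1.symm, h2, h3⟩
        · have : P (X.δ g g') = 0 := by
            refine Submodule.iSup_induction _ (motive := fun a ↦ P a = 0) hδ.1 ?_ (map_zero P) ?_
            · rintro ⟨q, hq⟩ a ha
              refine hP2 _ (fun hs ↦ hd ⟨?_, ?_⟩) a ha
              · have := hs.1
                dsimp only at this
                omega
              · have := hs.2
                dsimp only at this
                rw [hq] at this
                exact sub_left_injective this
            · intro a b ha hb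
              rw [map_add, ha, hb, add_zero]
          rw [this, mul_zero]
    have h1 := congrArg (fun a ↦ A.e (X.idem g₀) * P a) (DFunLike.congr_fun h g')
    simp only [Finsupp.linearCombination_apply, Finsupp.sum_apply, Finsupp.smul_apply,
      Finsupp.zero_apply, map_zero, mul_zero] at h1
    rw [Finsupp.sum, map_sum, Finset.mul_sum] at h1
    simp only [map_smul, mul_smul_comm, hP] at h1
    rw [extendScalars, Finsupp.linearCombination_apply, Finsupp.sum_mapRange_index (by simp),
      Finsupp.sum_apply, Finsupp.zero_apply, ← h1, Finsupp.sum, Finsupp.support_filter,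
      Finset.sum_filter]
    refine Finset.sum_congr rfl fun g _ ↦ ?_
    split_ifs with hp
    · rw [Finsupp.filter_apply_pos p v hp, Finsupp.smul_apply, smul_eq_mul, ← Algebra.smul_def]
    · rw [smul_zero]

end TypeD
end Kernel

/-! ### Splitting off kernel vectors, and generation of the Grothendieck group. -/

section Generation

variable {ι : Type} [Fintype ι] {G : Type} [AddCommGroup G] {M : Type*} [AddCommGroup M]
  {A : DGAlgebra ι G} {f : G →+ M}

namespace TypeD

/-- The morphism of Type D structures given by a homogeneous chain map of the associated
dg modules. -/
def homOfLinear {X Y : TypeD A f} (F : (X.gen →₀ A.carrier) →ₗ[A.carrier] (Y.gen →₀ A.carrier))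
    (hdeg : IsDeg X Y 0 fun g ↦ F (Finsupp.single g (A.e (X.idem g))))
    (hF : ∀ w, A.diff Y.δ (F w) = F (A.diff X.δ w)) : X ⟶ Y where
  toFun g := F (Finsupp.single g (A.e (X.idem g)))
  deg := hdeg
  closed := by
    funext g
    have h : compFun X.δ (fun g ↦ F (Finsupp.single g (A.e (X.idem g)))) g =
        F (compFun X.δ (idFun A X.idem) g) :=
      (Finsupp.apply_linearCombination A.carrier F (idFun A X.idem) (X.δ g)).symm
    rw [bdry, h, comp_id X.isDeg_δ, hF, DGAlgebra.diff_single, A.d_e, Finsupp.single_zero, zero_add,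
      e_smul_δ]
    exact A.add_self _

/-- The isomorphism of Type D structures given by homogeneous inverse isomorphisms of the
associated dg modules. -/
def isoOfLinear {X Y : TypeD A f}
    (F : (X.gen →₀ A.carrier) ≃ₗ[A.carrier] (Y.gen →₀ A.carrier))
    (hdeg : IsDeg X Y 0 fun g ↦ F (Finsupp.single g (A.e (X.idem g))))
    (hdeg' : IsDeg Y X 0 fun g ↦ F.symm (Finsupp.single g (A.e (Y.idem g))))
    (hF : ∀ w, A.diff Y.δ (F w) = F (A.diff X.δ w)) : X ≅ Y where
  hom := homOfLinear F.toLinearMap hdeg hF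
  inv := homOfLinear F.symm.toLinearMap hdeg' fun w ↦ F.injective <| by
    change F (A.diff X.δ (F.symm w)) = F (F.symm (A.diff Y.δ w))
    rw [← hF, F.apply_symm_apply, F.apply_symm_apply]
  hom_inv_id := Hom.ext <| funext fun g ↦ by
    refine (Finsupp.apply_linearCombination A.carrier F.symm.toLinearMap (idFun A Y.idem)
      (F (Finsupp.single g (A.e (X.idem g))))).symm.trans ?_
    rw [linComb_id _ _ fun g' ↦ (hdeg g g').2.2]
    exact F.symm_apply_apply _
  inv_hom_id := Hom.ext <| funext fun g ↦ by
    refine (Finsupp.apply_linearCombination A.carrier F.toLinearMap (idFun A X.idem)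
      (F.symm (Finsupp.single g (A.e (Y.idem g))))).symm.trans ?_
    rw [linComb_id _ _ fun g' ↦ (hdeg' g g').2.2]
    exact F.apply_symm_apply _

/-- The Type D structure with one generator, and with vanishing `δ¹`. -/
def point (A : DGAlgebra ι G) (f : G →+ M) (x : ι) (h : ℤ) (m : M) : TypeD A f where
  gen := Unit
  idem _ := x
  mas _ := h
  alex _ := m
  δ _ := 0
  δ_mem _ _ := zero_mem _
  δ_δ _ := map_zero _

lemma point_isFGBounded (x : ι) (h : ℤ) (m : M) : (point A f x h m).IsFGBounded := by
  refine ⟨inferInstanceAs (Finite Unit), 1, fun k hk g ↦ ?_⟩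
  obtain ⟨k, rfl⟩ := Nat.exists_eq_add_of_le' hk
  rfl

namespace IsKernelVector

variable {X : TypeD A f} {c : X.gen →₀ ZMod 2} {g₀ : X.gen}

lemma eq_one (g : X.gen) (h : c g ≠ 0) : c g = 1 :=
  (by decide : ∀ r : ZMod 2, r ≠ 0 → r = 1) _ h

/-- Homogeneity of `c` makes elimination degree-preserving: `g₀` is replaced only by generators with
the same idempotent and bidegree. -/
lemma elim_mem (hc : IsKernelVector X c g₀) {x : ι} {h : ℤ} {m : M} (w : X.gen →₀ A.carrier)
    (hw : ∀ g, w g ∈ A.piece f x (X.idem g) (h - X.mas g) (m - X.alex g)) (g : {g // g ≠ g₀}) :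
    elim A.carrier c g₀ w g ∈ A.piece f x (X.idem g) (h - X.mas g) (m - X.alex g) := by
  rw [elim_apply]
  refine add_mem (hw g) ?_
  by_cases h0 : c g = 0
  · rw [h0, map_zero, mul_zero]
    exact zero_mem _
  · rw [eq_one _ h0, map_one, mul_one]
    obtain ⟨h1, h2, h3⟩ := hc.homog g h0
    rw [h1, h2, h3]
    exact hw g₀

/-- The span of `c` is a dg submodule of `A ⊗ X`, because `δ¹ c = 0` and `d` kills the coefficients
of `c`. The differential therefore descends to the quotient. -/
lemma diff_elim (hc : IsKernelVector X c g₀) (w : X.gen →₀ A.carrier) :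
    A.diff (fun g : {g // g ≠ g₀} ↦ elim A.carrier c g₀ (X.δ g)) (elim A.carrier c g₀ w) =
      elim A.carrier c g₀ (A.diff X.δ w) := by
  have h1 := linearCombination_elim (R := A.carrier) hc.coeff
    (F := fun g ↦ elim A.carrier c g₀ (X.δ g))
    (by
      refine (Finsupp.apply_linearCombination A.carrier (elim A.carrier c g₀) X.δ _).symm.trans ?_
      rw [hc.δ, map_zero]) w
  have h2 : Finsupp.linearCombination A.carrier (fun g ↦ elim A.carrier c g₀ (X.δ g)) w = _ :=
    (Finsupp.apply_linearCombination A.carrier (elim A.carrier c g₀) X.δ w).symm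
  have h3 := elim_mapRange (R := A.carrier) c g₀ A.d w
  exact (congrArg₂ (· + ·) h3.symm (h1.trans h2)).trans (map_add _ _ _).symm

/-- The desuspension of the quotient of `X` by the kernel vector `c`. -/
def quot (hc : IsKernelVector X c g₀) : TypeD A f where
  gen := {g // g ≠ g₀}
  idem g := X.idem g
  -- The `+ 1` is undone by the shift that the mapping cone applies to its source.
  mas g := X.mas g + 1
  alex g := X.alex g
  δ g := elim A.carrier c g₀ (X.δ g)
  δ_mem g g' := DGAlgebra.piece_congr (hc.elim_mem (X.δ g) (X.δ_mem g) g') (by ring) rfl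
  δ_δ g := by rw [hc.diff_elim, X.δ_δ, map_zero]

/-- This is what transfers boundedness from `X` to the quotient. -/
lemma iter_quot (hc : IsKernelVector X c g₀) (k : ℕ) (g : hc.quot.gen) :
    hc.quot.iter k g = elim (TensorAlgebra (ZMod 2) A.carrier) c g₀ (X.iter k g.1) := by
  induction k generalizing g with
  | zero =>
    exact (elim_single g.2 1).symm
  | succ k ih =>
    -- The iterate `(δ¹)ᵏ` sends `c` to zero modulo `c`: for `k = 0` it returns `c` itself, and for
    -- `k > 0` it already vanishes since `δ¹ c = 0`.
    have h0 : elim (TensorAlgebra (ZMod 2) A.carrier) c g₀ (Finsupp.linearCombination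
        (TensorAlgebra (ZMod 2) A.carrier) (X.iter k) (extendScalars _ c)) = 0 := by
      cases k with
      | zero =>
        have : Finsupp.linearCombination (TensorAlgebra (ZMod 2) A.carrier) (X.iter 0)
            (extendScalars _ c) = extendScalars _ c := by
          simp [iter, Finsupp.linearCombination_apply]
        rw [this, elim_extendScalars hc.coeff]
      | succ k =>
        rw [linearCombination_extendScalars, linearCombination_iter_succ,
          ← linearCombination_extendScalars (R := A.carrier), hc.δ, Finsupp.sum_zero_index,
          map_zero]
    have h1 := linearCombination_elim (R := TensorAlgebra (ZMod 2) A.carrier) hc.coeff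
      (F := fun g ↦ elim (TensorAlgebra (ZMod 2) A.carrier) c g₀ (X.iter k g))
      ((Finsupp.apply_linearCombination _ (elim (TensorAlgebra (ZMod 2) A.carrier) c g₀)
        (X.iter k) _).symm.trans h0)
      (Finsupp.mapRange.linearMap (TensorAlgebra.ι (ZMod 2)) (X.δ g.1))
    have h2 : ∀ {α N : Type} [AddCommGroup N] [Module (TensorAlgebra (ZMod 2) A.carrier) N]
        (F : α → N) (w : α →₀ A.carrier), Finsupp.linearCombination
          (TensorAlgebra (ZMod 2) A.carrier) F
          (Finsupp.mapRange.linearMap (TensorAlgebra.ι (ZMod 2)) w) =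
        w.sum fun g a ↦ TensorAlgebra.ι (ZMod 2) a • F g := fun F w ↦ by
      rw [Finsupp.linearCombination_apply, Finsupp.mapRange.linearMap_apply,
        Finsupp.sum_mapRange_index (by simp)]
    rw [elim_mapRange, h2, h2] at h1
    have h3 : hc.quot.iter k =
      fun g ↦ elim (TensorAlgebra (ZMod 2) A.carrier) c g₀ (X.iter k g.1) := funext ih
    change (elim A.carrier c g₀ (X.δ g.1)).sum
      (fun g' a ↦ TensorAlgebra.ι (ZMod 2) a • hc.quot.iter k g') = _
    rw [h3, iter, map_finsuppSum]
    simp only [map_smul]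
    exact h1

lemma quot_isFGBounded (hc : IsKernelVector X c g₀) (hX : X.IsFGBounded) :
    hc.quot.IsFGBounded := by
  obtain ⟨hfin, k₀, hk⟩ := hX
  exact ⟨inferInstanceAs (Finite {g // g ≠ g₀}), k₀, fun k hk' g ↦
    (hc.iter_quot k g).trans (by rw [hk k hk', map_zero]; rfl)⟩

lemma linearCombination_single_apply (w : X.gen →₀ A.carrier) :
    Finsupp.linearCombination A.carrier (fun g ↦ Finsupp.single () (X.δ g g₀)) w =
      Finsupp.single () (Finsupp.linearCombination A.carrier X.δ w g₀) := by
  refine (Finsupp.apply_linearCombination A.carrier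
    (Finsupp.lsingle () ∘ₗ Finsupp.lapply g₀) X.δ w).symm.trans ?_
  rfl

lemma linearCombination_single_elim (hc : IsKernelVector X c g₀) (w : X.gen →₀ A.carrier) :
    Finsupp.linearCombination A.carrier (fun g : {g // g ≠ g₀} ↦ Finsupp.single () (X.δ g g₀))
      (elim A.carrier c g₀ w) =
      Finsupp.single () (Finsupp.linearCombination A.carrier X.δ w g₀) := by
  rw [linearCombination_elim (F := fun g ↦ Finsupp.single () (X.δ g g₀)) hc.coeff,
    linearCombination_single_apply]
  rw [linearCombination_single_apply, hc.δ, Finsupp.zero_apply, Finsupp.single_zero]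

lemma diff_point (x : ι) (h : ℤ) (m : M) (a : A.carrier) :
    A.diff (point A f x h m).δ (Finsupp.single () a) = Finsupp.single () (A.d a) := by
  refine (DGAlgebra.diff_single (point A f x h m).δ () a).trans ?_
  exact (congrArg (fun v : Unit →₀ A.carrier ↦ Finsupp.single () (A.d a) + v)
    (smul_zero a)).trans (add_zero _)

/-- The attaching map of the quotient of `X` by `c` to the span of `c`. -/
def attach (hc : IsKernelVector X c g₀) :
    hc.quot ⟶ point A f (X.idem g₀) (X.mas g₀) (X.alex g₀) where
  toFun g := Finsupp.single () (X.δ g.1 g₀)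
  deg g g' := by
    have : (Finsupp.single () (X.δ g.1 g₀) : Unit →₀ A.carrier) g' = X.δ g.1 g₀ :=
      Finsupp.single_eq_same
    exact this ▸ DGAlgebra.piece_congr (X.δ_mem g.1 g₀)
      (by simp only [quot, point]; ring) rfl
  closed := by
    funext g
    -- The cycle condition for the attaching map is the `g₀`-component of the structure equation of
    -- `X`.
    have h1 := DFunLike.congr_fun (X.δ_δ g.1) g₀
    have h2 := hc.linearCombination_single_elim (X.δ g.1)
    refine (congrArg₂ (fun a b : Unit →₀ A.carrier ↦ a + b) (diff_point _ _ _ _) h2).trans ?_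
    refine (Finsupp.single_add _ _ _).symm.trans ?_
    exact (congrArg _ h1).trans (Finsupp.single_zero _)

/-- The change of basis that splits off the kernel vector. -/
def splitEquiv (hc : IsKernelVector X c g₀) :
    (X.gen →₀ A.carrier) ≃ₗ[A.carrier] ({g // g ≠ g₀} ⊕ Unit →₀ A.carrier) :=
  -- The new basis is `c` together with the generators other than `g₀`; the `c`-coordinate of `w` is
  -- `w g₀`.
  LinearEquiv.ofLinearMap
    (Finsupp.lmapDomain A.carrier A.carrier Sum.inl ∘ₗ elim A.carrier c g₀ +
      Finsupp.lsingle (Sum.inr ()) ∘ₗ Finsupp.lapply g₀)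
    (Finsupp.linearCombination A.carrier (Sum.elim (fun g ↦ Finsupp.single g.1 1)
      fun _ ↦ extendScalars A.carrier c))
    (by
      refine Finsupp.lhom_ext' fun g ↦ LinearMap.ext_ring ?_
      rcases g with g | g
      · simp [elim_single g.2, g.2]
      · have h1 : extendScalars A.carrier c g₀ = 1 := by simp [extendScalars, hc.coeff]
        simp [elim_extendScalars hc.coeff, h1])
    (by
      refine LinearMap.ext fun w ↦ ?_
      refine Eq.trans ?_ (linearCombination_single_elim_add (R := A.carrier) hc.coeff w)
      simp only [LinearMap.comp_apply, LinearMap.add_apply, map_add, Finsupp.lmapDomain_apply,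
        Finsupp.linearCombination_mapDomain, Finsupp.lsingle_apply, Finsupp.lapply_apply,
        Finsupp.linearCombination_single]
      rfl)

lemma splitEquiv_apply (hc : IsKernelVector X c g₀) (w : X.gen →₀ A.carrier) :
    hc.splitEquiv w = Finsupp.sumElim (elim A.carrier c g₀ w) (Finsupp.single () (w g₀)) := by
  rw [Finsupp.sumElim_eq_add, Finsupp.mapDomain_single]
  rfl

lemma splitEquiv_symm_single (hc : IsKernelVector X c g₀) (g : {g // g ≠ g₀} ⊕ Unit)
    (a : A.carrier) : hc.splitEquiv.symm (Finsupp.single g a) =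
      a • Sum.elim (fun g ↦ Finsupp.single g.1 1) (fun _ ↦ extendScalars A.carrier c) g :=
  Finsupp.linearCombination_single _ _ _

/-- `X` is the mapping cone of the attaching map. -/
def splitIso (hc : IsKernelVector X c g₀) : X ≅ cone hc.attach :=
  isoOfLinear hc.splitEquiv
    (by
      intro g g'
      have h := isDeg_id X g
      have e := DFunLike.congr_fun (hc.splitEquiv_apply (Finsupp.single g (A.e (X.idem g)))) g'
      refine Set.mem_of_eq_of_mem e ?_
      rcases g' with g' | g'
      · exact DGAlgebra.piece_congr (hc.elim_mem _ h g')
          (show X.mas g + 0 - X.mas g'.1 = X.mas g + 0 - (X.mas g'.1 + 1 - 1) by omega) rfl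
      · have e' : (Finsupp.single () (idFun A X.idem g g₀) : Unit →₀ A.carrier) g' =
          idFun A X.idem g g₀ := Finsupp.single_eq_same
        exact Set.mem_of_eq_of_mem e' (h g₀))
    (by
      intro g g'
      have e := DFunLike.congr_fun (hc.splitEquiv_symm_single g (A.e ((cone hc.attach).idem g))) g'
      refine Set.mem_of_eq_of_mem e ?_
      rcases g with g | g
      · have e' : (A.e (X.idem g.1) • Finsupp.single g.1 (1 : A.carrier)) g' =
            idFun A X.idem g.1 g' := by
          rw [idFun, Finsupp.smul_single, smul_eq_mul, mul_one]
        exact Set.mem_of_eq_of_mem e' (DGAlgebra.piece_congr (isDeg_id X g.1 g')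
          (show X.mas g.1 + 0 - X.mas g' = X.mas g.1 + 1 - 1 + 0 - X.mas g' by omega) rfl)
      · have e' : (A.e (X.idem g₀) • extendScalars A.carrier c) g' =
          A.e (X.idem g₀) * algebraMap (ZMod 2) A.carrier (c g') := rfl
        refine Set.mem_of_eq_of_mem e' ?_
        by_cases h0 : c g' = 0
        · rw [h0, map_zero, mul_zero]
          exact zero_mem _
        · obtain ⟨h1, h2, h3⟩ := hc.homog g' h0
          rw [eq_one _ h0, map_one, mul_one, h1, h2, h3]
          exact DGAlgebra.piece_congr (DGAlgebra.piece_e _)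
            (show 0 = X.mas g₀ + 0 - X.mas g₀ by omega) (sub_self (X.alex g₀)).symm)
    (by
      intro w
      have e := hc.linearCombination_single_elim w
      refine (congrArg _ (hc.splitEquiv_apply w)).trans ?_
      refine (diff_coneδ hc.attach _ _).trans ?_
      refine Eq.trans ?_ (hc.splitEquiv_apply (A.diff X.δ w)).symm
      refine congrArg₂ Finsupp.sumElim (hc.diff_elim w) ?_
      refine (congrArg₂ (fun a b : Unit →₀ A.carrier ↦ a + b) e (diff_point _ _ _ _)).trans ?_
      rw [← Finsupp.single_add, add_comm]
      rfl)

end IsKernelVector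

/-- The zero Type D structure. -/
def empty (A : DGAlgebra ι G) (f : G →+ M) : TypeD A f where
  gen := Empty
  idem g := g.elim
  mas g := g.elim
  alex g := g.elim
  δ g := g.elim
  δ_mem g := g.elim
  δ_δ g := g.elim

lemma isFGBounded_of_isEmpty (X : TypeD A f) [IsEmpty X.gen] : X.IsFGBounded :=
  ⟨inferInstance, 0, fun _ _ g ↦ isEmptyElim g⟩

/-- Type D structures without generators are isomorphic. -/
def isoOfIsEmpty (X Y : TypeD A f) [IsEmpty X.gen] [IsEmpty Y.gen] :
    X ≅ Y where
  hom := ⟨fun _ ↦ 0, fun g ↦ isEmptyElim g, funext fun g ↦ isEmptyElim g⟩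
  inv := ⟨fun _ ↦ 0, fun g ↦ isEmptyElim g, funext fun g ↦ isEmptyElim g⟩
  hom_inv_id := TypeD.Hom.ext (funext fun g ↦ isEmptyElim g)
  inv_hom_id := TypeD.Hom.ext (funext fun g ↦ isEmptyElim g)

end TypeD

/-- The object of `D^b_M(A)` given by a finitely generated bounded Type D structure. -/
def Db.of {X : TypeD A f} (hX : X.IsFGBounded) : Db A f :=
  ⟨(HoTypeD.of A f).obj X, X, hX, ⟨Iso.refl _⟩⟩

namespace K0

lemma mk_eq_of_iso {X Y : Db A f} (i : X.obj ≅ Y.obj) : mk X = mk Y := by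
  have : Quotient.mk (isIsomorphicSetoid (Db A f)) X = Quotient.mk _ Y :=
    Quotient.sound ⟨(isDb A f).isoMk i⟩
  rw [mk, mk, Db.cls, this]
  rfl

lemma mk_cone {X Y Z : Db A f} (φ : X.obj.as ⟶ Y.obj.as)
    (i : Z.obj ≅ (HoTypeD.of A f).obj (TypeD.cone φ)) : mk X + mk Z = mk Y := by
  have h : X.cls + Z.cls - Y.cls ∈ K0Relations A f := by
    refine AddSubgroup.subset_closure ⟨X, Y, Z, (HoTypeD.of A f).map φ,
      (HoTypeD.of A f).map (TypeD.coneInr φ) ≫ i.inv,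
      i.hom ≫ (HoTypeD.of A f).map (TypeD.coneFst φ), ?_, rfl⟩
    refine ⟨X.obj.as, Y.obj.as, φ, Iso.refl _, Iso.refl _, i, ?_, ?_, ?_⟩
    · exact (Category.comp_id _).trans (Category.id_comp _).symm
    · rw [Category.assoc, i.inv_hom_id]
      exact (Category.comp_id _).trans (Category.id_comp _).symm
    · rw [Iso.refl_hom]
      exact (congrArg _ ((HoTypeD.susp A f).map_id _)).trans (Category.comp_id _)
  rw [← sub_eq_zero]
  exact (QuotientAddGroup.eq_zero_iff _).mpr h

/-- The cone of the identity of `X` is again empty, so the triangle relation reads `[X] + [X] =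
[X]`. -/
lemma mk_of_isEmpty (X : TypeD A f) [IsEmpty X.gen] (hX : X.IsFGBounded) : mk (Db.of hX) = 0 := by
  have : IsEmpty (TypeD.cone (𝟙 X)).gen := inferInstanceAs (IsEmpty (X.gen ⊕ X.gen))
  have h := mk_cone (X := Db.of hX) (Y := Db.of hX) (Z := Db.of hX) (𝟙 X)
    ((HoTypeD.of A f).mapIso (@TypeD.isoOfIsEmpty _ _ _ _ _ _ _ _ X _ _ this))
  exact add_eq_left.mp h

-- The cone of the map from a point to the zero structure is the shifted point, so the homological
-- shift acts by `-1`.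
open TypeD in
lemma mk_point_add (x : ι) (h : ℤ) (m : M) :
    mk (Db.of (point_isFGBounded (A := A) (f := f) x h m)) +
      mk (Db.of (point_isFGBounded (A := A) (f := f) x (h - 1) m)) = 0 := by
  have : IsEmpty (TypeD.empty A f).gen := inferInstanceAs (IsEmpty Empty)
  let φ : point A f x h m ⟶ TypeD.empty A f :=
    ⟨fun _ ↦ 0, fun _ _ ↦ zero_mem _, funext fun _ ↦ Finsupp.ext fun g ↦ isEmptyElim g⟩
  let i : point A f x (h - 1) m ≅ cone φ := isoOfLinear
    { toFun := fun w ↦ Finsupp.sumElim w 0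
      map_add' := fun v w ↦ by
        refine Eq.trans ?_ (Finsupp.sumElim_add v w 0 0)
        rw [add_zero]
        rfl
      map_smul' := fun a w ↦ Finsupp.ext fun g ↦ by
        rcases g with g | g
        · rfl
        · exact isEmptyElim g
      invFun := fun w ↦ w.comapDomain Sum.inl Sum.inl_injective.injOn
      left_inv := fun w ↦ Finsupp.comapDomain_inl_sumElim _ _
      right_inv := fun w ↦ Finsupp.ext fun g ↦ by
        rcases g with g | g
        · rfl
        · exact isEmptyElim g }
    (by
      rintro g (g' | g')
      · exact isDeg_id (point A f x (h - 1) m) g g'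
      · exact isEmptyElim g')
    (by
      rintro (g | g) g'
      · refine Set.mem_of_eq_of_mem ?_ (isDeg_id (point A f x (h - 1) m) g g')
        exact (Finsupp.single_eq_same (a := (Sum.inl () : Unit ⊕ Empty))).trans
          (Finsupp.single_eq_same (a := ())).symm
      · exact isEmptyElim g)
    (fun w ↦ (diff_coneδ φ w 0).trans (congrArg _ (Finsupp.ext fun g ↦ isEmptyElim g)))
  have h1 := mk_cone (X := Db.of (point_isFGBounded (A := A) (f := f) x h m))
    (Z := Db.of (point_isFGBounded (A := A) (f := f) x (h - 1) m))
    (Y := Db.of (isFGBounded_of_isEmpty (TypeD.empty A f))) φ ((HoTypeD.of A f).mapIso i)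
  rwa [mk_of_isEmpty (TypeD.empty A f)] at h1

lemma mk_point_mem_span (x : ι) (h : ℤ) (m : M) :
    mk (Db.of (TypeD.point_isFGBounded (A := A) (f := f) x h m)) ∈
      Submodule.span (AddMonoidAlgebra ℤ M) (Set.range fun x ↦ mk (Db.Q A f x)) := by
  induction h using Int.induction_on with
  | zero =>
    have h1 := single_smul_mk m (Db.Q A f x)
    have h2 : twistObj m (Db.Q A f x) = Db.of (TypeD.point_isFGBounded (A := A) (f := f) x 0 m) :=
      ObjectProperty.FullSubcategory.ext (CategoryTheory.Quotient.ext (by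
        change (TypeD.Q A f x).twist m = TypeD.point A f x 0 m
        simp [TypeD.twist, TypeD.Q, TypeD.point]))
    rw [← h2, ← h1]
    exact Submodule.smul_mem _ _ (Submodule.subset_span ⟨x, rfl⟩)
  | succ k ih =>
    have := mk_point_add (A := A) (f := f) x (k + 1) m
    simp only [add_sub_cancel_right] at this
    rw [eq_neg_of_add_eq_zero_left this]
    exact neg_mem ih
  | pred k ih =>
    have := mk_point_add (A := A) (f := f) x (-k) m
    rw [eq_neg_of_add_eq_zero_right this]
    exact neg_mem ih

/-- Splitting off a kernel vector gives `[X] = [point] - [quot]`, where the quotient is bounded and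
has one generator fewer. -/
lemma mk_of_mem_span (N : ℕ) : ∀ {X : TypeD A f} (hX : X.IsFGBounded), Nat.card X.gen = N →
    mk (Db.of hX) ∈
      Submodule.span (AddMonoidAlgebra ℤ M) (Set.range fun x ↦ mk (Db.Q A f x)) := by
  induction N with
  | zero =>
    intro X hX hN
    have := hX.1
    have : IsEmpty X.gen := (Nat.card_eq_zero.mp hN).resolve_right
      (not_infinite_iff_finite.mpr this)
    rw [mk_of_isEmpty]
    exact zero_mem _
  | succ N ih =>
    intro X hX hN
    have := hX.1
    have : Nonempty X.gen := (Nat.card_pos_iff.mp (by omega)).1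
    obtain ⟨c, g₀, hc⟩ := TypeD.exists_isKernelVector hX
    have h1 := mk_cone (X := Db.of (hc.quot_isFGBounded hX)) (Z := Db.of hX)
      (Y := Db.of (TypeD.point_isFGBounded _ _ _)) hc.attach ((HoTypeD.of A f).mapIso hc.splitIso)
    have h2 : Nat.card {g // g ≠ g₀} = N := by
      classical
      have := Fintype.ofFinite X.gen
      rw [Nat.card_eq_fintype_card] at hN ⊢
      simp [Fintype.card_subtype_compl, hN]
    rw [eq_sub_of_add_eq' h1]
    exact sub_mem (mk_point_mem_span _ _ _) (ih _ h2)

lemma span_Q : Submodule.span (AddMonoidAlgebra ℤ M) (Set.range fun x ↦ mk (Db.Q A f x)) = ⊤ := by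
  rw [eq_top_iff]
  rintro a -
  obtain ⟨a, rfl⟩ := QuotientAddGroup.mk_surjective a
  induction a using FreeAbelianGroup.induction_on with
  | zero => exact zero_mem _
  | of X =>
    induction X using Quotient.inductionOn with
    | h X =>
      obtain ⟨Y, hY, ⟨i⟩⟩ := X.property
      change mk X ∈ _
      rw [mk_eq_of_iso (Y := Db.of hY) i]
      exact mk_of_mem_span _ hY rfl
  | neg X ih => exact neg_mem ih
  | add a b ha hb => exact add_mem ha hb

/-- The classes `[Q_x]` form a basis of the Grothendieck group if `A` has augmentations at all
idempotents. -/
def basisQ (h : ∀ x, ∃ ε, A.IsAugmentation x ε) (f : G →+ M) :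
    Module.Basis ι (AddMonoidAlgebra ℤ M) (K0 A f) :=
  Module.Basis.mk (linearIndependent_Q h) span_Q.ge

lemma basisQ_apply (h : ∀ x, ∃ ε, A.IsAugmentation x ε) (f : G →+ M) (x : ι) :
    basisQ h f x = mk (Db.Q A f x) := by
  rw [basisQ, Module.Basis.mk_apply]

end K0
end Generation

/-! ### Augmentations of `B(n, S)` and of its truncations. -/

section OSz

variable {n : ℕ} {S : Finset (Fin n)}

/-- Membership of a region in `x` is the difference of the counts at two consecutive thresholds. The
strands give the thresholds `1, …, n`, the cardinality gives the threshold `0`, and beyond `n` the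
count is zero. -/
lemma eq_of_vcount_eq {x y : IState n} (hc : x.card = y.card)
    (h : ∀ i, vcount x i = vcount y i) : x = y := by
  classical
  have h1 : ∀ k : ℕ, (x.filter fun a ↦ k ≤ a.val).card = (y.filter fun a ↦ k ≤ a.val).card := by
    intro k
    rcases k with _ | k
    · simpa using hc
    · by_cases hk : k < n
      · have := h ⟨k, hk⟩
        simpa [vcount, Fin.le_def] using this
      · have e : ∀ z : IState n, (z.filter fun a ↦ k + 1 ≤ a.val) = ∅ := fun z ↦
          Finset.filter_eq_empty_iff.mpr fun a _ ↦ by omega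
        rw [e, e]
  have h2 : ∀ (z : IState n) (a : Fin (n + 1)), (z.filter fun b ↦ a.val ≤ b.val).card =
      (z.filter fun b ↦ a.val + 1 ≤ b.val).card + if a ∈ z then 1 else 0 := by
    intro z a
    have e : (z.filter fun b ↦ a.val ≤ b.val) =
        (z.filter fun b ↦ a.val + 1 ≤ b.val) ∪ z.filter fun b ↦ b = a := by
      ext b
      by_cases hb : b ∈ z <;> simp only [hb, Finset.mem_filter, Finset.mem_union, Fin.ext_iff,
        true_and, false_and, or_false]
      omega
    rw [e, Finset.card_union_of_disjoint, Finset.filter_eq']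
    · split_ifs <;> simp
    · rw [Finset.disjoint_filter]
      rintro b _ hb rfl
      omega
  ext a
  have h3 := h2 x a
  have h4 := h2 y a
  rw [h1, h1, h4] at h3
  by_cases hx : a ∈ x <;> by_cases hy : a ∈ y <;> simp_all

lemma IsMono.eq_of_zero {x y : IState n} (h : IsMono x y 0) : x = y := by
  obtain ⟨hc, s, hs⟩ := h
  refine eq_of_vcount_eq hc fun i ↦ ?_
  have := hs i
  simp only [Pi.zero_apply] at this
  omega

lemma JGen.ne_zero {x y : IState n} {t : Fin n → ℕ} (h : JGen x y t) : t ≠ 0 := by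
  rcases h with @⟨x, y, z, i, j⟩ | @⟨x, y, z, i, j⟩ | @⟨x, i⟩ <;> intro e <;>
    have := congrFun e i <;> simp at this

/-- Weights are nonnegative and add, and every generator of `J` has nonzero weight. Hence the
idempotents survive in the quotient. -/
lemma not_inJ_zero (x y : IState n) : ¬ InJ x y 0 := by
  rintro ⟨p, q, a, b, c, -, hb, -, e⟩
  refine hb.ne_zero (funext fun i ↦ ?_)
  have := congrFun e i
  simp only [Pi.zero_apply, Pi.add_apply] at this ⊢
  omega

/-- The monomial `I_x`. -/
def idemMono (S : Finset (Fin n)) (x : IState n) : Mono n S :=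
  ⟨x, x, 0, ∅, IsMono.refl x, not_inJ_zero x x, Finset.empty_subset S⟩

open Classical in
lemma coeff_mon {x' y x : IState n} {t : Fin n → ℕ} {cs : Finset (Fin n)} (h : IsMono x' y t) :
    BAlg.coeff (idemMono S x) (mon S x' y t cs) = if x' = x ∧ t = 0 ∧ cs = ∅ then 1 else 0 := by
  split_ifs with hc
  · obtain ⟨rfl, rfl, rfl⟩ := hc
    obtain rfl := h.eq_of_zero
    have : mon S x' x' 0 ∅ = (idemMono S x').toAlg := rfl
    rw [this, toAlg_eq]
    exact Finsupp.single_eq_same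
  · by_cases h' : IsMono x' y t ∧ ¬ InJ x' y t ∧ cs ⊆ S
    · refine BAlg.coeff_toAlg _ ⟨x', y, t, cs, h'.1, h'.2.1, h'.2.2⟩ fun e ↦ hc ?_
      rw [idemMono, Mono.mk.injEq] at e
      exact ⟨e.1, e.2.2.1, e.2.2.2⟩
    · rw [mon_zero h', map_zero]

/-- A product of two basis monomials is `I_x` only if both have weight zero and no factor `C_i`.
Both are then idempotents, and being composable with product `I_x` they both equal `I_x`. -/
lemma BAlg.coeff_mul (x : IState n) (a b : BAlg n S) :
    BAlg.coeff (idemMono S x) (a * b) =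
      BAlg.coeff (idemMono S x) a * BAlg.coeff (idemMono S x) b := by
  classical
  induction a using BAlg.induction with
  | h0 => simp
  | hadd a a' h h' => rw [add_mul, map_add, map_add, h, h', add_mul]
  | hmon a =>
  induction b using BAlg.induction with
  | h0 => simp
  | hadd b b' h h' => rw [mul_add, map_add, map_add, h, h', mul_add]
  | hmon b =>
  rw [toAlg_mul, Mono.toAlg, Mono.toAlg, coeff_mon a.isMono, coeff_mon b.isMono]
  have ht : a.t + b.t = 0 ↔ a.t = 0 ∧ b.t = 0 := by
    simp only [funext_iff, Pi.add_apply, Pi.zero_apply, Nat.add_eq_zero_iff, forall_and]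
  by_cases h : a.y = b.x ∧ Disjoint a.cs b.cs
  · rw [if_pos h, coeff_mon (a.isMono.add (h.1 ▸ b.isMono)), ite_zero_mul_ite_zero, one_mul]
    simp only [ht, Finset.union_eq_empty]
    refine if_congr ⟨?_, ?_⟩ rfl rfl
    · rintro ⟨h1, ⟨h2, h3⟩, h4, h5⟩
      refine ⟨⟨h1, h2, h4⟩, ?_, h3, h5⟩
      have := a.isMono
      rw [h2] at this
      rw [← h.1, ← this.eq_of_zero, h1]
    · tauto
  · rw [if_neg h, map_zero, ite_zero_mul_ite_zero, one_mul, if_neg]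
    rintro ⟨⟨h1, h2, h3⟩, h4, h5, h6⟩
    refine h ⟨?_, by rw [h3]; exact Finset.disjoint_empty_left _⟩
    have := a.isMono
    rw [h2] at this
    rw [← this.eq_of_zero, h1, h4]

lemma BAlg.coeff_one (x : IState n) : BAlg.coeff (idemMono S x) (1 : BAlg n S) = 1 := by
  classical
  rw [BAlg.one_def, map_sum, Finset.sum_eq_single x]
  · exact (coeff_mon (IsMono.refl x)).trans (if_pos ⟨rfl, rfl, rfl⟩)
  · intro y _ hy
    exact (coeff_mon (IsMono.refl y)).trans (if_neg fun h ↦ hy h.1)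
  · simp

/-- The augmentation of `B(n, S)` at the idempotent `I_x`. -/
def augB (S : Finset (Fin n)) (x : IState n) : BAlg n S →+* ZMod 2 where
  toFun := BAlg.coeff (idemMono S x)
  map_one' := BAlg.coeff_one x
  map_mul' := BAlg.coeff_mul x
  map_zero' := map_zero _
  map_add' := map_add _

/-- Every term of `d a` carries an extra factor `U_i`, so it has positive weight and is never `I_x`;
moreover `I_x` has bidegree zero. -/
lemma isAugmentation_augB (x : IState n) : (OSzB n S).IsAugmentation x (augB S x) where
  d a := by
    classical
    change BAlg.coeff (idemMono S x) (BAlg.d a) = 0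
    induction a using BAlg.induction with
    | h0 => simp
    | hadd a b ha hb => rw [map_add, map_add, ha, hb, add_zero]
    | hmon a =>
      rw [Mono.toAlg, mon_d a.isMono a.subset, map_sum]
      refine Finset.sum_eq_zero fun i _ ↦ ?_
      rw [coeff_mon (a.isMono.add_two i), if_neg]
      rintro ⟨-, h, -⟩
      have := congrFun h i
      simp at this
  e := by
    classical
    exact (coeff_mon (IsMono.refl x)).trans (if_pos ⟨rfl, rfl, rfl⟩)
  gr p hp a ha := by
    refine BAlg.coeff_of_mem_gr (fun h ↦ hp ?_) ha
    rw [← h]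
    refine Prod.ext ?_ (funext fun i ↦ ?_)
    · simp [mdeg, maslov, idemMono]
    · simp [mdeg, alexander, idemMono]

lemma DGAlgebra.IsAugmentation.exists_corner {ι : Type} [Fintype ι] {G : Type} [AddCommGroup G]
    {A : DGAlgebra ι G} (p : ι → Prop) [DecidablePred p] (x : {x // p x})
    {ε : A.carrier →+* ZMod 2} (hε : A.IsAugmentation x ε) :
    ∃ ε', (A.corner p).IsAugmentation x ε' := by
  -- The unit of the corner is `A.eSum p`, not `1`, so unitality of the restricted map has to be
  -- derived from `ε (e x) = 1`.
  have h1 : ε (A.eSum p) = 1 := by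
    have := congrArg ε (A.e_mul_eSum p x)
    rwa [map_mul, hε.e, one_mul] at this
  exact ⟨{ toFun := fun a ↦ ε a.1
           map_one' := h1
           map_mul' := fun a b ↦ map_mul ε a.1 b.1
           map_zero' := map_zero ε
           map_add' := fun a b ↦ map_add ε a.1 b.1 },
    fun a ↦ hε.d a.1, hε.e, fun q hq a ha ↦ hε.gr q hq a.1 ha⟩

lemma exists_isAugmentation_OSzC (side : Side) (n : ℕ) (S : Finset (Fin n)) (x : CState side n) :
    ∃ ε, (OSzC side n S).IsAugmentation x ε :=
  (isAugmentation_augB x.1).exists_corner _ x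

lemma card_CState (side : Side) (n : ℕ) : Fintype.card (CState side n) = 2 ^ n := by
  have h : (Finset.univ.filter fun x : IState n ↦ side.excl n ∉ x) =
      (Finset.univ.erase (side.excl n)).powerset := by
    ext x
    simp [Finset.subset_erase]
  rw [Fintype.card_subtype, h, Finset.card_powerset, Finset.card_erase_of_mem (Finset.mem_univ _),
    Finset.card_univ, Fintype.card_fin, Nat.add_sub_cancel]

end OSz
end
end BorderedDecat

/-! ### The theorem: basis, rank and base change. -/

open BorderedDecat

open scoped TensorProduct

theorem mainTheorem3 (n : ℕ) (S : Finset (Fin n)) (side : Side)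
    {M : Type*} [AddCommGroup M] [Module.Free ℤ M] (f : MY n →+ M) :
    (Nat.card (CState side n) = 2 ^ n ∧
      ∃ b : Module.Basis (CState side n) (AddMonoidAlgebra ℤ M) (K0 (OSzC side n S) f),
        ∀ x, b x = K0.mk (Db.Q (OSzC side n S) f x)) ∧
    (Module.Free (AddMonoidAlgebra ℤ (MY n)) (K0 (OSzC side n S) (AddMonoidHom.id (MY n))) ∧
      Module.rank (AddMonoidAlgebra ℤ (MY n)) (K0 (OSzC side n S) (AddMonoidHom.id (MY n))) =
        2 ^ n) ∧
    (letI : Algebra (AddMonoidAlgebra ℤ (MY n)) (AddMonoidAlgebra ℤ M) :=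
        (AddMonoidAlgebra.mapDomainRingHom ℤ f).toAlgebra
      ∃ φ : AddMonoidAlgebra ℤ M ⊗[AddMonoidAlgebra ℤ (MY n)]
            K0 (OSzC side n S) (AddMonoidHom.id (MY n))
          ≃ₗ[AddMonoidAlgebra ℤ M] K0 (OSzC side n S) f,
        ∀ x, φ (1 ⊗ₜ K0.mk (Db.Q (OSzC side n S) (AddMonoidHom.id (MY n)) x)) =
          K0.mk (Db.Q (OSzC side n S) f x)) := by
  have h := exists_isAugmentation_OSzC side n S
  refine ⟨⟨?_, K0.basisQ h f, K0.basisQ_apply h f⟩,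
    ⟨Module.Free.of_basis (K0.basisQ h (AddMonoidHom.id (MY n))), ?_⟩, ?_⟩
  · rw [Nat.card_eq_fintype_card, card_CState]
  · rw [rank_eq_card_basis (K0.basisQ h (AddMonoidHom.id (MY n))), card_CState]
    norm_cast
  · let _ : Algebra (AddMonoidAlgebra ℤ (MY n)) (AddMonoidAlgebra ℤ M) :=
      (AddMonoidAlgebra.mapDomainRingHom ℤ f).toAlgebra
    -- Both sides have bases indexed by the same idempotent states; the isomorphism matches them.
    refine ⟨((K0.basisQ h (AddMonoidHom.id (MY n))).baseChange (AddMonoidAlgebra ℤ M)).equiv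
      (K0.basisQ h f) (Equiv.refl _), fun x ↦ ?_⟩
    rw [← K0.basisQ_apply h, ← Module.Basis.baseChange_apply, Module.Basis.equiv_apply,
      K0.basisQ_apply]
    rfl
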